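/- Let $\mathbb K$ be an algebraically closed field, $I$ a finite set, and $(I,A,\cdot)$ a Borcherds--Cartan datum: an integer matrix $A=(a_{ij})_{i,j\in I}$ with $a_{ii}\in\{2,0,-2,-4,\dots\}$, $a_{ij}\le 0$ for $i\ne j$, and positive integers $r_i$ with $r_ia_{ij}=r_ja_{ji}=:i\cdot j$. Put $I^+=\{i: a_{ii}=2\}$ (real indices) and $I^-=\{i: a_{ii}\le 0\}$ (imaginary indices). For $\nu\in\mathbb N[I]$ of height $m$ let $\mathrm{Seq}(\nu)$ be the set of sequences $\mathbf i=i_1\cdots i_m$ in $I$ with $i_1+\cdots+i_m=\nu$. Let $R(\nu)$ be the graded unital $\mathbb K$-algebra generated by elements $1_{\mathbf i}$, $x_{k,\mathbf i}$ ($1\le k\le m$), $\tau_{k,\mathbf i}$ ($1\le k<m$), $\mathbf i\in\mathrm{Seq}(\nu)$, of degrees $0$, $2r_{i_k}$, $-i_k\cdot i_{k+1}$, where the $1_{\mathbf i}$ are orthogonal idempotents with sum $1$, $x_{k,\mathbf i}=1_{\mathbf i}x_{k,\mathbf i}1_{\mathbf i}$, $\tau_{k,\mathbf i}=1_{s_k\mathbf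 i}\tau_{k,\mathbf i}1_{\mathbf i}$, and, writing $x_k=\sum_{\mathbf i}x_{k,\mathbf i}$, $\tau_k=\sum_{\mathbf i}\tau_{k,\mathbf i}$, the relations are: $x_kx_l=x_lx_k$; $\tau_kx_l=x_l\tau_k$ for $l\ne k,k+1$; $\tau_k\tau_l=\tau_l\tau_k$ for $|k-l|>1$; $(x_k\tau_k-\tau_kx_{k+1})1_{\mathbf i}=(\tau_kx_k-x_{k+1}\tau_k)1_{\mathbf i}$, which equals $1_{\mathbf i}$ if $i_k=i_{k+1}\in I^+$ and $0$ otherwise; $\tau_k^21_{\mathbf i}$ equals $0$ if $i_k=i_{k+1}$, $1_{\mathbf i}$ if $i_k\neq i_{k+1}$ and $i_k\cdot i_{k+1}=0$, and $(x_k^{-a_{ij}}+x_{k+1}^{-a_{ji}})1_{\mathbf i}$ if $i=i_k\ne j=i_{k+1}$ and $i\cdot j\ne 0$; and $(\tau_k\tau_{k+1}\tau_k-\tau_{k+1}\tau_k\tau_{k+1})1_{\mathbf i}$ equals $\sum_{c=0}^{-a_{ij}-1}x_k^{c}x_{k+2}^{-a_{ij}-1-c}1_{\mathbf i}$ if $i_k=i_{k+2}=i\in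 I^+$, $i_{k+1}=j\neq i$, $i\cdot j\ne0$, and $0$ otherwise. Juxtaposition of diagrams gives a (non-unital) homomorphism $R(\nu)\otimes R(\nu')\to R(\nu+\nu')$ with $1\otimes1\mapsto 1_{\nu,\nu'}=\sum_{\mathbf i\in\mathrm{Seq}(\nu),\,\mathbf j\in\mathrm{Seq}(\nu')}1_{\mathbf i\mathbf j}$. For a graded $R(\nu)\otimes R(\nu')$-module $N$ put $\mathrm{Ind}_{\nu,\nu'}N=R(\nu+\nu')1_{\nu,\nu'}\otimes_{R(\nu)\otimes R(\nu')}N$. For a graded $R(\nu)$-module $M$ and $i\in I$, $n\ge 0$, let $\Delta_{i^n}M=1_{\nu-ni,\,ni}M$, a graded $R(\nu-ni)\otimes R(ni)$-module (zero if $\nu-ni\notin\mathbb N[I]$), and let $\varepsilon_i(M)=\max\{n\ge0:\Delta_{i^n}M\ne0\}$ for $M \neq 0$. Let $V(i^n)$ be the following graded irreducible $R(ni)$-module, generated in degree $0$: for $i\in I^+$ it is the quotient of $R(ni)$ by the left ideal generated by $x_1,\dots,x_n$, and for $i\in I^-$ it is the one-dimensional module on which all $x_k$ and $\tau_k$ act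 by zero. The graded head $\mathrm{hd}\,N$ is the quotient of $N$ by the intersection of its maximal graded submodules. All isomorphisms are degree-preserving isomorphisms of graded modules. Let $i\in I$ (real or imaginary) and let $M$ be a finite-dimensional graded irreducible $R(\nu)$-module with $\varepsilon_i(M)=n$. Then there is a finite-dimensional graded irreducible $R(\nu-ni)$-module $K$ with $\varepsilon_i(K)=0$ and $$\Delta_{i^n}M\simeq K\otimes V(i^n).$$ Moreover, for every finite-dimensional graded irreducible $R(\nu-ni)$-module $K$ with $\varepsilon_i(K)=0$ and $\Delta_{i^n}M\simeq K\otimes V(i^n)$, one has $$M\simeq \mathrm{hd}\,\mathrm{Ind}_{\nu-ni,\,ni}\,K\otimes V(i^n).$$ -/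

import Mathlib

open scoped TensorProduct

universe u v w w'

/-! ### Borcherds--Cartan data -/

/-- A Borcherds--Cartan datum on the index set `I`: an integral matrix `a` with diagonal entries
in `{2, 0, -2, -4, …}`, nonpositive off-diagonal entries, and positive integers `r i` making
`r i * a i j` symmetric. -/
structure BorcherdsCartanDatum (I : Type v) where
  a : Matrix I I ℤ
  r : I → ℤ
  diag : ∀ i, a i i = 2 ∨ (a i i ≤ 0 ∧ Even (a i i))
  offDiag : ∀ i j, i ≠ j → a i j ≤ 0
  r_pos : ∀ i, 0 < r i
  symm : ∀ i j, r i * a i j = r j * a j i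

namespace BorcherdsCartanDatum

variable {I : Type v} (D : BorcherdsCartanDatum I)

/-- The symmetric form `i · j = r_i a_{ij}`. -/
def form (i j : I) : ℤ := D.r i * D.a i j

/-- `i ∈ I⁺`; otherwise `i ∈ I⁻`. -/
def IsReal (i : I) : Prop := D.a i i = 2

/-- The natural number `-a_{ij}` (used for `i ≠ j`, where `a_{ij} ≤ 0`). -/
def negA (i j : I) : ℕ := (-D.a i j).toNat

end BorcherdsCartanDatum

/-! ### The algebras `R(ν)`

A weight `ν ∈ ℕ[I]` is a multiset `ν : Multiset I`; sequences in `I` are lists. -/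

/-- `Seq(ν)`: all sequences in `I` of weight `ν`. -/
def SeqOf {I : Type v} [DecidableEq I] (ν : Multiset I) : Finset (List I) :=
  (Multiset.lists ν).toFinset

/-- The elementary diagrams.  `idem s` is the diagram `1_s` of vertical strands coloured by `s`;
`dot a i b` is the diagram on the sequence `a i b` with a dot on the displayed strand `i`;
`cross a i j b` is the diagram with bottom sequence `a i j b` and top sequence `a j i b` in which
the two displayed strands cross. -/
inductive Diagram (I : Type v) : Type v
  | idem (s : List I)
  | dot (a : List I) (i : I) (b : List I)
  | cross (a : List I) (i j : I) (b : List I)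

namespace Diagram

variable {I : Type v}

/-- The bottom sequence. -/
def bot : Diagram I → List I
  | idem s => s
  | dot a i b => a ++ i :: b
  | cross a i j b => a ++ i :: j :: b

/-- The top sequence. -/
def top : Diagram I → List I
  | idem s => s
  | dot a i b => a ++ i :: b
  | cross a i j b => a ++ j :: i :: b

/-- Add vertical strands `p` on the left and `t` on the right. -/
def pad (p t : List I) : Diagram I → Diagram I
  | idem s => idem (p ++ s ++ t)
  | dot a i b => dot (p ++ a) i (b ++ t)
  | cross a i j b => cross (p ++ a) i j (b ++ t)

/-- The degree of an elementary diagram. -/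
def deg (D : BorcherdsCartanDatum I) : Diagram I → ℤ
  | idem _ => 0
  | dot _ i _ => 2 * D.r i
  | cross _ i j _ => - D.form i j

theorem pad_top (p t : List I) (g : Diagram I) : (g.pad p t).top = p ++ g.top ++ t := by
  cases g <;> simp [Diagram.pad, Diagram.top]

theorem pad_bot (p t : List I) (g : Diagram I) : (g.pad p t).bot = p ++ g.bot ++ t := by
  cases g <;> simp [Diagram.pad, Diagram.bot]

end Diagram

section Relations

variable (k : Type u) [Field k] {I : Type v} [DecidableEq I] (D : BorcherdsCartanDatum I)

/-- `1_s` in the free algebra. -/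
def fE (s : List I) : FreeAlgebra k (Diagram I) := FreeAlgebra.ι k (Diagram.idem s)
/-- A dot in the free algebra. -/
def fX (a : List I) (i : I) (b : List I) : FreeAlgebra k (Diagram I) :=
  FreeAlgebra.ι k (Diagram.dot a i b)
/-- A crossing in the free algebra. -/
def fT (a : List I) (i j : I) (b : List I) : FreeAlgebra k (Diagram I) :=
  FreeAlgebra.ι k (Diagram.cross a i j b)

open Classical in
/-- The right-hand side of the quadratic relation, on the sequence `a i j b`. -/
noncomputable def quadTerm (a : List I) (i j : I) (b : List I) : FreeAlgebra k (Diagram I) :=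
  if i = j then 0
  else if D.form i j = 0 then fE k (a ++ i :: j :: b)
  else fX k a i (j :: b) ^ D.negA i j + fX k (a ++ [i]) j b ^ D.negA j i

open Classical in
/-- The right-hand side of the dot-slide relations, on the sequence `a i j b`. -/
noncomputable def slideTerm (a : List I) (i j : I) (b : List I) : FreeAlgebra k (Diagram I) :=
  if i = j ∧ D.IsReal i then fE k (a ++ i :: j :: b) else 0

open Classical in
/-- The right-hand side of the braid relation, on the sequence `a i j l b`. -/
noncomputable def braidTerm (a : List I) (i j l : I) (b : List I) : FreeAlgebra k (Diagram I) :=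
  if i = l ∧ D.IsReal i ∧ i ≠ j ∧ D.form i j ≠ 0 then
    ∑ c ∈ Finset.range (D.negA i j),
      fX k a i (j :: l :: b) ^ c * fX k (a ++ [i, j]) l b ^ (D.negA i j - 1 - c)
        * fE k (a ++ i :: j :: l :: b)
  else 0

/-- The relations among diagrams that do not involve the weight.  A product `A * B` is the
concatenation with `A` on top of `B`. -/
inductive DiagramRel : FreeAlgebra k (Diagram I) → FreeAlgebra k (Diagram I) → Prop
  -- concatenation with vertical strands
  | idem_self (s : List I) : DiagramRel (fE k s * fE k s) (fE k s)
  | idem_ne (s t : List I) (h : s ≠ t) : DiagramRel (fE k s * fE k t) 0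
  | top_mul (g : Diagram I) :
      DiagramRel (fE k g.top * FreeAlgebra.ι k g) (FreeAlgebra.ι k g)
  | mul_bot (g : Diagram I) :
      DiagramRel (FreeAlgebra.ι k g * fE k g.bot) (FreeAlgebra.ι k g)
  -- planar isotopy: distant dots and crossings slide past each other
  | dot_dot (a : List I) (i : I) (b : List I) (j : I) (c : List I) :
      DiagramRel (fX k a i (b ++ j :: c) * fX k (a ++ i :: b) j c)
        (fX k (a ++ i :: b) j c * fX k a i (b ++ j :: c))
  | dot_cross (a : List I) (l : I) (b : List I) (i j : I) (c : List I) :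
      DiagramRel (fX k a l (b ++ j :: i :: c) * fT k (a ++ l :: b) i j c)
        (fT k (a ++ l :: b) i j c * fX k a l (b ++ i :: j :: c))
  | cross_dot (a : List I) (i j : I) (b : List I) (l : I) (c : List I) :
      DiagramRel (fX k (a ++ j :: i :: b) l c * fT k a i j (b ++ l :: c))
        (fT k a i j (b ++ l :: c) * fX k (a ++ i :: j :: b) l c)
  | cross_cross (a : List I) (i j : I) (b : List I) (l m : I) (c : List I) :
      DiagramRel (fT k (a ++ j :: i :: b) l m c * fT k a i j (b ++ l :: m :: c))
        (fT k a i j (b ++ m :: l :: c) * fT k (a ++ i :: j :: b) l m c)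
  -- local relations
  | quad (a : List I) (i j : I) (b : List I) :
      DiagramRel (fT k a j i b * fT k a i j b) (quadTerm k D a i j b)
  | slide_left (a : List I) (i j : I) (b : List I) :
      DiagramRel (fX k a j (i :: b) * fT k a i j b - fT k a i j b * fX k (a ++ [i]) j b)
        (slideTerm k D a i j b)
  | slide_right (a : List I) (i j : I) (b : List I) :
      DiagramRel (fT k a i j b * fX k a i (j :: b) - fX k (a ++ [j]) i b * fT k a i j b)
        (slideTerm k D a i j b)
  | braid (a : List I) (i j l : I) (b : List I) :
      DiagramRel
        (fT k a j l (i :: b) * fT k (a ++ [j]) i l b * fT k a i j (l :: b)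
          - fT k (a ++ [l]) i j b * fT k a i l (j :: b) * fT k (a ++ [i]) j l b)
        (braidTerm k D a i j l b)

/-- The defining relations of `R(ν)`: those above, and `∑_{s ∈ Seq(ν)} 1_s = 1`.  The latter makes
every diagram `g` whose bottom sequence is not in `Seq(ν)` vanish, since then
`g = g * 1 = ∑_{s ∈ Seq(ν)} g * 1_s = 0`. -/
inductive KLRRel (ν : Multiset I) :
    FreeAlgebra k (Diagram I) → FreeAlgebra k (Diagram I) → Prop
  | rel {x y : FreeAlgebra k (Diagram I)} (h : DiagramRel k D x y) : KLRRel ν x y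
  | one : KLRRel ν (∑ s ∈ SeqOf ν, fE k s) 1

/-- The algebra `R(ν)`. -/
def KLR (ν : Multiset I) : Type (max u v) := RingQuot (KLRRel k D ν)

noncomputable instance KLR.instRing (ν : Multiset I) : Ring (KLR k D ν) :=
  inferInstanceAs (Ring (RingQuot (KLRRel k D ν)))

noncomputable instance KLR.instAlgebra (ν : Multiset I) : Algebra k (KLR k D ν) :=
  inferInstanceAs (Algebra k (RingQuot (KLRRel k D ν)))

end Relations

namespace KLR

open Diagram (pad_top pad_bot)

variable {k : Type u} [Field k] {I : Type v} [DecidableEq I] {D : BorcherdsCartanDatum I}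
variable {ν ν' μ : Multiset I}

/-- The quotient map from the free algebra. -/
noncomputable def mk (ν : Multiset I) : FreeAlgebra k (Diagram I) →ₐ[k] KLR k D ν :=
  RingQuot.mkAlgHom k (KLRRel k D ν)

/-- The class of an elementary diagram. -/
noncomputable def gen (ν : Multiset I) (g : Diagram I) : KLR k D ν := mk ν (FreeAlgebra.ι k g)

/-- The homogeneous component of degree `d`: the span of all products of elementary diagrams of
total degree `d`. -/
noncomputable def grading (k : Type u) [Field k] (D : BorcherdsCartanDatum I) (ν : Multiset I)
    (d : ℤ) : Submodule k (KLR k D ν) :=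
  Submodule.span k {x | ∃ l : List (Diagram I),
    (l.map (Diagram.deg D)).sum = d ∧ x = (l.map (gen ν)).prod}

theorem mem_seqOf {s : List I} : s ∈ SeqOf ν ↔ (s : Multiset I) = ν := by
  simp only [SeqOf, Multiset.mem_toFinset, Multiset.mem_lists_iff, Multiset.quot_mk_to_coe]
  exact eq_comm

theorem mk_surjective : Function.Surjective (mk (k := k) (D := D) ν) :=
  RingQuot.mkAlgHom_surjective k _

theorem mk_rel {x y : FreeAlgebra k (Diagram I)} (h : DiagramRel k D x y) :
    mk (D := D) ν x = mk ν y := RingQuot.mkAlgHom_rel k (KLRRel.rel h)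

theorem sum_idem : ∑ s ∈ SeqOf ν, gen (k := k) (D := D) ν (.idem s) = 1 := by
  have := RingQuot.mkAlgHom_rel k (KLRRel.one (k := k) (D := D) (ν := ν))
  rw [map_sum, map_one] at this
  exact this

theorem idem_mul_idem (s t : List I) :
    gen (k := k) (D := D) ν (.idem s) * gen ν (.idem t) = if s = t then gen ν (.idem s) else 0 := by
  split_ifs with h
  · subst h
    have := mk_rel (D := D) (ν := ν) (DiagramRel.idem_self (k := k) s)
    rwa [map_mul] at this
  · have := mk_rel (D := D) (ν := ν) (DiagramRel.idem_ne (k := k) s t h)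
    rwa [map_mul, map_zero] at this

theorem top_mul_gen (g : Diagram I) :
    gen (k := k) (D := D) ν (.idem g.top) * gen ν g = gen ν g := by
  have := mk_rel (D := D) (ν := ν) (DiagramRel.top_mul (k := k) g)
  rwa [map_mul] at this

theorem gen_mul_bot (g : Diagram I) :
    gen (k := k) (D := D) ν g * gen ν (.idem g.bot) = gen ν g := by
  have := mk_rel (D := D) (ν := ν) (DiagramRel.mul_bot (k := k) g)
  rwa [map_mul] at this

theorem idem_mul_gen (s : List I) (g : Diagram I) :
    gen (k := k) (D := D) ν (.idem s) * gen ν g = if s = g.top then gen ν g else 0 := by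
  rw [← top_mul_gen g, ← mul_assoc, idem_mul_idem]
  split_ifs with h
  · rw [h]
  · simp

theorem gen_mul_idem (s : List I) (g : Diagram I) :
    gen (k := k) (D := D) ν g * gen ν (.idem s) = if g.bot = s then gen ν g else 0 := by
  rw [← gen_mul_bot g, mul_assoc, idem_mul_idem]
  split_ifs with h
  · rfl
  · simp

theorem gen_mul_gen_of_ne {g h : Diagram I} (hne : g.bot ≠ h.top) :
    gen (k := k) (D := D) ν g * gen ν h = 0 := by
  rw [← gen_mul_bot g, mul_assoc, idem_mul_gen, if_neg hne, mul_zero]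

theorem top_mem_iff (g : Diagram I) : g.top ∈ SeqOf ν ↔ g.bot ∈ SeqOf ν := by
  have h : (g.top : Multiset I) = g.bot := by
    cases g with
    | idem s => rfl
    | dot a i b => rfl
    | cross a i j b =>
      exact Multiset.coe_eq_coe.2 (List.Perm.append_left a (List.Perm.swap i j b))
  rw [mem_seqOf, mem_seqOf, h]

/-- Adding vertical strands `p` on the left and `t` on the right, from the free algebra. -/
noncomputable def padFree (k : Type u) [Field k] (D : BorcherdsCartanDatum I) (μ : Multiset I)
    (p t : List I) : FreeAlgebra k (Diagram I) →ₐ[k] KLR k D μ :=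
  FreeAlgebra.lift k fun g => gen μ (g.pad p t)

theorem padFree_ι (p t : List I) (g : Diagram I) :
    padFree k D μ p t (FreeAlgebra.ι k g) = gen μ (g.pad p t) := by
  simp [padFree]

theorem padFree_fE (p t s : List I) :
    padFree k D μ p t (fE k s) = mk μ (fE k (p ++ s ++ t)) := padFree_ι _ _ _

theorem padFree_fX (p t a : List I) (i : I) (b : List I) :
    padFree k D μ p t (fX k a i b) = mk μ (fX k (p ++ a) i (b ++ t)) := padFree_ι _ _ _

theorem padFree_fT (p t a : List I) (i j : I) (b : List I) :
    padFree k D μ p t (fT k a i j b) = mk μ (fT k (p ++ a) i j (b ++ t)) := padFree_ι _ _ _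

theorem padFree_rel (p t : List I) {x y : FreeAlgebra k (Diagram I)} (h : DiagramRel k D x y) :
    padFree k D μ p t x = padFree k D μ p t y := by
  cases h with
  | idem_self s =>
    simpa only [map_mul, padFree_fE] using mk_rel (ν := μ) (DiagramRel.idem_self (k := k) _)
  | idem_ne s t' h =>
    simpa only [map_mul, padFree_fE, map_zero] using
      mk_rel (ν := μ) (DiagramRel.idem_ne (k := k) (p ++ s ++ t) (p ++ t' ++ t) (by simpa using h))
  | top_mul g =>
    rw [map_mul, padFree_ι, padFree_fE, ← pad_top]
    exact top_mul_gen _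
  | mul_bot g =>
    rw [map_mul, padFree_ι, padFree_fE, ← pad_bot]
    exact gen_mul_bot _
  | dot_dot a i b j c =>
    simpa [padFree_fX] using mk_rel (ν := μ) (DiagramRel.dot_dot (k := k) (p ++ a) i b j (c ++ t))
  | dot_cross a l b i j c =>
    simpa [padFree_fX, padFree_fT] using
      mk_rel (ν := μ) (DiagramRel.dot_cross (k := k) (p ++ a) l b i j (c ++ t))
  | cross_dot a i j b l c =>
    simpa [padFree_fX, padFree_fT] using
      mk_rel (ν := μ) (DiagramRel.cross_dot (k := k) (p ++ a) i j b l (c ++ t))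
  | cross_cross a i j b l m c =>
    simpa [padFree_fT] using
      mk_rel (ν := μ) (DiagramRel.cross_cross (k := k) (p ++ a) i j b l m (c ++ t))
  | quad a i j b =>
    have := mk_rel (ν := μ) (DiagramRel.quad (k := k) (D := D) (p ++ a) i j (b ++ t))
    rw [map_mul, padFree_fT, padFree_fT, ← map_mul, this, quadTerm, quadTerm]
    split_ifs <;> simp [padFree_fX, padFree_fE]
  | slide_left a i j b =>
    have := mk_rel (ν := μ) (DiagramRel.slide_left (k := k) (D := D) (p ++ a) i j (b ++ t))
    have h2 : padFree k D μ p t (slideTerm k D a i j b)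
        = mk μ (slideTerm k D (p ++ a) i j (b ++ t)) := by
      rw [slideTerm, slideTerm]
      split_ifs <;> simp [padFree_fE]
    rw [h2, ← this]
    simp [padFree_fX, padFree_fT]
  | slide_right a i j b =>
    have := mk_rel (ν := μ) (DiagramRel.slide_right (k := k) (D := D) (p ++ a) i j (b ++ t))
    have h2 : padFree k D μ p t (slideTerm k D a i j b)
        = mk μ (slideTerm k D (p ++ a) i j (b ++ t)) := by
      rw [slideTerm, slideTerm]
      split_ifs <;> simp [padFree_fE]
    rw [h2, ← this]
    simp [padFree_fX, padFree_fT]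
  | braid a i j l b =>
    have := mk_rel (ν := μ) (DiagramRel.braid (k := k) (D := D) (p ++ a) i j l (b ++ t))
    have h2 : padFree k D μ p t (braidTerm k D a i j l b)
        = mk μ (braidTerm k D (p ++ a) i j l (b ++ t)) := by
      rw [braidTerm, braidTerm]
      split_ifs <;> simp [padFree_fE, padFree_fX]
    rw [h2, ← this]
    simp [padFree_fT]

/-- The idempotent `1_p ⊗ 1_ν ⊗ 1_t` of `R(μ)`. -/
noncomputable def padIdem (k : Type u) [Field k] (D : BorcherdsCartanDatum I) (ν μ : Multiset I)
    (p t : List I) : KLR k D μ := ∑ s ∈ SeqOf ν, gen μ (.idem (p ++ s ++ t))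

theorem padIdem_eq (p t : List I) :
    padIdem k D ν μ p t = padFree k D μ p t (∑ s ∈ SeqOf ν, fE k s) := by
  simp only [padIdem, map_sum, padFree_fE]
  rfl

theorem padIdem_mul_gen (p t : List I) (g : Diagram I) :
    padIdem k D ν μ p t * gen μ (g.pad p t) =
      if g.top ∈ SeqOf ν then gen μ (g.pad p t) else 0 := by
  simp only [padIdem, Finset.sum_mul, idem_mul_gen, pad_top, List.append_left_inj,
    List.append_right_inj, Finset.sum_ite_eq']

theorem gen_mul_padIdem (p t : List I) (g : Diagram I) :
    gen μ (g.pad p t) * padIdem k D ν μ p t =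
      if g.top ∈ SeqOf ν then gen μ (g.pad p t) else 0 := by
  simp only [padIdem, Finset.mul_sum, gen_mul_idem, pad_bot, List.append_left_inj,
    List.append_right_inj, Finset.sum_ite_eq, top_mem_iff]

theorem padIdem_commute (p t : List I) (x : FreeAlgebra k (Diagram I)) :
    Commute (padIdem k D ν μ p t) (padFree k D μ p t x) := by
  induction x using FreeAlgebra.induction with
  | grade0 c => rw [AlgHom.commutes]; exact (Algebra.commutes c _).symm
  | grade1 g =>
    rw [padFree_ι, commute_iff_eq, padIdem_mul_gen, gen_mul_padIdem]
  | mul a b ha hb => rw [map_mul]; exact ha.mul_right hb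
  | add a b ha hb => rw [map_add]; exact ha.add_right hb

theorem padIdem_mul_self (p t : List I) :
    padIdem k D ν μ p t * padIdem k D ν μ p t = padIdem k D ν μ p t := by
  conv_lhs => arg 2; rw [padIdem]
  rw [Finset.mul_sum, padIdem]
  refine Finset.sum_congr rfl fun s hs => ?_
  have := padIdem_mul_gen (k := k) (D := D) (ν := ν) (μ := μ) p t (.idem s)
  rwa [if_pos (show (Diagram.idem s).top ∈ SeqOf ν from hs)] at this

theorem padIdem_isIdem (p t : List I) : IsIdempotentElem (padIdem k D ν μ p t) :=
  padIdem_mul_self p t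

/-- The map `c ↦ 1_p ⊗ c ⊗ 1_t`, as a unital ring homomorphism into a corner. -/
noncomputable def padCorner (k : Type u) [Field k] (D : BorcherdsCartanDatum I) (ν μ : Multiset I)
    (p t : List I) :
    FreeAlgebra k (Diagram I) →+*
      (padIdem_isIdem (k := k) (D := D) (ν := ν) (μ := μ) p t).Corner where
  toFun x := ⟨padIdem k D ν μ p t * padFree k D μ p t x,
    padFree k D μ p t x, by
      change padIdem k D ν μ p t * padFree k D μ p t x * padIdem k D ν μ p t = _
      rw [mul_assoc, ← (padIdem_commute p t x).eq, ← mul_assoc, padIdem_mul_self]⟩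
  map_one' := Subtype.ext (by
    change padIdem k D ν μ p t * padFree k D μ p t 1 = padIdem k D ν μ p t
    rw [map_one, mul_one])
  map_zero' := Subtype.ext (by
    change padIdem k D ν μ p t * padFree k D μ p t 0 = 0
    rw [map_zero, mul_zero])
  map_add' x y := Subtype.ext (by
    change padIdem k D ν μ p t * padFree k D μ p t (x + y) =
      padIdem k D ν μ p t * padFree k D μ p t x + padIdem k D ν μ p t * padFree k D μ p t y
    rw [map_add, mul_add])
  map_mul' x y := Subtype.ext (by
    change padIdem k D ν μ p t * padFree k D μ p t (x * y) =
      (padIdem k D ν μ p t * padFree k D μ p t x)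
      * (padIdem k D ν μ p t * padFree k D μ p t y)
    rw [map_mul, mul_assoc (padIdem k D ν μ p t), ← mul_assoc (padFree k D μ p t x),
      ← (padIdem_commute p t x).eq, ← mul_assoc, ← mul_assoc, ← mul_assoc, padIdem_mul_self])

theorem padCorner_rel (p t : List I) {x y : FreeAlgebra k (Diagram I)} (h : KLRRel k D ν x y) :
    padCorner k D ν μ p t x = padCorner k D ν μ p t y := by
  refine Subtype.ext ?_
  change padIdem k D ν μ p t * padFree k D μ p t x = padIdem k D ν μ p t * padFree k D μ p t y
  cases h with
  | rel h => rw [padFree_rel p t h]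
  | one => rw [← padIdem_eq, padIdem_mul_self, map_one, mul_one]

/-- The underlying function of `padMap`. -/
noncomputable def padFun (k : Type u) [Field k] (D : BorcherdsCartanDatum I) (ν μ : Multiset I)
    (p t : List I) (x : KLR k D ν) : KLR k D μ :=
  (RingQuot.lift ⟨padCorner k D ν μ p t, fun _ _ h => padCorner_rel p t h⟩ x).1

theorem padFun_mk (p t : List I) (x : FreeAlgebra k (Diagram I)) :
    padFun k D ν μ p t (mk ν x) = padIdem k D ν μ p t * padFree k D μ p t x := by
  have h : mk (D := D) ν x = RingQuot.mkRingHom (KLRRel k D ν) x := by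
    rw [← RingQuot.mkAlgHom_coe k]; rfl
  unfold padFun
  rw [h, RingQuot.lift_mkRingHom_apply]
  rfl

/-- The linear map `R(ν) → R(μ)`, `c ↦ 1_p ⊗ c ⊗ 1_t`: it adds vertical strands coloured by `p` on
the left and by `t` on the right. -/
noncomputable def padMap (k : Type u) [Field k] (D : BorcherdsCartanDatum I) (ν μ : Multiset I)
    (p t : List I) : KLR k D ν →ₗ[k] KLR k D μ where
  toFun := padFun k D ν μ p t
  map_add' x y := by
    obtain ⟨x, rfl⟩ := mk_surjective x
    obtain ⟨y, rfl⟩ := mk_surjective y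
    rw [← map_add, padFun_mk, padFun_mk, padFun_mk, map_add, mul_add]
  map_smul' c x := by
    obtain ⟨x, rfl⟩ := mk_surjective x
    rw [← map_smul, padFun_mk, padFun_mk, map_smul, mul_smul_comm, RingHom.id_apply]

theorem padMap_mk (p t : List I) (x : FreeAlgebra k (Diagram I)) :
    padMap k D ν μ p t (mk ν x) = padIdem k D ν μ p t * padFree k D μ p t x := padFun_mk p t x

theorem padMap_one (p t : List I) : padMap k D ν μ p t 1 = padIdem k D ν μ p t := by
  rw [← map_one (mk ν), padMap_mk, map_one, mul_one]

theorem padMap_mul (p t : List I) (x y : KLR k D ν) :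
    padMap k D ν μ p t (x * y) = padMap k D ν μ p t x * padMap k D ν μ p t y := by
  obtain ⟨x, rfl⟩ := mk_surjective x
  obtain ⟨y, rfl⟩ := mk_surjective y
  rw [← map_mul, padMap_mk, padMap_mk, padMap_mk]
  exact congrArg Subtype.val (map_mul (padCorner k D ν μ p t) x y)

theorem padMap_gen (p t : List I) (g : Diagram I) :
    padMap k D ν μ p t (gen ν g) = if g.top ∈ SeqOf ν then gen μ (g.pad p t) else 0 := by
  rw [gen, padMap_mk, padFree_ι, padIdem_mul_gen]

theorem padIdem_mul_of_ne {p t p' t' : List I} (hp : p.length = p'.length)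
    (ht : t.length = t'.length) (hne : ¬(p = p' ∧ t = t')) :
    padIdem k D ν μ p t * padIdem k D ν μ p' t' = 0 := by
  rw [padIdem, padIdem, Finset.sum_mul_sum]
  refine Finset.sum_eq_zero fun s _ => Finset.sum_eq_zero fun s' _ => ?_
  rw [idem_mul_idem, if_neg]
  intro h
  obtain ⟨h1, h2⟩ := List.append_inj' h ht
  exact hne ⟨(List.append_inj h1 hp).1, h2⟩

theorem padMap_mul_of_ne {p t p' t' : List I} (hp : p.length = p'.length)
    (ht : t.length = t'.length) (hne : ¬(p = p' ∧ t = t')) (x y : KLR k D ν) :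
    padMap k D ν μ p t x * padMap k D ν μ p' t' y = 0 := by
  rw [← mul_one x, ← one_mul y, padMap_mul, padMap_mul, padMap_one, padMap_one, mul_assoc,
    ← mul_assoc (padIdem k D ν μ p t), padIdem_mul_of_ne hp ht hne, zero_mul, mul_zero]

theorem length_of_mem {s t : List I} (hs : s ∈ SeqOf ν) (ht : t ∈ SeqOf ν) :
    s.length = t.length := by
  rw [mem_seqOf] at hs ht
  rw [← Multiset.coe_card, ← Multiset.coe_card, hs, ht]

/-- The map `c ↦ c ⊗ 1_{ν'}` from `R(ν)` to `R(μ)`. -/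
noncomputable def padL (k : Type u) [Field k] (D : BorcherdsCartanDatum I) (ν ν' μ : Multiset I) :
    KLR k D ν →ₗ[k] KLR k D μ := ∑ t ∈ SeqOf ν', padMap k D ν μ [] t

/-- The map `c ↦ 1_ν ⊗ c` from `R(ν')` to `R(μ)`. -/
noncomputable def padR (k : Type u) [Field k] (D : BorcherdsCartanDatum I) (ν ν' μ : Multiset I) :
    KLR k D ν' →ₗ[k] KLR k D μ := ∑ s ∈ SeqOf ν, padMap k D ν' μ s []

/-- The idempotent `1_{ν,ν'} = 1_ν ⊗ 1_{ν'}` of `R(μ)`, for `μ = ν + ν'`.  (It is zero for all other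
`μ`.) -/
noncomputable def idem₂ (k : Type u) [Field k] (D : BorcherdsCartanDatum I) (ν ν' μ : Multiset I) :
    KLR k D μ := ∑ s ∈ SeqOf ν, ∑ t ∈ SeqOf ν', gen μ (.idem (s ++ t))

/-- The linear map `R(ν) ⊗ R(ν') → R(μ)` for `μ = ν + ν'`, `a ⊗ b ↦ (a ⊗ 1_{ν'})(1_ν ⊗ b)`, that
places diagrams side by side. -/
noncomputable def juxt (k : Type u) [Field k] (D : BorcherdsCartanDatum I) (ν ν' μ : Multiset I) :
    KLR k D ν ⊗[k] KLR k D ν' →ₗ[k] KLR k D μ :=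
  LinearMap.mul' k (KLR k D μ) ∘ₗ TensorProduct.map (padL k D ν ν' μ) (padR k D ν ν' μ)

theorem juxt_tmul (a : KLR k D ν) (b : KLR k D ν') :
    juxt k D ν ν' μ (a ⊗ₜ b) = padL k D ν ν' μ a * padR k D ν ν' μ b := by
  simp [juxt]

theorem padL_mul (x y : KLR k D ν) :
    padL k D ν ν' μ (x * y) = padL k D ν ν' μ x * padL k D ν ν' μ y := by
  simp only [padL, LinearMap.sum_apply, Finset.sum_mul_sum]
  refine Finset.sum_congr rfl fun t ht => ?_
  rw [Finset.sum_eq_single_of_mem t ht, padMap_mul]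
  intro t' ht' hne
  exact padMap_mul_of_ne rfl (length_of_mem ht ht') (fun h => hne h.2.symm) _ _

theorem padR_mul (x y : KLR k D ν') :
    padR k D ν ν' μ (x * y) = padR k D ν ν' μ x * padR k D ν ν' μ y := by
  simp only [padR, LinearMap.sum_apply, Finset.sum_mul_sum]
  refine Finset.sum_congr rfl fun t ht => ?_
  rw [Finset.sum_eq_single_of_mem t ht, padMap_mul]
  intro t' ht' hne
  exact padMap_mul_of_ne (length_of_mem ht ht') rfl (fun h => hne h.1.symm) _ _

theorem padL_one : padL k D ν ν' μ 1 = idem₂ k D ν ν' μ := by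
  simp only [padL, LinearMap.sum_apply, padMap_one, padIdem, idem₂, List.nil_append]
  exact Finset.sum_comm

theorem padR_one : padR k D ν ν' μ 1 = idem₂ k D ν ν' μ := by
  simp only [padR, LinearMap.sum_apply, padMap_one, padIdem, idem₂, List.append_nil]

theorem padL_gen (g : Diagram I) : padL k D ν ν' μ (gen ν g) =
    if g.top ∈ SeqOf ν then ∑ t ∈ SeqOf ν', gen μ (g.pad [] t) else 0 := by
  simp only [padL, LinearMap.sum_apply, padMap_gen]
  split_ifs <;> simp

theorem padR_gen (h : Diagram I) : padR k D ν ν' μ (gen ν' h) =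
    if h.top ∈ SeqOf ν' then ∑ s ∈ SeqOf ν, gen μ (h.pad s []) else 0 := by
  simp only [padR, LinearMap.sum_apply, padMap_gen]
  split_ifs <;> simp

theorem interchange (g h : Diagram I) :
    gen (k := k) (D := D) μ (g.pad [] h.top) * gen μ (h.pad g.bot []) =
      gen μ (h.pad g.top []) * gen μ (g.pad [] h.bot) := by
  have rel : ∀ {x y : FreeAlgebra k (Diagram I)}, DiagramRel k D x y →
    mk (D := D) μ x = mk μ y := mk_rel
  cases g with
  | idem s =>
    have h1 := top_mul_gen (k := k) (D := D) (ν := μ) (h.pad s [])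
    have h2 := gen_mul_bot (k := k) (D := D) (ν := μ) (h.pad s [])
    simp only [pad_top, pad_bot, List.append_nil] at h1 h2
    simpa [Diagram.pad, Diagram.bot, Diagram.top] using h1.trans h2.symm
  | dot a i b =>
    cases h with
    | idem s =>
      have h1 := top_mul_gen (k := k) (D := D) (ν := μ) (.dot a i (b ++ s))
      have h2 := gen_mul_bot (k := k) (D := D) (ν := μ) (.dot a i (b ++ s))
      simpa [Diagram.pad, Diagram.bot, Diagram.top] using h2.trans h1.symm
    | dot a' j b' =>
      simpa [Diagram.pad, Diagram.bot, Diagram.top, gen, fX] using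
        rel (DiagramRel.dot_dot a i (b ++ a') j b')
    | cross a' j l b' =>
      simpa [Diagram.pad, Diagram.bot, Diagram.top, gen, fX, fT] using
        rel (DiagramRel.dot_cross a i (b ++ a') j l b')
  | cross a i j b =>
    cases h with
    | idem s =>
      have h1 := top_mul_gen (k := k) (D := D) (ν := μ) (.cross a i j (b ++ s))
      have h2 := gen_mul_bot (k := k) (D := D) (ν := μ) (.cross a i j (b ++ s))
      simpa [Diagram.pad, Diagram.bot, Diagram.top] using h2.trans h1.symm
    | dot a' l b' =>
      simpa [Diagram.pad, Diagram.bot, Diagram.top, gen, fX, fT] using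
        (rel (DiagramRel.cross_dot a i j (b ++ a') l b')).symm
    | cross a' l m b' =>
      simpa [Diagram.pad, Diagram.bot, Diagram.top, gen, fT] using
        (rel (DiagramRel.cross_cross a i j (b ++ a') l m b')).symm

theorem padL_padR_gen (g h : Diagram I) :
    padL k D ν ν' μ (gen ν g) * padR k D ν ν' μ (gen ν' h) =
      padR k D ν ν' μ (gen ν' h) * padL k D ν ν' μ (gen ν g) := by
  rw [padL_gen, padR_gen]
  split_ifs with hg hh hh
  · have hg' := (top_mem_iff g).1 hg
    have hh' := (top_mem_iff h).1 hh
    rw [Finset.sum_mul_sum, Finset.sum_mul_sum]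
    rw [Finset.sum_eq_single_of_mem h.top hh, Finset.sum_eq_single_of_mem g.bot hg',
      Finset.sum_eq_single_of_mem g.top hg, Finset.sum_eq_single_of_mem h.bot hh']
    · exact interchange g h
    · intro t ht hne
      refine gen_mul_gen_of_ne ?_
      rw [pad_bot, pad_top]
      simpa using Ne.symm hne
    · intro s hs hne
      refine Finset.sum_eq_zero fun t ht => gen_mul_gen_of_ne ?_
      rw [pad_bot, pad_top]
      intro he
      simp only [List.nil_append, List.append_nil] at he
      exact hne (List.append_inj he (length_of_mem hs hg)).1
    · intro s hs hne
      refine gen_mul_gen_of_ne ?_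
      rw [pad_bot, pad_top]
      simpa using Ne.symm hne
    · intro t ht hne
      refine Finset.sum_eq_zero fun s hs => gen_mul_gen_of_ne ?_
      rw [pad_bot, pad_top]
      intro he
      simp only [List.nil_append, List.append_nil] at he
      exact hne (List.append_inj he (length_of_mem hg' hs)).2
  · simp
  · simp
  · simp

theorem padL_padR_comm (x : KLR k D ν) (y : KLR k D ν') :
    Commute (padL k D ν ν' μ x) (padR k D ν ν' μ y) := by
  obtain ⟨x, rfl⟩ := mk_surjective x
  obtain ⟨y, rfl⟩ := mk_surjective y
  have key : ∀ x, padL k D ν ν' μ x * idem₂ k D ν ν' μ = idem₂ k D ν ν' μ * padL k D ν ν' μ x := by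
    intro x
    rw [← padL_one, ← padL_mul, ← padL_mul, mul_one, one_mul]
  have key' : ∀ y, padR k D ν ν' μ y * idem₂ k D ν ν' μ = idem₂ k D ν ν' μ * padR k D ν ν' μ y := by
    intro x
    rw [← padR_one, ← padR_mul, ← padR_mul, mul_one, one_mul]
  induction x using FreeAlgebra.induction with
  | grade0 c =>
    rw [AlgHom.commutes, Algebra.algebraMap_eq_smul_one, map_smul, padL_one]
    exact (show Commute _ _ from (key' _).symm).smul_left c
  | mul a b ha hb => rw [map_mul, padL_mul]; exact ha.mul_left hb
  | add a b ha hb => rw [map_add, map_add]; exact ha.add_left hb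
  | grade1 g =>
    induction y using FreeAlgebra.induction with
    | grade0 c =>
      rw [AlgHom.commutes, Algebra.algebraMap_eq_smul_one, map_smul, padR_one]
      exact (show Commute _ _ from key _).smul_right c
    | mul a b ha hb => rw [map_mul, padR_mul]; exact ha.mul_right hb
    | add a b ha hb => rw [map_add, map_add]; exact ha.add_right hb
    | grade1 h => exact padL_padR_gen g h

theorem juxt_mul (x y : KLR k D ν ⊗[k] KLR k D ν') :
    juxt k D ν ν' μ (x * y) = juxt k D ν ν' μ x * juxt k D ν ν' μ y := by
  induction x using TensorProduct.induction_on with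
  | zero => simp
  | add a b ha hb => rw [add_mul, map_add, map_add, ha, hb, add_mul]
  | tmul a b =>
    induction y using TensorProduct.induction_on with
    | zero => simp
    | add a b ha hb => rw [mul_add, map_add, map_add, ha, hb, mul_add]
    | tmul c d =>
      rw [Algebra.TensorProduct.tmul_mul_tmul, juxt_tmul, juxt_tmul, juxt_tmul, padL_mul, padR_mul,
        mul_assoc, mul_assoc, ← mul_assoc (padL k D ν ν' μ c), (padL_padR_comm c b).eq]
      simp only [mul_assoc]

theorem juxt_one : juxt k D ν ν' μ 1 = idem₂ k D ν ν' μ := by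
  rw [Algebra.TensorProduct.one_def, juxt_tmul, padL_one]
  nth_rewrite 1 [← padR_one]
  rw [← padR_mul, one_mul, padR_one]

theorem idem₂_mul_juxt (x : KLR k D ν ⊗[k] KLR k D ν') :
    idem₂ k D ν ν' μ * juxt k D ν ν' μ x = juxt k D ν ν' μ x := by
  rw [← juxt_one, ← juxt_mul, one_mul]

end KLR

/-! ### Modules with a grading -/

/-- A left module over the `k`-algebra `A` with a family of subspaces indexed by `ℤ`, its
candidate homogeneous components.  See `GrMod.IsGraded` for the axioms of a graded module. -/
structure GrMod (k : Type u) [Field k] (A : Type v) [Ring A] [Algebra k A] where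
  carrier : Type w
  [addCommGroup : AddCommGroup carrier]
  [moduleBase : Module k carrier]
  [module : Module A carrier]
  [tower : IsScalarTower k A carrier]
  deg : ℤ → Submodule k carrier

namespace GrMod

attribute [instance] GrMod.addCommGroup GrMod.moduleBase GrMod.module GrMod.tower

section General

variable {k : Type u} [Field k] {A : Type v} [Ring A] [Algebra k A]

/-- `M` is a graded module over the algebra `A` with homogeneous components `𝒜 d`: it is the direct
sum of its components and `𝒜_a M_b ⊆ M_{a+b}`. -/
def IsGraded (𝒜 : ℤ → Submodule k A) (M : GrMod.{u, v, w} k A) : Prop :=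
  DirectSum.IsInternal M.deg ∧
    ∀ a b : ℤ, ∀ x ∈ 𝒜 a, ∀ m ∈ M.deg b, x • m ∈ M.deg (a + b)

/-- A graded submodule: every element is a sum of homogeneous elements of the submodule. -/
def IsHomogeneous (M : GrMod.{u, v, w} k A) (W : Submodule A M.carrier) : Prop :=
  W.restrictScalars k = ⨆ d : ℤ, W.restrictScalars k ⊓ M.deg d

/-- A gr-irreducible module: nonzero, and without proper nonzero graded submodules. -/
def GrIrreducible (M : GrMod.{u, v, w} k A) : Prop :=
  Nontrivial M.carrier ∧ ∀ W : Submodule A M.carrier, M.IsHomogeneous W → W = ⊥ ∨ W = ⊤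

/-- Isomorphism of graded modules (of degree zero). -/
def Iso (M : GrMod.{u, v, w} k A) (N : GrMod.{u, v, w'} k A) : Prop :=
  ∃ e : M.carrier ≃ₗ[A] N.carrier, ∀ (d : ℤ) (m : M.carrier), m ∈ M.deg d ↔ e m ∈ N.deg d

/-- A maximal graded submodule. -/
def IsMaxGraded (M : GrMod.{u, v, w} k A) (W : Submodule A M.carrier) : Prop :=
  M.IsHomogeneous W ∧ W ≠ ⊤ ∧
    ∀ W' : Submodule A M.carrier, M.IsHomogeneous W' → W < W' → W' = ⊤

/-- The graded radical: the intersection of all maximal graded submodules. -/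
def grRadical (M : GrMod.{u, v, w} k A) : Submodule A M.carrier := sInf {W | M.IsMaxGraded W}

/-- The quotient by a submodule, with the images of the homogeneous components. -/
def quot (M : GrMod.{u, v, w} k A) (W : Submodule A M.carrier) : GrMod.{u, v, w} k A where
  carrier := M.carrier ⧸ W
  deg d := (M.deg d).map (W.mkQ.restrictScalars k)

/-- The graded head `hd M = M / J^gr M`. -/
def head (M : GrMod.{u, v, w} k A) : GrMod.{u, v, w} k A := M.quot M.grRadical

variable {B : Type v} [Ring B] [Algebra k B]

/-- The action of `A ⊗ B` on `M ⊗ N`, `(a ⊗ b)(m ⊗ n) = am ⊗ bn`. -/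
noncomputable def outerAction (M : GrMod.{u, v, w} k A) (N : GrMod.{u, v, w'} k B) :
    A ⊗[k] B →ₐ[k] Module.End k (M.carrier ⊗[k] N.carrier) :=
  Module.endTensorEndAlgHom.comp
    (Algebra.TensorProduct.map (Algebra.lsmul k k M.carrier) (Algebra.lsmul k k N.carrier))

/-- The outer tensor product: the graded `A ⊗ B`-module `M ⊗ N`. -/
noncomputable def outer (M : GrMod.{u, v, w} k A) (N : GrMod.{u, v, w'} k B) :
    GrMod.{u, v, max w w'} k (A ⊗[k] B) :=
  letI act : Module (A ⊗[k] B) (M.carrier ⊗[k] N.carrier) :=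
    Module.compHom _ (outerAction M N).toRingHom
  { carrier := M.carrier ⊗[k] N.carrier
    module := act
    tower := ⟨fun c x m => by
      change outerAction M N (c • x) m = c • outerAction M N x m
      rw [map_smul, LinearMap.smul_apply]⟩
    deg := fun d => Submodule.span k
      {z | ∃ a b : ℤ, a + b = d ∧ ∃ m ∈ M.deg a, ∃ n ∈ N.deg b, z = m ⊗ₜ[k] n} }

theorem outer_smul_tmul (M : GrMod.{u, v, w} k A) (N : GrMod.{u, v, w'} k B) (a : A) (b : B)
    (m : M.carrier) (n : N.carrier) :
    ((a ⊗ₜ[k] b) • (show (outer M N).carrier from m ⊗ₜ[k] n)) =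
      (show (outer M N).carrier from (a • m) ⊗ₜ[k] (b • n)) := rfl

end General

section KLR

variable {k : Type u} [Field k] {I : Type v} [DecidableEq I] {D : BorcherdsCartanDatum I}
variable {μ : Multiset I}

open KLR

/-- The subspace `1_{ν,ν'} M`. -/
noncomputable def resSpace (ν ν' : Multiset I) (M : GrMod.{u, max u v, w} k (KLR k D μ)) :
    Submodule k M.carrier :=
  LinearMap.range (Algebra.lsmul k k M.carrier (idem₂ k D ν ν' μ))

theorem juxt_smul_mem (ν ν' : Multiset I) (M : GrMod.{u, max u v, w} k (KLR k D μ))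
    (x : KLR k D ν ⊗[k] KLR k D ν') (m : M.carrier) :
    juxt k D ν ν' μ x • m ∈ resSpace ν ν' M := by
  refine ⟨juxt k D ν ν' μ x • m, ?_⟩
  change idem₂ k D ν ν' μ • (juxt k D ν ν' μ x • m) = _
  rw [smul_smul, idem₂_mul_juxt]

/-- The action of `R(ν) ⊗ R(ν')` on `1_{ν,ν'} M`, through the juxtaposition of diagrams. -/
@[reducible] noncomputable def resModule (ν ν' : Multiset I) (M : GrMod.{u, max u v, w} k (KLR k D μ)) :
    Module (KLR k D ν ⊗[k] KLR k D ν') (resSpace ν ν' M) where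
  smul x m := ⟨juxt k D ν ν' μ x • m.1, juxt_smul_mem ν ν' M x m.1⟩
  one_smul m := by
    obtain ⟨_, m, rfl⟩ := m
    refine Subtype.ext ?_
    change juxt k D ν ν' μ 1 • (idem₂ k D ν ν' μ • m) = idem₂ k D ν ν' μ • m
    rw [smul_smul, ← juxt_one, ← juxt_mul, one_mul]
  mul_smul x y m := Subtype.ext (by
    change juxt k D ν ν' μ (x * y) • m.1 = juxt k D ν ν' μ x • (juxt k D ν ν' μ y • m.1)
    rw [juxt_mul, mul_smul])
  smul_zero x := Subtype.ext (smul_zero _)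
  smul_add x m n := Subtype.ext (smul_add _ _ _)
  add_smul x y m := Subtype.ext (by
    change juxt k D ν ν' μ (x + y) • m.1 = juxt k D ν ν' μ x • m.1 + juxt k D ν ν' μ y • m.1
    rw [map_add, add_smul])
  zero_smul m := Subtype.ext (by
    change juxt k D ν ν' μ 0 • m.1 = 0
    rw [map_zero, zero_smul])

/-- The restriction `Res_{ν,ν'} M = 1_{ν,ν'} M`, an `R(ν) ⊗ R(ν')`-module. -/
noncomputable def res (ν ν' : Multiset I) (M : GrMod.{u, max u v, w} k (KLR k D μ)) :
    GrMod.{u, max u v, w} k (KLR k D ν ⊗[k] KLR k D ν') :=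
  letI act := resModule ν ν' M
  { carrier := resSpace ν ν' M
    module := act
    tower := ⟨fun c x m => Subtype.ext (by
      change juxt k D ν ν' μ (c • x) • m.1 = c • (juxt k D ν ν' μ x • m.1)
      rw [map_smul, smul_assoc])⟩
    deg := fun d => (M.deg d).comap (resSpace ν ν' M).subtype }

/-- The submodule of `R(μ) ⊗ N` generated by all `r (a ⊗ b) ⊗ w - r ⊗ (a ⊗ b) w` with
`r ∈ R(μ)`, `a ⊗ b ∈ R(ν) ⊗ R(ν')`, `w ∈ N`. -/
noncomputable def indRel {ν ν' : Multiset I} (μ : Multiset I)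
    (N : GrMod.{u, max u v, w} k (KLR k D ν ⊗[k] KLR k D ν')) :
    Submodule (KLR k D μ) (KLR k D μ ⊗[k] N.carrier) :=
  Submodule.span (KLR k D μ)
    {z | ∃ (r : KLR k D μ) (c : KLR k D ν ⊗[k] KLR k D ν') (w : N.carrier),
      z = (r * juxt k D ν ν' μ c) ⊗ₜ[k] w - r ⊗ₜ[k] (c • w)}

/-- The induction `Ind_{ν,ν'} N = R(μ) 1_{ν,ν'} ⊗_{R(ν) ⊗ R(ν')} N` for `μ = ν + ν'`.  The relation
with `c = 1` reads `r 1_{ν,ν'} ⊗ w = r ⊗ w`, so `R(μ)` may be written for `R(μ) 1_{ν,ν'}`. -/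
noncomputable def ind {ν ν' : Multiset I} (μ : Multiset I)
    (N : GrMod.{u, max u v, w} k (KLR k D ν ⊗[k] KLR k D ν')) :
    GrMod.{u, max u v, max u v w} k (KLR k D μ) where
  carrier := (KLR k D μ ⊗[k] N.carrier) ⧸ indRel μ N
  deg d := Submodule.span k
    {z | ∃ a b : ℤ, a + b = d ∧ ∃ r ∈ KLR.grading k D μ a, ∃ w ∈ N.deg b,
      z = (indRel μ N).mkQ (r ⊗ₜ[k] w)}

/-- The left ideal of `R(ni)` generated by all dots and, if `i ∈ I⁻`, also by all crossings. -/
noncomputable def trivIdeal (k : Type u) [Field k] (D : BorcherdsCartanDatum I) (i : I) (n : ℕ) :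
    Ideal (KLR k D (Multiset.replicate n i)) :=
  Ideal.span ({z | ∃ a j b, z = gen _ (.dot a j b)} ∪
    {z | ¬ D.IsReal i ∧ ∃ a j l b, z = gen _ (.cross a j l b)})

/-- The gr-irreducible `R(ni)`-module `V(i^n)`, generated by one vector of degree zero.
For `i ∈ I⁺` it is `NH_n ⊗_{P_n} L = NH_n / (NH_n x_1 + ⋯ + NH_n x_n)`, where `L` is the trivial
`P_n`-module; for `i ∈ I⁻` it is the trivial module, on which all dots and crossings act by `0`. -/
noncomputable def V (k : Type u) [Field k] (D : BorcherdsCartanDatum I) (i : I) (n : ℕ) :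
    GrMod.{u, max u v, max u v} k (KLR k D (Multiset.replicate n i)) where
  carrier := KLR k D (Multiset.replicate n i) ⧸ trivIdeal k D i n
  deg d := (KLR.grading k D (Multiset.replicate n i) d).map
    ((trivIdeal k D i n).mkQ.restrictScalars k)

/-- `Δ_{i^n} M = (1_{ν-ni} ⊗ 1_{ni}) M`, an `R(ν-ni) ⊗ R(ni)`-module.  (It is zero if
`ν - ni ∉ ℕ[I]`.) -/
noncomputable def delta (i : I) (n : ℕ) {ν : Multiset I}
    (M : GrMod.{u, max u v, w} k (KLR k D ν)) :
    GrMod.{u, max u v, w} k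
      (KLR k D (ν - Multiset.replicate n i) ⊗[k] KLR k D (Multiset.replicate n i)) :=
  res (ν - Multiset.replicate n i) (Multiset.replicate n i) M

/-- `ε_i(M) = max {n ≥ 0 | Δ_{i^n} M ≠ 0}`. -/
noncomputable def eps (i : I) {ν : Multiset I} (M : GrMod.{u, max u v, w} k (KLR k D ν)) : ℕ :=
  sSup {n : ℕ | Nontrivial (delta i n M).carrier}

/-- A gr-irreducible object of the category of finite-dimensional graded `R(ν)`-modules. -/
def IsIrr {ν : Multiset I} (M : GrMod.{u, max u v, w} k (KLR k D ν)) : Prop :=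
  M.IsGraded (KLR.grading k D ν) ∧ Module.Finite k M.carrier ∧ M.GrIrreducible

end KLR

end GrMod

/-! Everything rests on one part of the shuffle lemma. Call a subspace `W` of an `R(μ)`-module a
block (`IsBlock`) if it looks like `K ⊗ V` with `K` over `R(ν)`, `V` over `R(ni)` and `ε_i(K) = 0`:
it is stable under both algebras, and none of its sequences ends in `i^{n+1}`. Then `1_{ν,ni} R(μ) W
⊆ W` (`IsBlock.idem₂_smul_mem`). The reason is that a shuffle which brings a strand of `K` among the
last `n` positions of a sequence ending in `i^n` forces `K` to have a sequence ending in `i`. The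
proof uses no basis of `R(μ)`. It slides the strands `i` to the left one at a time and shows from
the local relations that the slid vectors span a stable subspace (`slideSpan_stable`,
`IsBlock.idem_smul_mem`).

Irreducibility of `Δ_{i^n} M` (`delta_irreducible`): a nonzero graded submodule is a block of `M`,
generates `M`, and therefore contains all of `Δ_{i^n} M`.

Factorisation: write `V(i^n) = R(ni) / J`. For an irreducible `E` over `A ⊗ R(ni)` let `K = ann E J`
be the vectors killed by `J`, that is, `Hom(V(i^n), E)`. It is nonzero because dots raise degrees
and `E` is finite-dimensional (`annSpace_trivIdeal_ne_bot`). Evaluation `K ⊗ V(i^n) → E` is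
injective (`annMap_injective`): for imaginary `i` because `V(i^n)` is a line, for real `i` because
the longest product of crossings separates vectors killed by the dots. Its image is all of `E`, and
`K` inherits irreducibility (`ann_irreducible`, `iso_ann_outer`).

Head: Frobenius reciprocity turns `K ⊗ V(i^n) ≃ Δ_{i^n} M ⊆ M` into a map from the induced module to
`M`. The image of `1 ⊗ (K ⊗ V(i^n))` is a block, and a graded submodule that maps onto `M` must
contain it, hence is everything. So the kernel is the only maximal graded submodule
(`iso_head_ind`). -/

set_option linter.unusedSectionVars false

/-! ### Elementary diagrams -/

namespace Diagram

variable {I : Type v}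

theorem bot_dot (a : List I) (i : I) (b : List I) : (dot a i b).bot = a ++ i :: b := rfl

theorem top_dot (a : List I) (i : I) (b : List I) : (dot a i b).top = a ++ i :: b := rfl

theorem bot_cross (a : List I) (i j : I) (b : List I) :
    (cross a i j b).bot = a ++ i :: j :: b := rfl

theorem top_cross (a : List I) (i j : I) (b : List I) :
    (cross a i j b).top = a ++ j :: i :: b := rfl

theorem pad_idem (p t s : List I) : (idem s).pad p t = idem (p ++ s ++ t) := rfl

theorem pad_dot (p t a : List I) (i : I) (b : List I) :
    (dot a i b).pad p t = dot (p ++ a) i (b ++ t) := rfl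

theorem pad_cross (p t a : List I) (i j : I) (b : List I) :
    (cross a i j b).pad p t = cross (p ++ a) i j (b ++ t) := rfl

theorem length_bot (g : Diagram I) : g.bot.length = g.top.length := by
  cases g <;> simp [Diagram.bot, Diagram.top]

theorem pad_pad_left (t t' : List I) (g : Diagram I) :
    (g.pad [] t).pad [] t' = g.pad [] (t ++ t') := by
  cases g <;> simp [Diagram.pad]

end Diagram

/-! ### Sliding one strand to the left -/

namespace KLR

open Diagram

section Stability

variable {k : Type u} [Field k] {I : Type v} [DecidableEq I] {D : BorcherdsCartanDatum I}
variable {μ : Multiset I}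

theorem gen_idem_eq_zero {s : List I} (hs : s ∉ SeqOf μ) : gen (k := k) (D := D) μ (.idem s) = 0 := by
  rw [← mul_one (gen μ _), ← sum_idem, Finset.mul_sum]
  refine Finset.sum_eq_zero fun t ht => ?_
  rw [idem_mul_idem, if_neg]
  rintro rfl
  exact hs ht

theorem gen_eq_zero {g : Diagram I} (hg : g.top ∉ SeqOf μ) : gen (k := k) (D := D) μ g = 0 := by
  rw [← top_mul_gen, gen_idem_eq_zero hg, zero_mul]

variable {X : Type w} [AddCommGroup X] [Module k X] [Module (KLR k D μ) X]
  [IsScalarTower k (KLR k D μ) X]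

/-- A subspace is stable under `R(μ)` as soon as it is stable under the elementary diagrams. -/
theorem smul_mem_of_gen (W : Submodule k X) (h : ∀ g, ∀ x ∈ W, gen (k := k) (D := D) μ g • x ∈ W)
    (r : KLR k D μ) {x : X} (hx : x ∈ W) : r • x ∈ W := by
  obtain ⟨r, rfl⟩ := mk_surjective r
  induction r using FreeAlgebra.induction generalizing x with
  | grade0 c =>
    rw [AlgHom.commutes, algebraMap_smul]
    exact W.smul_mem c hx
  | grade1 g => exact h g x hx
  | mul a b ha hb => rw [map_mul, mul_smul]; exact ha (hb hx)
  | add a b ha hb => rw [map_add, add_smul]; exact W.add_mem (ha hx) (hb hx)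

/-- `W` is stable under all diagrams with the strands `t` added on the right. -/
def PadStable (D : BorcherdsCartanDatum I) (μ : Multiset I) [Module (KLR k D μ) X] (t : List I)
    (W : Submodule k X) : Prop :=
  ∀ g : Diagram I, ∀ x ∈ W, gen (k := k) (D := D) μ (g.pad [] t) • x ∈ W

/-- The smallest subspace that contains `W` and is stable under all diagrams with the strands `t`
added on the right. -/
def padClosure (D : BorcherdsCartanDatum I) (μ : Multiset I) [Module (KLR k D μ) X] (t : List I)
    (W : Submodule k X) : Submodule k X :=
  sInf {Z | W ≤ Z ∧ PadStable D μ t Z}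

theorem le_padClosure (t : List I) (W : Submodule k X) : W ≤ padClosure D μ t W :=
  le_sInf fun _ hZ => hZ.1

theorem padClosure_stable (t : List I) (W : Submodule k X) :
    PadStable D μ t (padClosure D μ t W) := by
  intro g x hx
  rw [padClosure, Submodule.mem_sInf] at hx ⊢
  exact fun Z hZ => hZ.2 g x (hx Z hZ)

theorem padClosure_le {t : List I} {W Z : Submodule k X} (h : W ≤ Z) (hZ : PadStable D μ t Z) :
    padClosure D μ t W ≤ Z := sInf_le ⟨h, hZ⟩

/-- The action of an element of `R(μ)` as a `k`-linear map. -/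
noncomputable def actL (r : KLR k D μ) : X →ₗ[k] X := Algebra.lsmul k k X r

theorem actL_apply (r : KLR k D μ) (x : X) : actL r x = r • x := rfl

/-- The diagram on the sequence `p q i t` that moves the strand `i` to the left of `q`. -/
noncomputable def slide (k : Type u) [Field k] (D : BorcherdsCartanDatum I) (μ : Multiset I) (i : I)
    (t : List I) : List I → List I → KLR k D μ
  | p, [] => gen μ (.idem (p ++ i :: t))
  | p, j :: q => gen μ (.cross p j i (q ++ t)) * slide k D μ i t (p ++ [j]) q

variable {i : I} {t : List I}

theorem idem_mul_slide (s p q : List I) : gen μ (.idem s) * slide k D μ i t p q =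
    if s = p ++ i :: (q ++ t) then slide k D μ i t p q else 0 := by
  cases q with
  | nil => simp only [slide, idem_mul_idem, List.nil_append]; split_ifs with h <;> simp [h]
  | cons j q =>
    rw [slide, ← mul_assoc, idem_mul_gen, List.cons_append, top_cross]
    split_ifs <;> simp

theorem top_mul_slide (p q : List I) :
    gen μ (.idem (p ++ i :: (q ++ t))) * slide k D μ i t p q = slide k D μ i t p q := by
  rw [idem_mul_slide, if_pos rfl]

theorem slide_mul_bot (p q : List I) :
    slide k D μ i t p q * gen μ (.idem (p ++ q ++ i :: t)) = slide k D μ i t p q := by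
  induction q generalizing p with
  | nil => simp [slide, idem_mul_idem]
  | cons j q ih =>
    have := ih (p ++ [j])
    rw [slide, mul_assoc]
    simp only [List.append_assoc, List.cons_append, List.nil_append] at this ⊢
    rw [this]

theorem gen_mul_slide (g : Diagram I) (p q : List I) (h : g.bot ≠ p ++ i :: (q ++ t)) :
    gen μ g * slide k D μ i t p q = 0 := by
  rw [← gen_mul_bot, mul_assoc, idem_mul_slide, if_neg h, mul_zero]

/-- Diagrams to the left of the sliding strand pass through. -/
theorem pad_mul_slide (g : Diagram I) (q : List I) :
    gen μ (g.pad [] (i :: (q ++ t))) * slide k D μ i t g.bot q =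
      slide k D μ i t g.top q * gen μ (g.pad [] (q ++ i :: t)) := by
  induction q generalizing g with
  | nil =>
    have h1 := top_mul_gen (k := k) (D := D) (ν := μ) (g.pad [] (i :: t))
    have h2 := gen_mul_bot (k := k) (D := D) (ν := μ) (g.pad [] (i :: t))
    rw [pad_top] at h1
    rw [pad_bot] at h2
    simp only [slide, List.nil_append] at h1 h2 ⊢
    rw [h1, h2]
  | cons j q ih =>
    -- The leading crossing of the slide lies to the right of `g`, so the two exchange. The rest of
    -- the slide passes `g` widened by the strand `j`.
    have h1 := interchange (k := k) (D := D) (μ := μ) g (.cross [] j i (q ++ t))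
    simp only [pad_cross, top_cross, bot_cross, List.append_nil, List.nil_append] at h1
    have h2 := ih (g.pad [] [j])
    have e : (g.pad [] [j]).pad [] (i :: (q ++ t)) = g.pad [] (j :: i :: (q ++ t)) := by
      rw [pad_pad_left]; rfl
    have e' : (g.pad [] [j]).pad [] (q ++ i :: t) = g.pad [] (j :: q ++ i :: t) := by
      cases g <;> simp [Diagram.pad]
    rw [e, e', pad_top, pad_bot] at h2
    simp only [List.nil_append] at h2
    simp only [slide, List.cons_append] at h2 ⊢
    rw [← mul_assoc, h1, mul_assoc, h2, mul_assoc]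

/-- The span of all `slide p q • w`, `w ∈ W`, with at least `l` strands in `p`. -/
def slideSpan (D : BorcherdsCartanDatum I) (μ : Multiset I) [Module (KLR k D μ) X] (i : I)
    (t : List I) (W : Submodule k X) (l : ℕ) : Submodule k X :=
  Submodule.span k {z | ∃ p q, l ≤ p.length ∧ ∃ w ∈ W, z = slide k D μ i t p q • w}

variable {W : Submodule k X}

theorem slide_mem {p q : List I} {l : ℕ} (hl : l ≤ p.length) {x : X} (hw : x ∈ W) :
    slide k D μ i t p q • x ∈ slideSpan D μ i t W l :=
  Submodule.subset_span ⟨p, q, hl, x, hw, rfl⟩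

theorem slideSpan_anti {l l' : ℕ} (h : l ≤ l') :
    slideSpan D μ i t W l' ≤ slideSpan D μ i t W l :=
  Submodule.span_mono fun _ ⟨p, q, hl, hx⟩ => ⟨p, q, h.trans hl, hx⟩

theorem slideSpan_induction {l : ℕ} (r : KLR k D μ) {Z : Submodule k X}
    (h : ∀ p q : List I, l ≤ p.length → ∀ x ∈ W, r • slide k D μ i t p q • x ∈ Z) {z : X}
    (hz : z ∈ slideSpan D μ i t W l) : r • z ∈ Z := by
  have : slideSpan D μ i t W l ≤ Z.comap (actL r) := by
    refine Submodule.span_le.2 ?_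
    rintro _ ⟨p, q, hl, x, hx, rfl⟩
    exact h p q hl x hx
  exact this hz

theorem idem_smul_slideSpan {l : ℕ} (s : List I) {z : X} (hz : z ∈ slideSpan D μ i t W l) :
    gen (k := k) (D := D) μ (.idem s) • z ∈ slideSpan D μ i t W l := by
  refine slideSpan_induction _ (fun p q hl x hx => ?_) hz
  rw [smul_smul, idem_mul_slide]
  split_ifs
  · exact slide_mem hl hx
  · rw [zero_smul]; exact zero_mem _

section

variable (hW : PadStable D μ (i :: t) W)

include hW

/-- Once `g` has moved below the slide, the strands `q` can be counted as part of it, and then `hW`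
absorbs it into `W`. -/
theorem pad_smul_slide_mem (g : Diagram I) (q : List I) {l : ℕ} (hl : l ≤ g.bot.length) {x : X}
    (hx : x ∈ W) :
    gen (k := k) (D := D) μ (g.pad [] (i :: (q ++ t))) • slide k D μ i t g.bot q • x
      ∈ slideSpan D μ i t W l := by
  rw [smul_smul, pad_mul_slide, mul_smul]
  refine slide_mem (length_bot g ▸ hl) ?_
  rw [← pad_pad_left]
  exact hW _ _ hx

/-- Positions below `l` all belong to `p`, so the dot is to the left of the sliding strand. The same
applies to crossings of two such positions. -/
theorem dot_smul_slideSpan_of_lt {l : ℕ} (a : List I) (j : I) (b : List I) (ha : a.length < l)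
    {z : X} (hz : z ∈ slideSpan D μ i t W l) :
    gen (k := k) (D := D) μ (.dot a j (b ++ t)) • z ∈ slideSpan D μ i t W l := by
  refine slideSpan_induction _ (fun p q hl x hx => ?_) hz
  by_cases h : a ++ j :: (b ++ t) = p ++ i :: (q ++ t)
  · have h' : a ++ j :: b = p ++ i :: q := by
      apply List.append_cancel_right (bs := t); simpa using h
    obtain ⟨c, rfl, hc⟩ | ⟨c, rfl, hc⟩ := List.append_eq_append_iff.1 h'
    · cases c with
      | nil => simp at hl; omega
      | cons d c =>
        simp only [List.cons_append, List.cons.injEq] at hc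
        obtain ⟨rfl, rfl⟩ := hc
        have := pad_smul_slide_mem hW (.dot a j c) q (l := l) hl hx
        simpa [Diagram.pad, Diagram.bot] using this
    · simp at ha; omega
  · rw [smul_smul, gen_mul_slide (.dot a j (b ++ t)) _ _ h, zero_smul]; exact zero_mem _

theorem cross_smul_slideSpan_of_lt {l : ℕ} (a : List I) (j j' : I) (b : List I)
    (ha : a.length + 1 < l) {z : X} (hz : z ∈ slideSpan D μ i t W l) :
    gen (k := k) (D := D) μ (.cross a j j' (b ++ t)) • z ∈ slideSpan D μ i t W l := by
  refine slideSpan_induction _ (fun p q hl x hx => ?_) hz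
  by_cases h : a ++ j :: j' :: (b ++ t) = p ++ i :: (q ++ t)
  · have h' : a ++ j :: j' :: b = p ++ i :: q := by
      apply List.append_cancel_right (bs := t); simpa using h
    obtain ⟨c, rfl, hc⟩ | ⟨c, rfl, hc⟩ := List.append_eq_append_iff.1 h'
    · match c, hc with
      | [], hc => simp at hl; omega
      | [d], hc => simp at hl; omega
      | d :: d' :: c, hc =>
        simp only [List.cons_append, List.cons.injEq] at hc
        obtain ⟨rfl, rfl, rfl⟩ := hc
        have := pad_smul_slide_mem hW (.cross a j j' c) q (l := l) hl hx
        simpa [Diagram.pad, Diagram.bot] using this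
    · simp at ha; omega
  · rw [smul_smul, gen_mul_slide (.cross a j j' (b ++ t)) _ _ h, zero_smul]; exact zero_mem _

/-- Either the crossing lies to the left of the sliding strand, or `p` has exactly `l + 1` strands
and the crossing prolongs the slide by one step. The second case is why the index drops. -/
theorem cross_smul_slideSpan_of_eq {l : ℕ} (a : List I) (j j' : I) (b : List I)
    (ha : a.length = l) {z : X} (hz : z ∈ slideSpan D μ i t W (l + 1)) :
    gen (k := k) (D := D) μ (.cross a j j' (b ++ t)) • z ∈ slideSpan D μ i t W l := by
  refine slideSpan_induction _ (fun p q hl x hx => ?_) hz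
  by_cases h : a ++ j :: j' :: (b ++ t) = p ++ i :: (q ++ t)
  · have h' : a ++ j :: j' :: b = p ++ i :: q := by
      apply List.append_cancel_right (bs := t); simpa using h
    obtain ⟨c, rfl, hc⟩ | ⟨c, rfl, hc⟩ := List.append_eq_append_iff.1 h'
    · match c, hc with
      | [], hc => simp at hl; omega
      | [d], hc =>
        simp only [List.cons_append, List.cons.injEq, List.nil_append] at hc
        obtain ⟨rfl, rfl, rfl⟩ := hc
        rw [smul_smul]
        exact slide_mem (p := a) (q := j :: b) ha.ge hx
      | d :: d' :: c, hc =>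
        simp only [List.cons_append, List.cons.injEq] at hc
        obtain ⟨rfl, rfl, rfl⟩ := hc
        have := pad_smul_slide_mem hW (.cross a j j' c) q (l := l)
          (by simp [Diagram.bot]; omega) hx
        simpa [Diagram.pad, Diagram.bot] using this
    · simp at hl ha; omega
  · rw [smul_smul, gen_mul_slide (.cross a j j' (b ++ t)) _ _ h, zero_smul]; exact zero_mem _

end

end Stability

end KLR

/-! ### Stability of the span of the slid vectors -/

namespace KLR

open Diagram

section Relations

variable {k : Type u} [Field k] {I : Type v} [DecidableEq I] {D : BorcherdsCartanDatum I}
variable {μ : Multiset I}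

theorem cross_mul_cross (a : List I) (i j : I) (b : List I) :
    gen (k := k) (D := D) μ (.cross a j i b) * gen μ (.cross a i j b) = mk (D := D) μ (quadTerm k D a i j b) := by
  rw [← mk_rel (DiagramRel.quad a i j b), map_mul]; rfl

theorem dot_mul_cross_left (a : List I) (i j : I) (b : List I) :
    gen (k := k) (D := D) μ (.dot a j (i :: b)) * gen μ (.cross a i j b) =
      gen (k := k) (D := D) μ (.cross a i j b) * gen μ (.dot (a ++ [i]) j b) + mk (D := D) μ (slideTerm k D a i j b) := by
  rw [← mk_rel (DiagramRel.slide_left a i j b), map_sub, map_mul, map_mul]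
  exact (add_sub_cancel _ _).symm

theorem dot_mul_cross_right (a : List I) (i j : I) (b : List I) :
    gen (k := k) (D := D) μ (.dot (a ++ [j]) i b) * gen μ (.cross a i j b) =
      gen (k := k) (D := D) μ (.cross a i j b) * gen μ (.dot a i (j :: b)) - mk (D := D) μ (slideTerm k D a i j b) := by
  rw [← mk_rel (DiagramRel.slide_right a i j b), map_sub, map_mul, map_mul]
  exact (sub_sub_cancel _ _).symm

/-- Oriented so that a crossing to the right of the sliding strand `l` moves to its left. -/
theorem braid_gen (a : List I) (i j l : I) (b : List I) :
    gen (k := k) (D := D) μ (.cross (a ++ [l]) i j b) * (gen μ (.cross a i l (j :: b)) *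
        gen (k := k) (D := D) μ (.cross (a ++ [i]) j l b)) =
      gen (k := k) (D := D) μ (.cross a j l (i :: b)) * (gen μ (.cross (a ++ [j]) i l b) *
        gen (k := k) (D := D) μ (.cross a i j (l :: b))) - mk (D := D) μ (braidTerm k D a i j l b) := by
  rw [← mk_rel (DiagramRel.braid a i j l b), map_sub, map_mul, map_mul, map_mul, map_mul,
    sub_sub_eq_add_sub, eq_sub_iff_add_eq, add_comm, ← mul_assoc, ← mul_assoc]
  rfl

theorem cross_mul_dot_of_disjoint (a : List I) (i j : I) (b : List I) (l : I) (c : List I) :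
    gen (k := k) (D := D) μ (.dot (a ++ j :: i :: b) l c) * gen μ (.cross a i j (b ++ l :: c)) =
      gen (k := k) (D := D) μ (.cross a i j (b ++ l :: c)) * gen μ (.dot (a ++ i :: j :: b) l c) := by
  simpa only [map_mul, fX, fT] using! mk_rel (ν := μ) (DiagramRel.cross_dot (k := k) (D := D) a i j b l c)

theorem cross_mul_cross_of_disjoint (a : List I) (i j : I) (b : List I) (l m : I) (c : List I) :
    gen (k := k) (D := D) μ (.cross (a ++ j :: i :: b) l m c) *
        gen (k := k) (D := D) μ (.cross a i j (b ++ l :: m :: c)) =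
      gen (k := k) (D := D) μ (.cross a i j (b ++ m :: l :: c)) * gen μ (.cross (a ++ i :: j :: b) l m c) := by
  simpa only [map_mul] using!
    mk_rel (ν := μ) (DiagramRel.cross_cross (k := k) (D := D) a i j b l m c)

variable {X : Type w} [AddCommGroup X] [Module k X] [Module (KLR k D μ) X]
  [IsScalarTower k (KLR k D μ) X]

theorem pow_smul_mem {Z : Submodule k X} {r : KLR k D μ} (h : ∀ z ∈ Z, r • z ∈ Z) (n : ℕ) {z : X}
    (hz : z ∈ Z) : r ^ n • z ∈ Z := by
  induction n generalizing z with
  | zero => simpa using hz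
  | succ n ih => rw [pow_succ, mul_smul]; exact ih (h z hz)

variable {t : List I} {Z : Submodule k X}
  (hE : ∀ s, ∀ z ∈ Z, gen (k := k) (D := D) μ (.idem s) • z ∈ Z)
  (hX : ∀ a j b, ∀ z ∈ Z, gen (k := k) (D := D) μ (.dot a j (b ++ t)) • z ∈ Z)

include hE

/-- The right-hand sides of the local relations are polynomials in idempotents and dots, so a
subspace stable under those absorbs every error term. The same holds for the quadratic and braid
terms. -/
theorem slideTerm_smul_mem (a : List I) (i j : I) (b : List I) {z : X} (hz : z ∈ Z) :
    mk (D := D) μ (slideTerm k D a i j b) • z ∈ Z := by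
  rw [slideTerm]
  split_ifs
  · exact hE _ z hz
  · rw [map_zero, zero_smul]; exact Z.zero_mem

include hX

theorem quadTerm_smul_mem (a : List I) (i j : I) (b : List I) {z : X} (hz : z ∈ Z) :
    mk (D := D) μ (quadTerm k D a i j (b ++ t)) • z ∈ Z := by
  rw [quadTerm]
  split_ifs
  · rw [map_zero, zero_smul]; exact Z.zero_mem
  · exact hE _ z hz
  · rw [map_add, map_pow, map_pow, add_smul]
    exact Z.add_mem (pow_smul_mem (hX a i (j :: b)) _ hz)
      (pow_smul_mem (hX (a ++ [i]) j b) _ hz)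

theorem braidTerm_smul_mem (a : List I) (i j l : I) (b : List I) {z : X} (hz : z ∈ Z) :
    mk (D := D) μ (braidTerm k D a i j l (b ++ t)) • z ∈ Z := by
  rw [braidTerm]
  split_ifs
  · rw [map_sum, Finset.sum_smul]
    refine Z.sum_mem fun c _ => ?_
    rw [map_mul, map_mul, map_pow, map_pow, mul_smul, mul_smul]
    exact pow_smul_mem (hX a i (j :: l :: b)) _
      (pow_smul_mem (hX (a ++ [i, j]) l b) _ (hE _ z hz))
  · rw [map_zero, zero_smul]; exact Z.zero_mem

end Relations

section SlideSpan

variable {k : Type u} [Field k] {I : Type v} [DecidableEq I] {D : BorcherdsCartanDatum I}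
variable {μ : Multiset I} {X : Type w} [AddCommGroup X] [Module k X] [Module (KLR k D μ) X]
  [IsScalarTower k (KLR k D μ) X] {i : I} {t : List I} {W : Submodule k X}

/-- Such a slide lives on a sequence that is too long to have weight `μ`. This starts the descending
induction on `l`. -/
theorem slideSpan_eq_bot {l : ℕ} (hl : μ.card ≤ l) : slideSpan D μ i t W l = ⊥ := by
  rw [eq_bot_iff, slideSpan, Submodule.span_le]
  rintro _ ⟨p, q, hp, x, -, rfl⟩
  rw [← top_mul_slide, gen_idem_eq_zero, zero_mul, zero_smul]
  · exact Submodule.zero_mem _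
  · rw [mem_seqOf]
    rintro rfl
    simp at hl
    omega

/-- The inductive step for `slideSpan_stable`. -/
theorem slideSpan_stable_step (hW : PadStable D μ (i :: t) W)
    (hdot : ∀ s, ∀ x ∈ W, gen (k := k) (D := D) μ (.dot s i t) • x ∈ W) {l : ℕ}
    (hX1 : ∀ a j b, ∀ z ∈ slideSpan D μ i t W (l + 1),
      gen (k := k) (D := D) μ (.dot a j (b ++ t)) • z ∈ slideSpan D μ i t W (l + 1))
    (hX2 : ∀ a j b, ∀ z ∈ slideSpan D μ i t W (l + 2),
      gen (k := k) (D := D) μ (.dot a j (b ++ t)) • z ∈ slideSpan D μ i t W (l + 2))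
    (hT1 : ∀ a j j' b, l + 1 ≤ a.length → ∀ z ∈ slideSpan D μ i t W (l + 1),
      gen (k := k) (D := D) μ (.cross a j j' (b ++ t)) • z ∈ slideSpan D μ i t W (l + 1)) :
    (∀ a j b, ∀ z ∈ slideSpan D μ i t W l,
      gen (k := k) (D := D) μ (.dot a j (b ++ t)) • z ∈ slideSpan D μ i t W l) ∧
    (∀ a j j' b, l ≤ a.length → ∀ z ∈ slideSpan D μ i t W l,
      gen (k := k) (D := D) μ (.cross a j j' (b ++ t)) • z ∈ slideSpan D μ i t W l) := by
  have hanti : slideSpan D μ i t W (l + 1) ≤ slideSpan D μ i t W l :=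
    slideSpan_anti (Nat.le_succ l)
  constructor
  · intro a j b z hz
    refine slideSpan_induction _ (fun p q hl x hx => ?_) hz
    -- Generators with more than `l` strands in `p` lie in the next smaller subspace, where
    -- stability is known. From here on `p` has exactly `l` strands.
    obtain hl | hl := hl.lt_or_eq
    · exact hanti (hX1 a j b _ (slide_mem hl hx))
    by_cases h : a ++ j :: (b ++ t) = p ++ i :: (q ++ t)
    swap
    · rw [smul_smul, gen_mul_slide (.dot a j (b ++ t)) _ _ h, zero_smul]; exact zero_mem _
    have h' : a ++ j :: b = p ++ i :: q := by
      apply List.append_cancel_right (bs := t); simpa using h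
    by_cases ha : a.length < l
    · exact dot_smul_slideSpan_of_lt hW a j b ha (slide_mem hl.le hx)
    obtain ⟨c, rfl, hc⟩ | ⟨c, rfl, hc⟩ := List.append_eq_append_iff.1 h'
    -- The two branches overlap in `a = p`, where the dot is on the sliding strand itself.
    · have : c = [] := List.eq_nil_of_length_eq_zero (by simp at hl; omega)
      subst this
      simp only [List.nil_append, List.cons.injEq, List.append_nil] at hc hl hx ⊢
      obtain ⟨rfl, rfl⟩ := hc
      cases b with
      | nil =>
        have h1 := gen_mul_bot (k := k) (D := D) (ν := μ) (.dot a j t)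
        have h2 := top_mul_gen (k := k) (D := D) (ν := μ) (.dot a j t)
        rw [bot_dot] at h1
        rw [top_dot] at h2
        rw [slide, smul_smul, List.nil_append, h1, ← h2, mul_smul]
        exact slide_mem (p := a) (q := []) hl.le (hdot a x hx)
      | cons j0 q =>
        -- Removing the leading crossing gains one in the index. The dot passes that crossing, acts
        -- in the smaller subspace, and putting the crossing back loses the one again.
        have hy : slide k D μ j t (a ++ [j0]) q • x ∈ slideSpan D μ j t W (l + 1) :=
          slide_mem (by simp; omega) hx
        rw [slide, mul_smul, smul_smul, List.cons_append, dot_mul_cross_left, add_smul, mul_smul]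
        refine add_mem (cross_smul_slideSpan_of_eq hW _ _ _ _ hl.symm (hX1 _ _ _ _ hy)) ?_
        exact hanti (slideTerm_smul_mem (fun s z hz => idem_smul_slideSpan s hz) _ _ _ _ hy)
    · cases c with
      | nil =>
        simp only [List.nil_append, List.cons.injEq, List.append_nil] at hc ha ⊢
        obtain ⟨rfl, rfl⟩ := hc
        cases q with
        | nil =>
          have h1 := gen_mul_bot (k := k) (D := D) (ν := μ) (.dot p i t)
          have h2 := top_mul_gen (k := k) (D := D) (ν := μ) (.dot p i t)
          rw [bot_dot] at h1
          rw [top_dot] at h2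
          rw [slide, smul_smul, List.nil_append, h1, ← h2, mul_smul]
          exact slide_mem (p := p) (q := []) hl.le (hdot p x hx)
        | cons j0 q =>
          have hy : slide k D μ i t (p ++ [j0]) q • x ∈ slideSpan D μ i t W (l + 1) :=
            slide_mem (by simp; omega) hx
          rw [slide, mul_smul, smul_smul, List.cons_append, dot_mul_cross_left, add_smul, mul_smul]
          refine add_mem (cross_smul_slideSpan_of_eq hW _ _ _ _ hl.symm (hX1 _ _ _ _ hy)) ?_
          exact hanti (slideTerm_smul_mem (fun s z hz => idem_smul_slideSpan s hz) _ _ _ _ hy)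
      | cons d c =>
        simp only [List.cons_append, List.cons.injEq] at hc
        obtain ⟨rfl, rfl⟩ := hc
        cases c with
        | nil =>
          -- The dot is on the strand just to the right of the sliding one.
          have hy : slide k D μ i t (p ++ [j]) b • x ∈ slideSpan D μ i t W (l + 1) :=
            slide_mem (by simp; omega) hx
          simp only [List.nil_append]
          rw [slide, mul_smul, smul_smul, dot_mul_cross_right, sub_smul, mul_smul]
          refine sub_mem (cross_smul_slideSpan_of_eq hW _ _ _ _ hl.symm (hX1 p j (i :: b) _ hy)) ?_
          exact hanti (slideTerm_smul_mem (fun s z hz => idem_smul_slideSpan s hz) _ _ _ _ hy)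
        | cons j0 c =>
          have hy : slide k D μ i t (p ++ [j0]) (c ++ j :: b) • x ∈ slideSpan D μ i t W (l + 1) :=
            slide_mem (by simp; omega) hx
          rw [List.cons_append, slide, mul_smul, smul_smul, List.append_assoc, List.cons_append,
            cross_mul_dot_of_disjoint, mul_smul]
          have := cross_smul_slideSpan_of_eq hW p j0 i (c ++ j :: b) hl.symm
            (hX1 (p ++ j0 :: i :: c) j b _ hy)
          simpa using this
  · intro a j j' b ha z hz
    refine slideSpan_induction _ (fun p q hl x hx => ?_) hz
    obtain hl | hl := hl.lt_or_eq
    · obtain ha | ha := ha.lt_or_eq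
      · exact hanti (hT1 a j j' b ha _ (slide_mem hl hx))
      · exact cross_smul_slideSpan_of_eq hW a j j' b ha.symm (slide_mem hl hx)
    by_cases h : a ++ j :: j' :: (b ++ t) = p ++ i :: (q ++ t)
    swap
    · rw [smul_smul, gen_mul_slide (.cross a j j' (b ++ t)) _ _ h, zero_smul]; exact zero_mem _
    have h' : a ++ j :: j' :: b = p ++ i :: q := by
      apply List.append_cancel_right (bs := t); simpa using h
    obtain ⟨c, rfl⟩ : ∃ c, a = p ++ c := by
      obtain ⟨c, rfl, hc⟩ | ⟨c, rfl, hc⟩ := List.append_eq_append_iff.1 h'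
      · exact ⟨[], by rw [List.eq_nil_of_length_eq_zero (l := c) (by simp at hl; omega)]; simp⟩
      · exact ⟨c, rfl⟩
    rw [List.append_assoc, List.append_cancel_left_eq] at h'
    match c, h' with
    -- The crossing meets the leading crossing of the slide, and their product is a quadratic term.
    | [], h' =>
      simp only [List.nil_append, List.cons.injEq] at h'
      obtain ⟨rfl, rfl⟩ := h'
      have hy : slide k D μ j t (p ++ [j']) b • x ∈ slideSpan D μ j t W (l + 1) :=
        slide_mem (by simp; omega) hx
      rw [slide, List.append_nil, mul_smul, smul_smul, cross_mul_cross]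
      exact hanti (quadTerm_smul_mem (fun s z hz => idem_smul_slideSpan s hz) hX1 _ _ _ _ hy)
    -- The crossing involves the two strands just to the right of the sliding one. The braid
    -- relation moves it to the left, where it preserves index `l + 2`; the two crossings that
    -- remain lower the index to `l`.
    | [d], h' =>
      simp only [List.cons_append, List.nil_append, List.cons.injEq] at h'
      obtain ⟨rfl, rfl⟩ := h'
      have hy : slide k D μ d t (p ++ [j] ++ [j']) b • x ∈ slideSpan D μ d t W (l + 2) :=
        slide_mem (by simp; omega) hx
      rw [slide, slide, List.cons_append, smul_smul, ← mul_assoc, ← mul_assoc, mul_smul, mul_assoc,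
        braid_gen, sub_smul, mul_smul, mul_smul]
      refine sub_mem ?_ (hanti (slideSpan_anti (Nat.le_succ (l + 1))
        (braidTerm_smul_mem (fun s z hz => idem_smul_slideSpan s hz) hX2 _ _ _ _ _ hy)))
      refine cross_smul_slideSpan_of_eq hW p j' d (j :: b) hl.symm ?_
      refine cross_smul_slideSpan_of_eq hW _ _ _ _ (by simp; omega) ?_
      exact cross_smul_slideSpan_of_lt hW p j j' (d :: b) (by omega) hy
    -- The crossing is disjoint from the leading crossing of the slide.
    | d :: j0 :: c, h' =>
      simp only [List.cons_append, List.cons.injEq] at h'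
      obtain ⟨rfl, rfl⟩ := h'
      have hy : slide k D μ d t (p ++ [j0]) (c ++ j :: j' :: b) • x
          ∈ slideSpan D μ d t W (l + 1) := slide_mem (by simp; omega) hx
      rw [slide, mul_smul, smul_smul, List.append_assoc, List.cons_append, List.cons_append,
        cross_mul_cross_of_disjoint, mul_smul]
      have := cross_smul_slideSpan_of_eq hW p j0 d (c ++ j' :: j :: b) hl.symm
        (hT1 (p ++ j0 :: d :: c) j j' b (by simp; omega) _ hy)
      simpa using this

/-- If `W` is stable under the diagrams with `i t` added on the right and under the dots on the
strand `i`, the elements that slide this strand to the left generate a subspace that is stable under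
the diagrams with `t` added on the right. -/
theorem slideSpan_stable (hW : PadStable D μ (i :: t) W)
    (hdot : ∀ s, ∀ x ∈ W, gen (k := k) (D := D) μ (.dot s i t) • x ∈ W) :
    PadStable D μ t (slideSpan D μ i t W 0) := by
  -- Descending induction on `l`, with `d` bounding `|μ| - l`. Crossings that start left of position
  -- `l` are excluded; at `l = 0`, the case wanted, there are none.
  have key : ∀ d l : ℕ, μ.card ≤ l + d →
      (∀ a j b, ∀ z ∈ slideSpan D μ i t W l,
        gen (k := k) (D := D) μ (.dot a j (b ++ t)) • z ∈ slideSpan D μ i t W l) ∧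
      (∀ a j j' b, l ≤ a.length → ∀ z ∈ slideSpan D μ i t W l,
        gen (k := k) (D := D) μ (.cross a j j' (b ++ t)) • z ∈ slideSpan D μ i t W l) := by
    intro d
    induction d using Nat.strong_induction_on with
    | _ d ih =>
      intro l hl
      by_cases hd : μ.card ≤ l
      · simp [slideSpan_eq_bot hd]
      · have h1 := ih (d - 1) (by omega) (l + 1) (by omega)
        have h2 : ∀ a j b, ∀ z ∈ slideSpan D μ i t W (l + 2),
            gen (k := k) (D := D) μ (.dot a j (b ++ t)) • z ∈ slideSpan D μ i t W (l + 2) := by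
          by_cases hd' : μ.card ≤ l + 2
          · simp [slideSpan_eq_bot hd']
          · exact (ih (d - 2) (by omega) (l + 2) (by omega)).1
        exact slideSpan_stable_step hW hdot h1.1 h2 h1.2
  obtain ⟨h1, h2⟩ := key μ.card 0 (by omega)
  intro g z hz
  cases g with
  | idem s => exact idem_smul_slideSpan _ hz
  | dot a j b => exact h1 a j b z hz
  | cross a j j' b => exact h2 a j j' b (Nat.zero_le _) z hz

end SlideSpan

end KLR

/-! ### The shuffle lemma for blocks -/

namespace KLR

open Diagram

section Shuffle

variable {k : Type u} [Field k] {I : Type v} [DecidableEq I] {D : BorcherdsCartanDatum I}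
variable {μ : Multiset I} {X : Type w} [AddCommGroup X] [Module k X] [Module (KLR k D μ) X]
  [IsScalarTower k (KLR k D μ) X] {i : I} {t : List I} {W : Submodule k X}

/-- The dot on `i` commutes with every diagram to the left of `i`, so the vectors that it keeps
inside the closure form a stable subspace containing `W`. -/
theorem dot_smul_padClosure (h : ∀ s, ∀ x ∈ W, gen (k := k) (D := D) μ (.dot s i t) • x ∈ W)
    (s : List I) {x : X} (hx : x ∈ padClosure D μ (i :: t) W) :
    gen (k := k) (D := D) μ (.dot s i t) • x ∈ padClosure D μ (i :: t) W := by
  -- All `s` are treated at once because a diagram changes the sequence to the left of `i`.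
  have key : padClosure D μ (i :: t) W ≤
      ⨅ s, (padClosure D μ (i :: t) W).comap (actL (gen (k := k) (D := D) μ (.dot s i t))) := by
    refine padClosure_le (fun x hx => ?_) (fun g x hx => ?_)
    · rw [Submodule.mem_iInf]
      exact fun s => le_padClosure _ _ (h s x hx)
    · rw [Submodule.mem_iInf] at hx ⊢
      intro s
      rw [Submodule.mem_comap, actL_apply, smul_smul]
      by_cases hs : s = g.top
      · have h1 := interchange (k := k) (D := D) (μ := μ) g (.dot [] i t)
        simp only [pad_dot, top_dot, bot_dot, List.append_nil, List.nil_append] at h1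
        rw [hs, ← h1, mul_smul]
        exact padClosure_stable _ _ _ _ (hx _)
      · rw [gen_mul_gen_of_ne, zero_smul]
        · exact zero_mem _
        · rw [pad_top, bot_dot]
          simpa using hs
  exact (Submodule.mem_iInf _).1 (key hx) s

theorem idem_smul_padClosure_eq_zero
    (h : ∀ s : List I, (∀ p, s ≠ p ++ t) → ∀ x ∈ W, gen (k := k) (D := D) μ (.idem s) • x = 0)
    (s : List I) (hs : ∀ p, s ≠ p ++ t) {x : X} (hx : x ∈ padClosure D μ t W) :
    gen (k := k) (D := D) μ (.idem s) • x = 0 := by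
  have key : padClosure D μ t W ≤ LinearMap.ker (actL (X := X) (gen (k := k) (D := D) μ (.idem s))) := by
    refine padClosure_le (fun x hx => h s hs x hx) (fun g x hx => ?_)
    rw [LinearMap.mem_ker, actL_apply, smul_smul, idem_mul_gen, if_neg, zero_smul]
    rw [pad_top]
    exact hs _
  exact key hx

/-- A slide past no strands is an idempotent, and these idempotents recover every vector supported
on sequences ending in `i t`. -/
theorem le_slideSpan (h : ∀ s : List I, (∀ p, s ≠ p ++ i :: t) → ∀ x ∈ W,
    gen (k := k) (D := D) μ (.idem s) • x = 0) : W ≤ slideSpan D μ i t W 0 := by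
  intro x hx
  rw [← one_smul (KLR k D μ) x, ← sum_idem, Finset.sum_smul]
  refine sum_mem fun s _ => ?_
  by_cases hs : ∃ p, s = p ++ i :: t
  · obtain ⟨p, rfl⟩ := hs
    exact slide_mem (p := p) (q := []) (Nat.zero_le _) hx
  · rw [h s (fun p hp => hs ⟨p, hp⟩) x hx]
    exact zero_mem _

theorem replicate_append_cons (n : ℕ) (i : I) (t : List I) :
    List.replicate n i ++ i :: t = List.replicate (n + 1) i ++ t := by
  rw [List.replicate_succ', List.append_assoc]; rfl

/-- The hypotheses on a subspace `W` of an `R(μ)`-module which make `W` behave like the subspace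
`K ⊗ V` for modules `K` with `ε_i(K) = 0` and `V` over `R(ni)`, with strands `t` on the right. -/
structure IsBlock (D : BorcherdsCartanDatum I) (μ : Multiset I) [Module (KLR k D μ) X]
    (i : I) (n : ℕ) (t : List I) (W : Submodule k X) : Prop where
  stable : PadStable D μ (List.replicate n i ++ t) W
  dot : ∀ s a b, a + b + 1 = n → ∀ x ∈ W, gen (k := k) (D := D) μ
    (.dot (s ++ List.replicate a i) i (List.replicate b i ++ t)) • x ∈ W
  cross : ∀ s a b, a + b + 2 = n → ∀ x ∈ W, gen (k := k) (D := D) μ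
    (.cross (s ++ List.replicate a i) i i (List.replicate b i ++ t)) • x ∈ W
  supp : ∀ s, (∀ p, s ≠ p ++ (List.replicate n i ++ t)) → ∀ x ∈ W,
    gen (k := k) (D := D) μ (.idem s) • x = 0
  eps : ∀ s, ∀ x ∈ W, gen (k := k) (D := D) μ (.idem (s ++ (List.replicate (n + 1) i ++ t))) • x = 0

/-- The last of the `n + 1` strands is handed over to `t`. The subspace stays the same; the dot on
that strand and its crossing are no longer recorded. -/
theorem IsBlock.shift {n : ℕ} (h : IsBlock D μ i (n + 1) t W) : IsBlock D μ i n (i :: t) W where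
  stable := by rw [replicate_append_cons]; exact h.stable
  dot s a b hab x hx := by rw [replicate_append_cons]; exact h.dot s a (b + 1) (by omega) x hx
  cross s a b hab x hx := by rw [replicate_append_cons]; exact h.cross s a (b + 1) (by omega) x hx
  supp s := by rw [replicate_append_cons]; exact h.supp s
  eps s := by rw [replicate_append_cons]; exact h.eps s

/-- Sliding `i` past strands `i` only uses crossings inside `i^{n+1}`, and a block is stable under
these. -/
theorem IsBlock.slide_smul_mem {n : ℕ} (h : IsBlock D μ i (n + 1) t W) (s : List I) (a b : ℕ)
    (hab : a + b = n) {x : X} (hx : x ∈ W) :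
    slide k D μ i t (s ++ List.replicate a i) (List.replicate b i) • x ∈ W := by
  induction b generalizing a with
  | zero =>
    obtain rfl : a = n := hab
    have := h.stable (.idem s) x hx
    rw [pad_idem, ← replicate_append_cons] at this
    simpa [slide] using this
  | succ b ih =>
    have := ih (a + 1) (by omega)
    rw [List.replicate_succ, slide, mul_smul]
    refine h.cross s a b (by omega) _ ?_
    rwa [List.append_assoc, ← List.replicate_succ']

/-- The part of the shuffle lemma that needs no basis: if `W` is a block, the part of `R(μ) W` on
which the last strands are `i^n` is contained in `W`. -/
theorem IsBlock.idem_smul_mem {n : ℕ} (h : IsBlock D μ i n t W) (s : List I) {z : X}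
    (hz : z ∈ padClosure D μ t W) :
    gen (k := k) (D := D) μ (.idem (s ++ (List.replicate n i ++ t))) • z ∈ W := by
  induction n generalizing t s z with
  | zero =>
    have hst : PadStable D μ t W := h.stable
    have := hst (.idem s) z (padClosure_le le_rfl hst hz)
    simpa [pad_idem] using this
  | succ n ih =>
    have ih' := ih h.shift
    -- Everything `W` generates is a sum of vectors `slide p q • x` with `x` in `W'`, the part
    -- generated without touching the last `i`. The induction hypothesis controls `W'`.
    set W' := padClosure D μ (i :: t) W with hW'
    have hst : PadStable D μ t (slideSpan D μ i t W' 0) :=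
      slideSpan_stable (padClosure_stable _ _) fun s x hx =>
        dot_smul_padClosure (fun s x hx => by
          by_cases hs : ∃ p, s = p ++ List.replicate n i
          · obtain ⟨p, rfl⟩ := hs
            exact h.dot p n 0 (by omega) x hx
          · rw [← gen_mul_bot, mul_smul, bot_dot, h.supp, smul_zero]
            · exact zero_mem _
            · rintro p hp
              rw [← replicate_append_cons, ← List.append_assoc] at hp
              exact hs ⟨p, List.append_cancel_right hp⟩
            · exact hx) s hx
    have hle : W' ≤ slideSpan D μ i t W' 0 := by
      refine le_slideSpan fun s hs x hx => idem_smul_padClosure_eq_zero (fun s hs x hx => ?_) s hs hx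
      refine h.supp s (fun p hp => hs (p ++ List.replicate n i) ?_) x hx
      rw [hp, List.append_assoc, replicate_append_cons]
    have hz' := padClosure_le ((le_padClosure _ _).trans hle) hst hz
    refine slideSpan_induction _ (fun p q _ x hx => ?_) hz'
    rw [smul_smul, idem_mul_slide]
    split_ifs with heq
    swap
    · rw [zero_smul]; exact zero_mem _
    have heq' : s ++ List.replicate (n + 1) i = p ++ i :: q := by
      apply List.append_cancel_right (bs := t); simpa using heq
    -- The harmless case: the strand stops among the last `n + 1` positions before `t`. It has then
    -- crossed only strands `i`, and `ih'` puts the part of `x` that matters into `W`.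
    have hshuffle : ∀ a b, a + b = n → p = s ++ List.replicate a i → q = List.replicate b i →
        slide k D μ i t p q • x ∈ W := by
      rintro a b hab rfl rfl
      rw [← slide_mul_bot, mul_smul]
      refine h.slide_smul_mem s a b hab ?_
      have := ih' s hx
      rwa [← hab, List.replicate_add, List.append_assoc, ← List.append_assoc,
        ← List.append_assoc] at this
    obtain ⟨c, rfl, hc⟩ | ⟨c, rfl, hc⟩ := List.append_eq_append_iff.1 heq'
    · obtain ⟨hlen, hc1, hc2⟩ := List.append_eq_replicate_iff.1 hc.symm
      rw [List.length_cons, List.replicate_succ, List.cons.injEq] at hc2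
      rw [List.length_cons] at hlen
      exact hshuffle c.length q.length (by omega) (by rw [← hc1]) hc2.2
    · cases c with
      | nil =>
        rw [List.nil_append, List.replicate_succ, List.cons.injEq] at hc
        exact hshuffle 0 n (by omega) (by simp) hc.2
      -- The strand stops further to the left. Then `q` ends in `i^{n+1}`, so together with the
      -- unslid `i` the bottom sequence ends in `i^{n+2}` before `t`, which `h.eps` excludes.
      | cons d c =>
        rw [List.cons_append, List.cons.injEq] at hc
        obtain ⟨rfl, rfl⟩ := hc
        have e : p ++ (c ++ List.replicate (n + 1) i) ++ i :: t
            = (p ++ c) ++ (List.replicate (n + 1 + 1) i ++ t) := by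
          rw [← replicate_append_cons]; simp
        have hy := ih' (p ++ c ++ [i]) hx
        have e' : p ++ c ++ [i] ++ (List.replicate n i ++ i :: t)
            = (p ++ c) ++ (List.replicate (n + 1 + 1) i ++ t) := by
          rw [replicate_append_cons, List.replicate_succ (n := n + 1)]; simp
        rw [e'] at hy
        have h0 := h.eps (p ++ c) _ hy
        rw [smul_smul, idem_mul_idem, if_pos rfl] at h0
        rw [← slide_mul_bot, mul_smul, e, h0, smul_zero]
        exact zero_mem _

end Shuffle

end KLR

/-! ### The nilHecke relations -/

/-- The relations of the nilHecke algebra on `n` strands (`δ = 1`), or of its degenerate analogue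
(`δ = 0`). -/
structure NilHeckeRel {B : Type v} [Ring B] (n : ℕ) (δ : B) (x t : ℕ → B) : Prop where
  x_x : ∀ a b, a < n → b < n → x a * x b = x b * x a
  x_t : ∀ a b, a < n → b + 1 < n → a ≠ b → a ≠ b + 1 → x a * t b = t b * x a
  t_t : ∀ a b, a + 1 < b → b + 1 < n → t a * t b = t b * t a
  slide_left : ∀ a, a + 1 < n → x a * t a = t a * x (a + 1) + δ
  slide_right : ∀ a, a + 1 < n → x (a + 1) * t a = t a * x a - δ
  t_sq : ∀ a, a + 1 < n → t a * t a = 0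
  braid : ∀ a, a + 2 < n → t a * t (a + 1) * t a = t (a + 1) * t a * t (a + 1)

namespace NilHeckeRel

variable {B : Type v} [Ring B]

/-- The product `t_j t_{j+1} ⋯ t_{j+m-1}`. -/
def cyc (t : ℕ → B) : ℕ → ℕ → B
  | _, 0 => 1
  | j, m + 1 => t j * cyc t (j + 1) m

/-- A product of crossings for the longest permutation of the last `d` of `n` strands. -/
def longest (t : ℕ → B) (n : ℕ) : ℕ → B
  | 0 => 1
  | d + 1 => longest t n d * cyc t (n - d - 1) d

theorem map_cyc {C : Type w} [Ring C] (φ : B →+* C) (t : ℕ → B) (j m : ℕ) :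
    cyc (fun a => φ (t a)) j m = φ (cyc t j m) := by
  induction m generalizing j with
  | zero => simp [cyc]
  | succ m ih => rw [cyc, ih, cyc, map_mul]

theorem map_longest {C : Type w} [Ring C] (φ : B →+* C) (t : ℕ → B) (n d : ℕ) :
    longest (fun a => φ (t a)) n d = φ (longest t n d) := by
  induction d with
  | zero => simp [longest]
  | succ d ih => rw [longest, ih, map_cyc, longest, map_mul]

theorem map {C : Type w} [Ring C] (φ : B →+* C) {n : ℕ} {δ : B} {x t : ℕ → B}
    (h : NilHeckeRel n δ x t) : NilHeckeRel n (φ δ) (fun a => φ (x a)) (fun a => φ (t a)) where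
  x_x a b ha hb := by rw [← map_mul, h.x_x a b ha hb, map_mul]
  x_t a b ha hb h1 h2 := by rw [← map_mul, h.x_t a b ha hb h1 h2, map_mul]
  t_t a b ha hb := by rw [← map_mul, h.t_t a b ha hb, map_mul]
  slide_left a ha := by rw [← map_mul, h.slide_left a ha, map_add, map_mul]
  slide_right a ha := by rw [← map_mul, h.slide_right a ha, map_sub, map_mul]
  t_sq a ha := by rw [← map_mul, h.t_sq a ha, map_zero]
  braid a ha := by simp only [← map_mul, h.braid a ha]

theorem cyc_succ_right (t : ℕ → B) (j m : ℕ) : cyc t j (m + 1) = cyc t j m * t (j + m) := by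
  induction m generalizing j with
  | zero => simp [cyc]
  | succ m ih =>
    rw [cyc, ih, cyc, mul_assoc]
    congr 3
    omega

variable {n : ℕ} {δ : B} {x t : ℕ → B} (h : NilHeckeRel n δ x t)

include h

theorem x_mul_cyc {a j m : ℕ} (ha : a < j) (hm : j + m < n) :
    x a * cyc t j m = cyc t j m * x a := by
  induction m generalizing j with
  | zero => simp [cyc]
  | succ m ih =>
    rw [cyc, ← mul_assoc, h.x_t a j (by omega) (by omega) (by omega) (by omega), mul_assoc,
      ih (by omega) (by omega), mul_assoc]

theorem x_mul_longest {a d : ℕ} (ha : a + d < n) :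
    x a * longest t n d = longest t n d * x a := by
  induction d with
  | zero => simp [longest]
  | succ d ih =>
    rw [longest, ← mul_assoc, ih (by omega), mul_assoc, h.x_mul_cyc (by omega) (by omega),
      mul_assoc]

theorem t_mul_cyc_of_lt {a j m : ℕ} (ha : a + 1 < j) (hm : j + m < n) :
    t a * cyc t j m = cyc t j m * t a := by
  induction m generalizing j with
  | zero => simp [cyc]
  | succ m ih =>
    rw [cyc, ← mul_assoc, h.t_t a j ha (by omega), mul_assoc, ih (by omega) (by omega), mul_assoc]

/-- One braid relation raises the index from `a` to `a + 1`; all other factors of the cycle commute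
with the crossing they meet. -/
theorem cyc_mul_t {a j m : ℕ} (hj : j ≤ a) (ha : a + 1 < j + m) (hm : j + m < n) :
    cyc t j m * t a = t (a + 1) * cyc t j m := by
  induction m generalizing j with
  | zero => omega
  | succ m ih =>
    rw [cyc, mul_assoc]
    rcases hj.lt_or_eq with hj | rfl
    · rw [ih (by omega) (by omega) (by omega), ← mul_assoc, h.t_t j (a + 1) (by omega) (by omega),
        mul_assoc]
    · cases m with
      | zero => omega
      | succ m =>
        rw [cyc, mul_assoc, ← h.t_mul_cyc_of_lt (by omega) (by omega), ← mul_assoc, ← mul_assoc,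
          ← mul_assoc, h.braid j (by omega), mul_assoc, mul_assoc]

/-- The outermost cycle turns `t a` into `t (a + 1)`, which the shorter longest word kills by
induction. For the last crossing the cycle itself ends in `t a`, and `t_sq` applies. -/
theorem longest_mul_t {a d : ℕ} (hd : d ≤ n) (ha : n ≤ a + d) (han : a + 1 < n) :
    longest t n d * t a = 0 := by
  induction d generalizing a with
  | zero => omega
  | succ d ih =>
    rw [longest, mul_assoc]
    rcases Nat.lt_or_ge (a + 2) n with ha2 | ha2
    · rw [h.cyc_mul_t (by omega) (by omega) (by omega), ← mul_assoc,
        ih (by omega) (by omega) (by omega), zero_mul]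
    · cases d with
      | zero => omega
      | succ d =>
        rw [cyc_succ_right, mul_assoc, show n - (d + 1) - 1 + d = a by omega, h.t_sq a han,
          mul_zero, mul_zero]

section Module

variable {E : Type w} [AddCommGroup E] [Module B E]

/-- Each `x j` that passes `t j` leaves a correction term; since `x j` kills `z` and commutes with
`x (j + 1)`, only the correction created last survives. -/
theorem x_pow_succ_t {j m : ℕ} (hj : j + 1 < n) (hδ : δ = 1) {z : E} (hz : x j • z = 0) :
    x j ^ (m + 1) • t j • z = t j • x (j + 1) ^ (m + 1) • z + x (j + 1) ^ m • z := by
  have hz' : ∀ m, x j • x (j + 1) ^ m • z = 0 := by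
    intro m
    have : Commute (x j) (x (j + 1)) := h.x_x j (j + 1) (by omega) hj
    rw [smul_smul, (this.pow_right m).eq, mul_smul, hz, smul_zero]
  have h1 : ∀ y : E, x j • t j • y = t j • x (j + 1) • y + y := by
    intro y
    rw [smul_smul, h.slide_left j hj, hδ, add_smul, mul_smul, one_smul]
  induction m with
  | zero => simpa using h1 z
  | succ m ih =>
    rw [pow_succ', mul_smul, ih, smul_add, hz', h1, add_zero, ← mul_smul (x (j + 1)), ← pow_succ']

/-- By `x_pow_succ_t`, powers of `x j` become powers of `x (j + 1)` on the shorter cycle. The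
vanishing of higher powers is carried along because it removes the first term there. -/
theorem x_pow_smul_cyc (hδ : δ = 1) {q : E} (hq : ∀ a < n, x a • q = 0) {j m : ℕ}
    (hm : j + m < n) : x j ^ m • cyc t j m • q = q ∧
      ∀ l, m < l → x j ^ l • cyc t j m • q = 0 := by
  induction m generalizing j with
  | zero =>
    simp only [cyc, pow_zero, one_smul, true_and]
    intro l hl
    obtain ⟨l, rfl⟩ := Nat.exists_eq_succ_of_ne_zero hl.ne'
    rw [Nat.succ_eq_add_one, pow_succ, mul_smul, hq j (by omega), smul_zero]
  | succ m ih =>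
    obtain ⟨h1, h2⟩ := ih (j := j + 1) (by omega)
    have hz : x j • cyc t (j + 1) m • q = 0 := by
      rw [smul_smul, h.x_mul_cyc (by omega) (by omega), mul_smul, hq j (by omega), smul_zero]
    rw [cyc]
    refine ⟨?_, fun l hl => ?_⟩
    · rw [mul_smul, h.x_pow_succ_t (by omega) hδ hz, h1, h2 (m + 1) (by omega), smul_zero, zero_add]
    · obtain ⟨l, rfl⟩ := Nat.exists_eq_succ_of_ne_zero (Nat.ne_zero_of_lt hl)
      rw [mul_smul, Nat.succ_eq_add_one, h.x_pow_succ_t (by omega) hδ hz, h2 _ (by omega),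
        h2 _ (by omega), smul_zero, zero_add]

/-- A power of `x (n - d - 1)` undoes the outermost cycle and commutes with the shorter longest
word. In effect a monomial in the `x a` inverts the longest word on vectors killed by the `x a`. -/
theorem eq_zero_of_longest_smul (hδ : δ = 1) {q : E} (hq : ∀ a < n, x a • q = 0) {d : ℕ}
    (hd : d ≤ n) (h0 : longest t n d • q = 0) : q = 0 := by
  induction d with
  | zero => simpa [longest] using h0
  | succ d ih =>
    refine ih (by omega) ?_
    have hc : Commute (x (n - d - 1)) (longest t n d) := h.x_mul_longest (by omega)
    rw [← (h.x_pow_smul_cyc hδ hq (j := n - d - 1) (m := d) (by omega)).1, smul_smul, smul_smul,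
      ← (hc.pow_left d).eq, mul_assoc, mul_smul, ← longest, h0, smul_zero]

/-- A nonzero subset stable under the crossings contains a nonzero vector killed by them. -/
theorem exists_t_killed (U : Set E) (hU : ∀ a, a + 1 < n → ∀ y ∈ U, t a • y ∈ U)
    (hne : ∃ y ∈ U, y ≠ 0) : ∃ y ∈ U, y ≠ 0 ∧ ∀ a, a + 1 < n → t a • y = 0 := by
  suffices H : ∀ m, m ≤ n - 1 → ∃ y ∈ U, y ≠ 0 ∧ ∀ a < m, t a • y = 0 by
    obtain ⟨y, h1, h2, h3⟩ := H (n - 1) le_rfl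
    exact ⟨y, h1, h2, fun a ha => h3 a (by omega)⟩
  intro m
  induction m with
  | zero =>
    obtain ⟨y, h1, h2⟩ := hne
    exact fun _ => ⟨y, h1, h2, by simp⟩
  | succ m ih =>
    intro hm
    -- With `y` killed by `t 0, …, t (m - 1)`, the candidates are `t j ⋯ t m • y` for `j ≤ m + 1`,
    -- the last being `y` itself. The nonzero one with the smallest `j` works.
    obtain ⟨y, hyU, hy0, hy⟩ := ih (by omega)
    have hcU : ∀ l j, j + l = m + 1 → cyc t j l • y ∈ U := by
      intro l
      induction l with
      | zero => intro j _; simpa [cyc] using hyU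
      | succ l ihl =>
        intro j hj
        rw [cyc, mul_smul]
        exact hU j (by omega) _ (ihl (j + 1) (by omega))
    classical
    have hex : ∃ j, j ≤ m + 1 ∧ cyc t j (m + 1 - j) • y ≠ 0 :=
      ⟨m + 1, le_rfl, by simpa [cyc] using hy0⟩
    obtain ⟨hj, hj0⟩ := Nat.find_spec hex
    have hmin := fun j' (hj' : j' < Nat.find hex) => Nat.find_min hex hj'
    generalize Nat.find hex = j at hj hj0 hmin
    refine ⟨_, hcU (m + 1 - j) j (by omega), hj0, fun a ha => ?_⟩
    -- Commutation settles `a + 1 < j`, minimality of `j` settles `a + 1 = j`, the shift `cyc_mul_t`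
    -- settles `a > j`, and `t_sq` settles `a = j`.
    rcases Nat.lt_trichotomy (a + 1) j with haj | haj | haj
    · rw [smul_smul, h.t_mul_cyc_of_lt haj (by omega), mul_smul, hy a (by omega), smul_zero]
    · have := hmin a (by omega)
      rw [not_and, not_ne_iff, show m + 1 - a = (m + 1 - j) + 1 by omega, cyc, mul_smul, haj] at this
      exact this (by omega)
    · rcases Nat.lt_or_ge j a with hja | hja
      · obtain ⟨a, rfl⟩ := Nat.exists_eq_succ_of_ne_zero (Nat.ne_zero_of_lt hja)
        rw [smul_smul, Nat.succ_eq_add_one, ← h.cyc_mul_t (by omega) (by omega) (by omega), mul_smul,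
          hy a (by omega), smul_zero]
      · obtain rfl : j = a := by omega
        rw [show m + 1 - j = (m - j) + 1 by omega, cyc, mul_smul, smul_smul, h.t_sq _ (by omega),
          zero_smul]

omit h

/-- `v` is killed by all products of at least `l` of the `x_a`. -/
def XNil (n : ℕ) (x : ℕ → B) (l : ℕ) (y : E) : Prop :=
  ∀ L : List ℕ, l ≤ L.length → (∀ a ∈ L, a < n) → (L.map x).prod • y = 0

theorem XNil.mono {l l' : ℕ} (hl : l ≤ l') {y : E} (hy : XNil n x l y) : XNil n x l' y :=
  fun L hL => hy L (hl.trans hL)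

theorem XNil.add {l : ℕ} {y z : E} (hy : XNil n x l y) (hz : XNil n x l z) :
    XNil n x l (y + z) := fun L hL hn => by rw [smul_add, hy L hL hn, hz L hL hn, add_zero]

theorem xNil_zero_iff {y : E} : XNil n x 0 y ↔ y = 0 :=
  ⟨fun hy => by simpa using hy [] le_rfl (by simp), fun hy L _ _ => by rw [hy, smul_zero]⟩

theorem xNil_succ_iff {l : ℕ} {y : E} : XNil n x (l + 1) y ↔ ∀ a < n, XNil n x l (x a • y) := by
  constructor
  · intro hy a ha L hL hn
    have := hy (L ++ [a]) (by simpa using hL) (by simpa [or_imp, forall_and] using ⟨hn, ha⟩)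
    simpa [mul_smul] using this
  · intro hy L hL hn
    obtain rfl | ⟨L, a, rfl⟩ := L.eq_nil_or_concat
    · simp at hL
    · simp only [List.concat_eq_append, List.mem_append, List.mem_singleton] at hn hL
      have := hy a (hn a (Or.inr rfl)) L (by simpa using hL) (fun b hb => hn b (Or.inl hb))
      simpa [mul_smul] using this

/-- A nonzero subset of locally nilpotent vectors stable under the `x_a` contains a nonzero vector
killed by them. -/
theorem exists_x_killed (U : Set E) (hU : ∀ a < n, ∀ y ∈ U, x a • y ∈ U) {l : ℕ} {y : E}
    (hy : y ∈ U) (hl : XNil n x l y) (hy0 : y ≠ 0) : ∃ y ∈ U, y ≠ 0 ∧ ∀ a < n, x a • y = 0 := by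
  induction l generalizing y with
  | zero => exact absurd (xNil_zero_iff.1 hl) hy0
  | succ l ih =>
    by_cases hx : ∀ a < n, x a • y = 0
    · exact ⟨y, hy, hy0, hx⟩
    · push Not at hx
      obtain ⟨a, ha, hxa⟩ := hx
      exact ih (hU a ha y hy) (xNil_succ_iff.1 hl a ha) hxa

include h

/-- One shape for the three ways in which a dot meets a crossing, so that later inductions need not
distinguish them. -/
theorem x_smul_t_smul (hδ : δ = 1) {a b : ℕ} (ha : a < n) (hb : b + 1 < n) :
    ∃ c < n, ∃ ε : ℤ, ∀ y : E, x a • t b • y = t b • x c • y + ε • y := by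
  by_cases h1 : a = b
  · refine ⟨b + 1, hb, 1, fun y => ?_⟩
    rw [h1, smul_smul, h.slide_left b hb, hδ, add_smul, mul_smul, one_smul, one_smul]
  by_cases h2 : a = b + 1
  · refine ⟨b, by omega, -1, fun y => ?_⟩
    rw [h2, smul_smul, h.slide_right b hb, hδ, sub_smul, mul_smul, one_smul, neg_smul, one_smul,
      sub_eq_add_neg]
  · refine ⟨a, ha, 0, fun y => ?_⟩
    rw [smul_smul, h.x_t a b ha hb h1 h2, mul_smul, zero_smul, add_zero]

theorem x_smul_t_smul_eq_zero (hδ : δ = 0) {b : ℕ} (hb : b + 1 < n) {y : E}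
    (hy : ∀ a < n, x a • y = 0) {a : ℕ} (ha : a < n) : x a • t b • y = 0 := by
  by_cases h1 : a = b
  · rw [h1, smul_smul, h.slide_left b hb, hδ, add_zero, mul_smul, hy _ hb, smul_zero]
  by_cases h2 : a = b + 1
  · rw [h2, smul_smul, h.slide_right b hb, hδ, sub_zero, mul_smul, hy b (by omega), smul_zero]
  · rw [smul_smul, h.x_t a b ha hb h1 h2, mul_smul, hy a ha, smul_zero]

theorem XNil.t_smul (hδ : δ = 1) {l b : ℕ} (hb : b + 1 < n) {y : E} (hy : XNil n x l y) :
    XNil n x (l + 1) (t b • y) := by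
  induction l generalizing y with
  | zero =>
    rw [xNil_zero_iff.1 hy, smul_zero]
    exact (xNil_zero_iff.2 rfl).mono (Nat.zero_le _)
  | succ l ih =>
    refine xNil_succ_iff.2 fun a ha => ?_
    obtain ⟨c, hc, ε, hε⟩ := h.x_smul_t_smul (E := E) hδ ha hb
    rw [hε]
    refine (ih (xNil_succ_iff.1 hy c hc)).add fun L hL hn => ?_
    rw [smul_comm, hy L hL hn, smul_zero]

end Module

end NilHeckeRel

/-! ### The one-colour algebra `R(ni)` -/

namespace KLR

open Diagram

section OneColour

variable {k : Type u} [Field k] {I : Type v} [DecidableEq I] {D : BorcherdsCartanDatum I}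
variable {i : I} {n : ℕ}

/-- The dot on the strand `a` in `R(ni)`. -/
noncomputable def xRep (k : Type u) [Field k] (D : BorcherdsCartanDatum I) (i : I) (n a : ℕ) :
    KLR k D (Multiset.replicate n i) :=
  gen _ (.dot (List.replicate a i) i (List.replicate (n - 1 - a) i))

/-- The crossing of the strands `a` and `a + 1` in `R(ni)`. -/
noncomputable def tRep (k : Type u) [Field k] (D : BorcherdsCartanDatum I) (i : I) (n a : ℕ) :
    KLR k D (Multiset.replicate n i) :=
  gen _ (.cross (List.replicate a i) i i (List.replicate (n - 2 - a) i))

theorem mem_seqOf_replicate {s : List I} :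
    s ∈ SeqOf (Multiset.replicate n i) ↔ s = List.replicate n i := by
  rw [mem_seqOf, ← Multiset.coe_replicate, Multiset.coe_eq_coe, List.perm_replicate]

theorem seqOf_replicate : SeqOf (Multiset.replicate n i) = {List.replicate n i} := by
  ext s
  rw [mem_seqOf_replicate, Finset.mem_singleton]

theorem gen_idem_replicate :
    gen (k := k) (D := D) (Multiset.replicate n i) (.idem (List.replicate n i)) = 1 := by
  rw [← sum_idem, seqOf_replicate, Finset.sum_singleton]

/-- The only sequence of weight `ni` is `i^n`; a diagram on any other list vanishes. -/
theorem gen_dot_replicate (a : List I) (j : I) (b : List I) :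
    gen (k := k) (D := D) (Multiset.replicate n i) (.dot a j b) = 0 ∨
      ∃ l < n, gen (k := k) (D := D) (Multiset.replicate n i) (.dot a j b) = xRep k D i n l := by
  by_cases h : a ++ j :: b ∈ SeqOf (Multiset.replicate n i)
  · right
    rw [mem_seqOf_replicate, List.append_eq_replicate_iff, List.length_cons] at h
    obtain ⟨h1, h2, h3⟩ := h
    rw [List.replicate_succ, List.cons.injEq] at h3
    refine ⟨a.length, by omega, ?_⟩
    rw [xRep, h3.1, ← h2, show n - 1 - a.length = b.length by omega, ← h3.2]
  · exact Or.inl (gen_eq_zero h)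

theorem gen_cross_replicate (a : List I) (j l : I) (b : List I) :
    gen (k := k) (D := D) (Multiset.replicate n i) (.cross a j l b) = 0 ∨
      ∃ c, c + 1 < n ∧
        gen (k := k) (D := D) (Multiset.replicate n i) (.cross a j l b) = tRep k D i n c := by
  by_cases h : a ++ l :: j :: b ∈ SeqOf (Multiset.replicate n i)
  · right
    rw [mem_seqOf_replicate, List.append_eq_replicate_iff, List.length_cons, List.length_cons] at h
    obtain ⟨h1, h2, h3⟩ := h
    rw [List.replicate_succ, List.replicate_succ, List.cons.injEq, List.cons.injEq] at h3
    refine ⟨a.length, by omega, ?_⟩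
    rw [tRep, h3.1, h3.2.1, ← h2, show n - 2 - a.length = b.length by omega, ← h3.2.2]
  · exact Or.inl (gen_eq_zero h)

/-- A subspace of an `R(ni)`-module that is stable under dots and crossings is a submodule. -/
theorem smul_mem_of_rep {X : Type w} [AddCommGroup X] [Module k X]
    [Module (KLR k D (Multiset.replicate n i)) X]
    [IsScalarTower k (KLR k D (Multiset.replicate n i)) X] (W : Submodule k X)
    (hx : ∀ a < n, ∀ y ∈ W, xRep k D i n a • y ∈ W)
    (ht : ∀ a, a + 1 < n → ∀ y ∈ W, tRep k D i n a • y ∈ W)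
    (r : KLR k D (Multiset.replicate n i)) {y : X} (hy : y ∈ W) : r • y ∈ W := by
  refine smul_mem_of_gen W (fun g y hy => ?_) r hy
  cases g with
  | idem s =>
    by_cases hs : s ∈ SeqOf (Multiset.replicate n i)
    · rw [mem_seqOf_replicate.1 hs, gen_idem_replicate, one_smul]; exact hy
    · rw [gen_idem_eq_zero hs, zero_smul]; exact W.zero_mem
  | dot a j b =>
    obtain h | ⟨l, hl, h⟩ := gen_dot_replicate (k := k) (D := D) (i := i) (n := n) a j b
    · rw [h, zero_smul]; exact W.zero_mem
    · rw [h]; exact hx l hl y hy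
  | cross a j l b =>
    obtain h | ⟨c, hc, h⟩ := gen_cross_replicate (k := k) (D := D) (i := i) (n := n) a j l b
    · rw [h, zero_smul]; exact W.zero_mem
    · rw [h]; exact ht c hc y hy

open Classical in
-- With a single colour the quadratic and braid terms are zero, so only the dot slides see whether
-- `i` is real.
theorem nilHeckeRel_rep : NilHeckeRel n
    (if D.IsReal i then (1 : KLR k D (Multiset.replicate n i)) else 0)
    (xRep k D i n) (tRep k D i n) := by
  have hxx : ∀ a b, a < b → b < n → xRep k D i n a * xRep k D i n b =
      xRep k D i n b * xRep k D i n a := by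
    intro a b hab hb
    have := mk_rel (D := D) (ν := Multiset.replicate n i) (DiagramRel.dot_dot (k := k)
      (List.replicate a i) i (List.replicate (b - a - 1) i) i (List.replicate (n - 1 - b) i))
    rw [← List.replicate_succ, ← List.replicate_succ, List.replicate_append_replicate,
      List.replicate_append_replicate, map_mul, map_mul,
      show b - a - 1 + (n - 1 - b + 1) = n - 1 - a by omega,
      show a + (b - a - 1 + 1) = b by omega] at this
    exact this
  have hδ : ∀ a, a + 1 < n → mk (D := D) (Multiset.replicate n i) (slideTerm k D
      (List.replicate a i) i i (List.replicate (n - 2 - a) i)) =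
        if D.IsReal i then 1 else 0 := by
    intro a ha
    rw [slideTerm]
    simp only [true_and]
    split_ifs
    · rw [← gen_idem_replicate (k := k) (D := D) (i := i) (n := n), ← List.replicate_succ,
        ← List.replicate_succ, List.replicate_append_replicate,
        show a + (n - 2 - a + 1 + 1) = n by omega]
      rfl
    · exact map_zero _
  have e1 : ∀ a, List.replicate a i ++ [i] = List.replicate (a + 1) i :=
    fun a => List.replicate_succ'.symm
  constructor
  · intro a b ha hb
    rcases Nat.lt_trichotomy a b with hab | rfl | hab
    · exact hxx a b hab hb
    · rfl
    · exact (hxx b a hab ha).symm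
  · intro a b ha hb h1 h2
    rcases Nat.lt_or_ge a b with hab | hab
    · have := mk_rel (D := D) (ν := Multiset.replicate n i) (DiagramRel.dot_cross (k := k)
        (List.replicate a i) i (List.replicate (b - a - 1) i) i i (List.replicate (n - 2 - b) i))
      rw [← List.replicate_succ, ← List.replicate_succ, ← List.replicate_succ,
        List.replicate_append_replicate, List.replicate_append_replicate, map_mul, map_mul,
        show b - a - 1 + (n - 2 - b + 1 + 1) = n - 1 - a by omega,
        show a + (b - a - 1 + 1) = b by omega] at this
      exact this
    · have := mk_rel (D := D) (ν := Multiset.replicate n i) (DiagramRel.cross_dot (k := k)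
        (List.replicate b i) i i (List.replicate (a - b - 2) i) i (List.replicate (n - 1 - a) i))
      rw [← List.replicate_succ, ← List.replicate_succ, ← List.replicate_succ,
        List.replicate_append_replicate, List.replicate_append_replicate, map_mul, map_mul,
        show a - b - 2 + (n - 1 - a + 1) = n - 2 - b by omega,
        show b + (a - b - 2 + 1 + 1) = a by omega] at this
      exact this
  · intro a b hab hb
    have := mk_rel (D := D) (ν := Multiset.replicate n i) (DiagramRel.cross_cross (k := k)
      (List.replicate a i) i i (List.replicate (b - a - 2) i) i i (List.replicate (n - 2 - b) i))
    rw [← List.replicate_succ, ← List.replicate_succ, ← List.replicate_succ, ← List.replicate_succ,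
      List.replicate_append_replicate, List.replicate_append_replicate, map_mul, map_mul,
      show b - a - 2 + (n - 2 - b + 1 + 1) = n - 2 - a by omega,
      show a + (b - a - 2 + 1 + 1) = b by omega] at this
    exact this.symm
  · intro a ha
    have := dot_mul_cross_left (k := k) (D := D) (μ := Multiset.replicate n i)
      (List.replicate a i) i i (List.replicate (n - 2 - a) i)
    rw [hδ a ha, e1, ← List.replicate_succ, show n - 2 - a + 1 = n - 1 - a by omega] at this
    rw [xRep, xRep, show n - 1 - (a + 1) = n - 2 - a by omega]
    exact this
  · intro a ha
    have := dot_mul_cross_right (k := k) (D := D) (μ := Multiset.replicate n i)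
      (List.replicate a i) i i (List.replicate (n - 2 - a) i)
    rw [hδ a ha, e1, ← List.replicate_succ, show n - 2 - a + 1 = n - 1 - a by omega] at this
    rw [xRep, xRep, show n - 1 - (a + 1) = n - 2 - a by omega]
    exact this
  · intro a ha
    have := cross_mul_cross (k := k) (D := D) (μ := Multiset.replicate n i)
      (List.replicate a i) i i (List.replicate (n - 2 - a) i)
    rwa [quadTerm, if_pos rfl, map_zero] at this
  · intro a ha
    have := braid_gen (k := k) (D := D) (μ := Multiset.replicate n i)
      (List.replicate a i) i i i (List.replicate (n - 3 - a) i)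
    rw [braidTerm, if_neg (by simp), map_zero, sub_zero, e1, ← List.replicate_succ,
      show n - 3 - a + 1 = n - 2 - a by omega] at this
    rw [mul_assoc, mul_assoc, tRep, tRep, show n - 2 - (a + 1) = n - 3 - a by omega]
    exact this.symm

end OneColour

end KLR

/-! ### Graded subspaces -/

section GradedLinearAlgebra

variable {k : Type u} [Field k] {E : Type v} [AddCommGroup E] [Module k E]
  {F : Type w} [AddCommGroup F] [Module k F] {𝓜 : ℤ → Submodule k E} {𝓝 : ℤ → Submodule k F}

/-- `S` contains the components of its elements. -/
def CompClosed (𝓜 : ℤ → Submodule k E) (S : Submodule k E) : Prop :=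
  ∀ (s : Finset ℤ) (f : ℤ → E), (∀ d, f d ∈ 𝓜 d) → ∑ d ∈ s, f d ∈ S → ∀ d ∈ s, f d ∈ S

theorem exists_sum_components (h𝓜 : iSup 𝓜 = ⊤) (e : E) :
    ∃ (s : Finset ℤ) (f : ℤ → E), (∀ d, f d ∈ 𝓜 d) ∧ ∑ d ∈ s, f d = e := by
  obtain ⟨f, hf, rfl⟩ := (Submodule.mem_iSup_iff_exists_finsupp 𝓜 e).1 (h𝓜 ▸ Submodule.mem_top)
  exact ⟨f.support, f, hf, rfl⟩

theorem CompClosed.le_iSup {S : Submodule k E} (hS : CompClosed 𝓜 S) (h𝓜 : iSup 𝓜 = ⊤) :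
    S ≤ ⨆ d, S ⊓ 𝓜 d := by
  intro e he
  obtain ⟨s, f, hf, rfl⟩ := exists_sum_components h𝓜 e
  exact sum_mem fun d hd => Submodule.mem_iSup_of_mem d ⟨hS s f hf he d hd, hf d⟩

/-- The images of the components lie in different, independent components, so their sum vanishes
only termwise. -/
theorem compClosed_ker (h𝓝 : iSupIndep 𝓝) (φ : E →ₗ[k] F) (c : ℤ)
    (hφ : ∀ d, ∀ e ∈ 𝓜 d, φ e ∈ 𝓝 (d + c)) : CompClosed 𝓜 (LinearMap.ker φ) := by
  intro s f hf hs d hd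
  have hi : iSupIndep fun d => 𝓝 (d + c) := h𝓝.comp (add_left_injective c)
  rw [iSupIndep_iff_finsetSum_eq_zero_imp_eq_zero] at hi
  rw [LinearMap.mem_ker, map_sum] at hs
  exact hi s (fun d => φ (f d)) (fun d _ => hφ d _ (hf d)) hs d hd

theorem CompClosed.iInf {ι : Sort*} {S : ι → Submodule k E} (h : ∀ j, CompClosed 𝓜 (S j)) :
    CompClosed 𝓜 (⨅ j, S j) := by
  intro s f hf hs d hd
  rw [Submodule.mem_iInf] at hs ⊢
  exact fun j => h j s f hf (hs j) d hd

theorem isInternal_comap (h : DirectSum.IsInternal 𝓜) {S : Submodule k E}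
    (hS : S ≤ ⨆ d, S ⊓ 𝓜 d) : DirectSum.IsInternal fun d => (𝓜 d).comap S.subtype := by
  refine DirectSum.isInternal_submodule_of_iSupIndep_of_iSup_eq_top ?_ ?_
  · have hi := (iSupIndep_iff_finsetSum_eq_zero_imp_eq_zero _).1 h.submodule_iSupIndep
    rw [iSupIndep_iff_finsetSum_eq_zero_imp_eq_zero]
    intro s f hf hs d hd
    refine Subtype.ext (hi s (fun d => (f d : E)) hf ?_ d hd)
    rw [← Submodule.coe_sum, hs, Submodule.coe_zero]
  · rw [eq_top_iff]
    rintro ⟨e, he⟩ -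
    have key : S ≤ (⨆ d, (𝓜 d).comap S.subtype).map S.subtype := by
      refine hS.trans (iSup_le fun d => ?_)
      rintro e ⟨he, hd⟩
      exact ⟨⟨e, he⟩, Submodule.mem_iSup_of_mem d hd, rfl⟩
    obtain ⟨e', he', h2⟩ := key he
    rwa [show (⟨e, he⟩ : S) = e' from Subtype.ext h2.symm]

/-- An injective map of degree zero from a sum of components reflects degrees. -/
theorem mem_of_map_mem (h𝓜 : iSup 𝓜 = ⊤) (h𝓝 : iSupIndep 𝓝) (φ : E →ₗ[k] F)
    (hφ : ∀ d, ∀ e ∈ 𝓜 d, φ e ∈ 𝓝 d) (hinj : Function.Injective φ) {d : ℤ} {e : E}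
    (he : φ e ∈ 𝓝 d) : e ∈ 𝓜 d := by
  obtain ⟨s, f, hf, rfl⟩ := exists_sum_components h𝓜 e
  -- Two decompositions of `φ e` are compared: the images of the components of `e`, and `φ e` alone
  -- in degree `d`. Injectivity then makes the components of `e` in other degrees vanish.
  have hi := (iSupIndep_iff_finsetSum_eq_imp_eq _).1 h𝓝 (insert d s)
    (fun c => if c ∈ s then φ (f c) else 0)
    (fun c => if c = d then φ (∑ c ∈ s, f c) else 0) (fun c _ => ⟨?_, ?_⟩) ?_
  · refine sum_mem fun c hc => ?_
    have := hi c (Finset.mem_insert_of_mem hc)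
    rw [if_pos hc] at this
    by_cases hcd : c = d
    · exact hcd ▸ hf c
    · rw [if_neg hcd, ← map_zero φ] at this
      rw [hinj this]
      exact zero_mem _
  · split_ifs
    · exact hφ c _ (hf c)
    · exact zero_mem _
  · split_ifs with h
    · exact h ▸ he
    · exact zero_mem _
  · rw [Finset.sum_ite_eq' (insert d s), if_pos (Finset.mem_insert_self d s), map_sum,
      ← Finset.sum_filter]
    refine Finset.sum_congr ?_ fun _ _ => rfl
    ext c
    simp +contextual

end GradedLinearAlgebra

/-! ### Outer tensor products and cyclic modules -/

namespace GrMod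

section Outer

variable {k : Type u} [Field k] {A B : Type v} [Ring A] [Algebra k A] [Ring B] [Algebra k B]

/-- The pure tensors of an outer tensor product. -/
noncomputable def outerMk (M : GrMod.{u, v, w} k A) (N : GrMod.{u, v, w'} k B) :
    M.carrier →ₗ[k] N.carrier →ₗ[k] (M.outer N).carrier :=
  TensorProduct.mk k M.carrier N.carrier

variable {M : GrMod.{u, v, w} k A} {N : GrMod.{u, v, w'} k B}

theorem tmul_smul_outerMk (a : A) (b : B) (m : M.carrier) (n : N.carrier) :
    (a ⊗ₜ[k] b) • outerMk M N m n = outerMk M N (a • m) (b • n) := rfl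

theorem outer_induction {p : (M.outer N).carrier → Prop} (zero : p 0)
    (mk : ∀ m n, p (outerMk M N m n)) (add : ∀ z z', p z → p z' → p (z + z')) (z) : p z :=
  @TensorProduct.induction_on k _ M.carrier N.carrier _ _ _ _ p z zero mk add

theorem outerMk_mem_deg {c d : ℤ} {m : M.carrier} {n : N.carrier} (hm : m ∈ M.deg c)
    (hn : n ∈ N.deg d) : outerMk M N m n ∈ (M.outer N).deg (c + d) :=
  Submodule.subset_span (R := k) (M := M.carrier ⊗[k] N.carrier) ⟨c, d, rfl, m, hm, n, hn, rfl⟩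

theorem outer_deg_le {d : ℤ} {S : Submodule k (M.outer N).carrier}
    (h : ∀ a b, a + b = d → ∀ m ∈ M.deg a, ∀ n ∈ N.deg b, outerMk M N m n ∈ S) :
    (M.outer N).deg d ≤ S := by
  refine Submodule.span_le.2 ?_
  rintro _ ⟨a, b, hab, m, hm, n, hn, rfl⟩
  exact h a b hab m hm n hn

/-- The linear map on an outer tensor product given by a bilinear map. -/
noncomputable def outerLift {F : Type*} [AddCommGroup F] [Module k F]
    (f : M.carrier →ₗ[k] N.carrier →ₗ[k] F) : (M.outer N).carrier →ₗ[k] F :=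
  TensorProduct.lift f

/-- Spanning is enough: degrees in the tensor product are recovered by `mem_of_map_mem` from an
injective map into a graded module. -/
theorem iSup_outer_deg (hM : iSup M.deg = ⊤) (hN : iSup N.deg = ⊤) : iSup (M.outer N).deg = ⊤ := by
  rw [eq_top_iff]
  rintro z -
  induction z using outer_induction with
  | zero => exact Submodule.zero_mem _
  | add z z' h h' => exact Submodule.add_mem _ h h'
  | mk m n =>
    obtain ⟨s, f, hf, rfl⟩ := exists_sum_components hM m
    obtain ⟨s', f', hf', rfl⟩ := exists_sum_components hN n
    rw [map_sum (outerMk M N), LinearMap.sum_apply]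
    refine Submodule.sum_mem _ fun c _ => ?_
    rw [map_sum]
    exact Submodule.sum_mem _ fun d _ => Submodule.mem_iSup_of_mem (c + d)
      (outerMk_mem_deg (hf c) (hf' d))

/-- The cyclic module `B / J`. -/
def cyclic (ℬ : ℤ → Submodule k B) (J : Ideal B) : GrMod.{u, v, v} k B where
  carrier := B ⧸ J
  deg d := (ℬ d).map (J.mkQ.restrictScalars k)

/-- The quotient map onto `B / J`. -/
def cyclicMk (ℬ : ℤ → Submodule k B) (J : Ideal B) : B →ₗ[B] (cyclic ℬ J).carrier := J.mkQ

theorem cyclicMk_surjective (ℬ : ℤ → Submodule k B) (J : Ideal B) :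
    Function.Surjective (cyclicMk ℬ J) := J.mkQ_surjective

theorem cyclicMk_eq_zero (ℬ : ℤ → Submodule k B) (J : Ideal B) {b : B} (hb : b ∈ J) :
    cyclicMk ℬ J b = 0 := (Submodule.Quotient.mk_eq_zero J).2 hb

theorem iSup_cyclic_deg {ℬ : ℤ → Submodule k B} (J : Ideal B) (hB : iSup ℬ = ⊤) :
    iSup (cyclic ℬ J).deg = ⊤ := by
  change (⨆ d, (ℬ d).map (J.mkQ.restrictScalars k)) = ⊤
  rw [← Submodule.map_iSup, hB, Submodule.map_top]
  exact LinearMap.range_eq_top.2 J.mkQ_surjective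

/-- The linear map on `B / J` given by a linear map on `B`. -/
noncomputable def cyclicLift (ℬ : ℤ → Submodule k B) (J : Ideal B) {F : Type*} [AddCommGroup F]
    [Module k F] (f : B →ₗ[k] F) (hf : ∀ b ∈ J, f b = 0) : (cyclic ℬ J).carrier →ₗ[k] F :=
  (Submodule.liftQ (J.restrictScalars k) f hf) ∘ₗ
    (Submodule.Quotient.restrictScalarsEquiv k J).symm.toLinearMap

end Outer

/-! ### Vectors killed by a left ideal, and evaluation -/

section Annihilator

variable {k : Type u} [Field k] {A B : Type v} [Ring A] [Algebra k A] [Ring B] [Algebra k B]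

/-- The vectors of an `A ⊗ B`-module killed by a left ideal of `B`. -/
def annSpace (E : GrMod.{u, v, w} k (A ⊗[k] B)) (J : Ideal B) : Submodule k E.carrier where
  carrier := {e | ∀ b ∈ J, ((1 : A) ⊗ₜ[k] b) • e = 0}
  add_mem' he he' b hb := by rw [smul_add, he b hb, he' b hb, add_zero]
  zero_mem' b _ := smul_zero _
  smul_mem' c e he b hb := by rw [smul_comm, he b hb, smul_zero]

theorem tmul_one_smul_mem (E : GrMod.{u, v, w} k (A ⊗[k] B)) (J : Ideal B) (a : A) {e : E.carrier}
    (he : e ∈ annSpace E J) : (a ⊗ₜ[k] (1 : B)) • e ∈ annSpace E J := by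
  intro b hb
  rw [smul_smul, Algebra.TensorProduct.tmul_mul_tmul, one_mul, mul_one,
    show a ⊗ₜ[k] b = (a ⊗ₜ[k] (1 : B)) * ((1 : A) ⊗ₜ[k] b) by simp, mul_smul, he b hb, smul_zero]

/-- The action of `A` on `annSpace E J`. -/
@[reducible] def annModule (E : GrMod.{u, v, w} k (A ⊗[k] B)) (J : Ideal B) :
    Module A (annSpace E J) where
  smul a e := ⟨(a ⊗ₜ[k] (1 : B)) • e.1, tmul_one_smul_mem E J a e.2⟩
  one_smul e := Subtype.ext (one_smul (A ⊗[k] B) e.1)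
  mul_smul a a' e := Subtype.ext (by
    change ((a * a') ⊗ₜ[k] (1 : B)) • e.1 = (a ⊗ₜ[k] (1 : B)) • (a' ⊗ₜ[k] (1 : B)) • e.1
    rw [smul_smul, Algebra.TensorProduct.tmul_mul_tmul, mul_one])
  smul_zero a := Subtype.ext (smul_zero _)
  smul_add a e e' := Subtype.ext (smul_add _ _ _)
  add_smul a a' e := Subtype.ext (by
    change ((a + a') ⊗ₜ[k] (1 : B)) • e.1 = (a ⊗ₜ[k] (1 : B)) • e.1 + (a' ⊗ₜ[k] (1 : B)) • e.1
    rw [TensorProduct.add_tmul, add_smul])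
  zero_smul e := Subtype.ext (by
    change ((0 : A) ⊗ₜ[k] (1 : B)) • e.1 = 0
    rw [TensorProduct.zero_tmul, zero_smul])

/-- The graded `A`-module of the vectors killed by a left ideal of `B`. -/
def ann (E : GrMod.{u, v, w} k (A ⊗[k] B)) (J : Ideal B) : GrMod.{u, v, w} k A :=
  letI act := annModule E J
  { carrier := annSpace E J
    module := act
    tower := ⟨fun c a e => Subtype.ext (by
      change ((c • a) ⊗ₜ[k] (1 : B)) • e.1 = c • ((a ⊗ₜ[k] (1 : B)) • e.1)
      rw [← TensorProduct.smul_tmul', smul_assoc])⟩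
    deg := fun d => (E.deg d).comap (annSpace E J).subtype }

/-- The inclusion of `ann E J`. -/
def annIncl (E : GrMod.{u, v, w} k (A ⊗[k] B)) (J : Ideal B) : (ann E J).carrier →ₗ[k] E.carrier :=
  (annSpace E J).subtype

theorem annIncl_injective (E : GrMod.{u, v, w} k (A ⊗[k] B)) (J : Ideal B) :
    Function.Injective (annIncl E J) := Subtype.val_injective

theorem smul_annIncl (E : GrMod.{u, v, w} k (A ⊗[k] B)) (J : Ideal B) (e : (ann E J).carrier)
    {b : B} (hb : b ∈ J) : ((1 : A) ⊗ₜ[k] b) • annIncl E J e = 0 := e.2 b hb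

theorem annIncl_smul (E : GrMod.{u, v, w} k (A ⊗[k] B)) (J : Ideal B) (a : A)
    (e : (ann E J).carrier) : annIncl E J (a • e) = (a ⊗ₜ[k] (1 : B)) • annIncl E J e := rfl

/-- The map `e ⊗ b ↦ b e`. -/
noncomputable def annMap (ℬ : ℤ → Submodule k B) (E : GrMod.{u, v, w} k (A ⊗[k] B)) (J : Ideal B) :
    ((ann E J).outer (cyclic ℬ J)).carrier →ₗ[k] E.carrier :=
  outerLift
    { toFun := fun e => cyclicLift ℬ J
        ((Algebra.lsmul k k E.carrier).toLinearMap.flip (annIncl E J e) ∘ₗ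
          (Algebra.TensorProduct.includeRight : B →ₐ[k] A ⊗[k] B).toLinearMap)
        (fun b hb => smul_annIncl E J e hb)
      map_add' := fun e e' => by
        ext z
        obtain ⟨b, rfl⟩ := cyclicMk_surjective ℬ J z
        exact smul_add ((1 : A) ⊗ₜ[k] b) (annIncl E J e) (annIncl E J e')
      map_smul' := fun c e => by
        ext z
        obtain ⟨b, rfl⟩ := cyclicMk_surjective ℬ J z
        exact smul_comm ((1 : A) ⊗ₜ[k] b) c (annIncl E J e) }

variable {E : GrMod.{u, v, w} k (A ⊗[k] B)} {J : Ideal B} {𝒜 : ℤ → Submodule k A}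
  {ℬ : ℤ → Submodule k B}

theorem annMap_mk (e : (ann E J).carrier) (b : B) :
    annMap ℬ E J (outerMk _ _ e (cyclicMk ℬ J b)) = ((1 : A) ⊗ₜ[k] b) • annIncl E J e := rfl

theorem annMap_smul (c : A ⊗[k] B) (z : ((ann E J).outer (cyclic ℬ J)).carrier) :
    annMap ℬ E J (c • z) = c • annMap ℬ E J z := by
  induction c using TensorProduct.induction_on with
  | zero => rw [zero_smul, zero_smul, map_zero]
  | add c c' h h' => rw [add_smul, add_smul, map_add, h, h']
  | tmul a b =>
    induction z using outer_induction with
    | zero => rw [smul_zero, map_zero, smul_zero]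
    | add z z' h h' => rw [smul_add, map_add, h, h', map_add, smul_add]
    | mk e y =>
      obtain ⟨b', rfl⟩ := cyclicMk_surjective ℬ J y
      rw [tmul_smul_outerMk, ← map_smul, smul_eq_mul, annMap_mk, annMap_mk, annIncl_smul,
        smul_smul, smul_smul, Algebra.TensorProduct.tmul_mul_tmul,
        Algebra.TensorProduct.tmul_mul_tmul, one_mul, mul_one, mul_one]

/-- A graded module over the graded algebra `A ⊗ B`. -/
structure IsBigraded (𝒜 : ℤ → Submodule k A) (ℬ : ℤ → Submodule k B)
    (E : GrMod.{u, v, w} k (A ⊗[k] B)) : Prop where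
  internal : DirectSum.IsInternal E.deg
  left : ∀ c d, ∀ a ∈ 𝒜 c, ∀ e ∈ E.deg d, (a ⊗ₜ[k] (1 : B)) • e ∈ E.deg (c + d)
  right : ∀ c d, ∀ b ∈ ℬ c, ∀ e ∈ E.deg d, ((1 : A) ⊗ₜ[k] b) • e ∈ E.deg (c + d)

theorem annMap_mem_deg (hE : IsBigraded 𝒜 ℬ E) (d : ℤ)
    (z : ((ann E J).outer (cyclic ℬ J)).carrier)
    (hz : z ∈ ((ann E J).outer (cyclic ℬ J)).deg d) : annMap ℬ E J z ∈ E.deg d := by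
  refine outer_deg_le (S := (E.deg d).comap (annMap ℬ E J)) ?_ hz
  rintro a b rfl e he _ ⟨y, hy, rfl⟩
  have := hE.right b a y hy (annIncl E J e) he
  rw [add_comm] at this
  exact this

theorem mem_annSpace_span {S : Set B} (hJ : J = Ideal.span S) {e : E.carrier} :
    e ∈ annSpace E J ↔ ∀ b ∈ S, ((1 : A) ⊗ₜ[k] b) • e = 0 := by
  refine ⟨fun he b hb => he b (hJ ▸ Ideal.subset_span hb), fun he b hb => ?_⟩
  rw [hJ] at hb
  induction hb using Submodule.span_induction with
  | mem b hb => exact he b hb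
  | zero => rw [TensorProduct.tmul_zero, zero_smul]
  | add b b' _ _ h h' => rw [TensorProduct.tmul_add, add_smul, h, h', add_zero]
  | smul c b _ h =>
    rw [smul_eq_mul, show (1 : A) ⊗ₜ[k] (c * b) = (1 ⊗ₜ[k] c) * (1 ⊗ₜ[k] b) by simp, mul_smul,
      h, smul_zero]

/-- Homogeneous generators of `J` present the space as an intersection of kernels of homogeneous
maps. -/
theorem ann_compClosed (hE : IsBigraded 𝒜 ℬ E) {S : Set B} (hJ : J = Ideal.span S)
    (hS : ∀ b ∈ S, ∃ d, b ∈ ℬ d) : CompClosed E.deg (annSpace E J) := by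
  have h : annSpace E J = ⨅ b : S, LinearMap.ker (Algebra.lsmul k k E.carrier ((1 : A) ⊗ₜ[k] b.1)) := by
    ext e
    rw [Submodule.mem_iInf, mem_annSpace_span hJ]
    exact ⟨fun he b => he b.1 b.2, fun he b hb => he ⟨b, hb⟩⟩
  rw [h]
  refine CompClosed.iInf fun b => ?_
  obtain ⟨d, hd⟩ := hS b.1 b.2
  refine compClosed_ker hE.internal.submodule_iSupIndep _ d fun c e he => ?_
  rw [add_comm]
  exact hE.right d c b.1 hd e he

/-- A subspace that contains its components generates a graded submodule. -/
theorem isHomogeneous_span (hE : IsBigraded 𝒜 ℬ E) (hA : iSup 𝒜 = ⊤) (hB : iSup ℬ = ⊤)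
    {S : Submodule k E.carrier} (hS : S ≤ ⨆ d, S ⊓ E.deg d) :
    E.IsHomogeneous (Submodule.span (A ⊗[k] B) (S : Set E.carrier)) := by
  set N := Submodule.span (A ⊗[k] B) (S : Set E.carrier) with hN
  set H := ⨆ d, N.restrictScalars k ⊓ E.deg d with hH
  refine le_antisymm ?_ (iSup_le fun d => inf_le_left)
  have hl : ∀ a : A, ∀ e ∈ H, (a ⊗ₜ[k] (1 : B)) • e ∈ H := by
    intro a e he
    obtain ⟨s, f, hf, rfl⟩ := exists_sum_components hA a
    rw [TensorProduct.sum_tmul, Finset.sum_smul]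
    refine sum_mem fun c _ => ?_
    have : H ≤ H.comap (Algebra.lsmul k k E.carrier (f c ⊗ₜ[k] (1 : B))) := by
      refine iSup_le fun d => ?_
      rintro e ⟨he, hd⟩
      exact Submodule.mem_iSup_of_mem (c + d) ⟨N.smul_mem _ he, hE.left c d _ (hf c) e hd⟩
    exact this he
  have hr : ∀ b : B, ∀ e ∈ H, ((1 : A) ⊗ₜ[k] b) • e ∈ H := by
    intro a e he
    obtain ⟨s, f, hf, rfl⟩ := exists_sum_components hB a
    rw [TensorProduct.tmul_sum, Finset.sum_smul]
    refine sum_mem fun c _ => ?_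
    have : H ≤ H.comap (Algebra.lsmul k k E.carrier ((1 : A) ⊗ₜ[k] f c)) := by
      refine iSup_le fun d => ?_
      rintro e ⟨he, hd⟩
      exact Submodule.mem_iSup_of_mem (c + d) ⟨N.smul_mem _ he, hE.right c d _ (hf c) e hd⟩
    exact this he
  intro e he
  induction (show e ∈ N from he) using Submodule.span_induction with
  | mem e he' =>
    have : S ≤ H := hS.trans (iSup_mono fun d => inf_le_inf_right _ fun e he =>
      Submodule.subset_span he)
    exact this he'
  | zero => exact zero_mem _
  | add e e' h1 h2 h h' => exact add_mem (h h1) (h' h2)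
  | smul c e h1 h =>
    have h' := h h1
    induction c using TensorProduct.induction_on with
    | zero => rw [zero_smul]; exact zero_mem _
    | add c c' hc hc' =>
      rw [add_smul]
      exact add_mem (hc (N.smul_mem _ h1)) (hc' (N.smul_mem _ h1))
    | tmul a b =>
      rw [show a ⊗ₜ[k] b = (a ⊗ₜ[k] (1 : B)) * ((1 : A) ⊗ₜ[k] b) by simp, mul_smul]
      exact hl a _ (hr b _ h')

/-- In a gr-irreducible module, the `B`-span of a nonzero graded submodule of `ann E J` is all. -/
theorem span_ann_eq_top (hE : IsBigraded 𝒜 ℬ E) (hA : iSup 𝒜 = ⊤) (hB : iSup ℬ = ⊤)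
    (hirr : E.GrIrreducible) (W : Submodule A (ann E J).carrier) (hW : (ann E J).IsHomogeneous W)
    (hW0 : W ≠ ⊥) : Submodule.span k
      {z | ∃ e ∈ W, ∃ b : B, z = ((1 : A) ⊗ₜ[k] b) • annIncl E J e} = ⊤ := by
  set R := Submodule.span k
      {z | ∃ e ∈ W, ∃ b : B, z = ((1 : A) ⊗ₜ[k] b) • annIncl E J e} with hR
  set S : Submodule k E.carrier := (W.restrictScalars k).map (annIncl E J) with hS
  have hSS : S ≤ ⨆ d, S ⊓ E.deg d := by
    rw [hS]
    have h1 : W.restrictScalars k ≤ ⨆ d, W.restrictScalars k ⊓ (ann E J).deg d := hW.le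
    refine (Submodule.map_mono h1).trans ?_
    rw [Submodule.map_iSup]
    refine iSup_mono fun d => ?_
    rintro _ ⟨e, ⟨he, hd⟩, rfl⟩
    exact ⟨⟨e, he, rfl⟩, hd⟩
  obtain h | h := hirr.2 _ (isHomogeneous_span hE hA hB hSS)
  · exfalso
    refine hW0 ((Submodule.eq_bot_iff _).2 fun e he => ?_)
    have : annIncl E J e ∈ Submodule.span (A ⊗[k] B) (S : Set E.carrier) :=
      Submodule.subset_span ⟨e, he, rfl⟩
    rw [h, Submodule.mem_bot] at this
    exact annIncl_injective E J (this.trans (map_zero _).symm)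
  · rw [eq_top_iff]
    rintro z -
    have hz : z ∈ Submodule.span (A ⊗[k] B) (S : Set E.carrier) := h ▸ Submodule.mem_top
    induction hz using Submodule.span_induction with
    | mem z hz =>
      obtain ⟨e, he, rfl⟩ := hz
      exact Submodule.subset_span ⟨e, he, 1, (one_smul (A ⊗[k] B) _).symm⟩
    | zero => exact zero_mem _
    | add z z' _ _ h h' => exact add_mem h h'
    | smul c z _ hz =>
      induction c using TensorProduct.induction_on with
      | zero => rw [zero_smul]; exact zero_mem _
      | add c c' hc hc' => rw [add_smul]; exact add_mem hc hc'
      | tmul a b =>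
        have : R ≤ R.comap (Algebra.lsmul k k E.carrier (a ⊗ₜ[k] b)) := by
          refine Submodule.span_le.2 ?_
          rintro _ ⟨e, he, b', rfl⟩
          refine Submodule.subset_span ⟨a • e, W.smul_mem a he, b * b', ?_⟩
          change (a ⊗ₜ[k] b) • ((1 : A) ⊗ₜ[k] b') • annIncl E J e = _
          rw [annIncl_smul, smul_smul, smul_smul,
            Algebra.TensorProduct.tmul_mul_tmul, Algebra.TensorProduct.tmul_mul_tmul, mul_one,
            one_mul, mul_one]
        exact this hz

variable (hE : IsBigraded 𝒜 ℬ E) (hA : iSup 𝒜 = ⊤) (hB : iSup ℬ = ⊤) {S : Set B}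
  (hJ : J = Ideal.span S) (hS : ∀ b ∈ S, ∃ d, b ∈ ℬ d)

include hE hJ hS

theorem ann_isGraded : (ann E J).IsGraded 𝒜 :=
  ⟨isInternal_comap hE.internal
      ((ann_compClosed hE hJ hS).le_iSup hE.internal.submodule_iSup_eq_top),
    fun c d a ha e he => hE.left c d a ha e.1 he⟩

include hA hB

/-- Let `W` be a nonzero graded submodule and `v` the generator of `B / J`. By `span_ann_eq_top`
each `e` is a sum of vectors `b w` with `w ∈ W`, so injectivity gives `e ⊗ v = ∑ w ⊗ b v`. A
functional `lam` with `lam v = 1`, applied to the second factor, yields `e ∈ W`. -/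
theorem ann_irreducible (hirr : E.GrIrreducible) (hne : annSpace E J ≠ ⊥)
    (hinj : Function.Injective (annMap ℬ E J)) : (ann E J).GrIrreducible := by
  obtain ⟨e, he, he0⟩ := Submodule.exists_mem_ne_zero_of_ne_bot hne
  refine ⟨⟨⟨e, he⟩, 0, fun h => he0 (congrArg (annIncl E J) h)⟩, fun W hW => ?_⟩
  rw [or_iff_not_imp_left]
  intro hW0
  have hR := span_ann_eq_top hE hA hB hirr W hW hW0
  have hv : cyclicMk ℬ J (1 : B) ≠ 0 := by
    intro h0
    have := annMap_mk (ℬ := ℬ) (E := E) (J := J) ⟨e, he⟩ 1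
    rw [h0, map_zero, map_zero] at this
    exact he0 (((one_smul (A ⊗[k] B) e).symm.trans this.symm))
  obtain ⟨lam, hlam⟩ := Module.Projective.exists_dual_eq_one k hv
  let L : ((ann E J).outer (cyclic ℬ J)).carrier →ₗ[k] (ann E J).carrier :=
    outerLift (LinearMap.flip ((LinearMap.lsmul k (ann E J).carrier) ∘ₗ lam))
  have hL : ∀ e y, L (outerMk _ _ e y) = lam y • e := fun e y => rfl
  rw [eq_top_iff]
  rintro e -
  have hle : (⊤ : Submodule k E.carrier) ≤
      (Submodule.comap L (W.restrictScalars k)).map (annMap ℬ E J) := by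
    rw [← hR]
    refine Submodule.span_le.2 ?_
    rintro _ ⟨e, he, b, rfl⟩
    refine ⟨outerMk _ _ e (cyclicMk ℬ J b), ?_, rfl⟩
    change L (outerMk _ _ e (cyclicMk ℬ J b)) ∈ W.restrictScalars k
    rw [hL]
    exact (W.restrictScalars k).smul_mem (lam (cyclicMk ℬ J b)) he
  obtain ⟨z, hz, hze⟩ := hle (Submodule.mem_top (x := annIncl E J e))
  have : z = outerMk _ _ e (cyclicMk ℬ J 1) := by
    refine hinj (hze.trans ?_)
    rw [annMap_mk]
    exact (one_smul (A ⊗[k] B) _).symm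
  have hz' : L z ∈ W.restrictScalars k := hz
  rw [this, hL, hlam, one_smul] at hz'
  exact hz'

/-- The isomorphism is the inverse of evaluation, whose surjectivity is `span_ann_eq_top` for the
whole of `ann E J`. -/
theorem iso_ann_outer (hirr : E.GrIrreducible) (hne : annSpace E J ≠ ⊥)
    (hinj : Function.Injective (annMap ℬ E J)) : E.Iso ((ann E J).outer (cyclic ℬ J)) := by
  have hgr := ann_isGraded hE hJ hS
  have hirrK := ann_irreducible hE hA hB hJ hS hirr hne hinj
  have hR := span_ann_eq_top hE hA hB hirr (J := J) ⊤ (by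
    have := hgr.1.submodule_iSup_eq_top
    rw [IsHomogeneous, Submodule.restrictScalars_top]
    simpa using this.symm) (by
      have := hirrK.1
      exact top_ne_bot)
  have hsurj : Function.Surjective (annMap ℬ E J) := by
    rw [← LinearMap.range_eq_top, eq_top_iff, ← hR]
    refine Submodule.span_le.2 ?_
    rintro _ ⟨e, -, b, rfl⟩
    exact ⟨outerMk _ _ e (cyclicMk ℬ J b), rfl⟩
  let f : ((ann E J).outer (cyclic ℬ J)).carrier →ₗ[A ⊗[k] B] E.carrier :=
    { toFun := annMap ℬ E J
      map_add' := map_add (annMap ℬ E J)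
      map_smul' := annMap_smul }
  let e := LinearEquiv.ofBijective f ⟨hinj, hsurj⟩
  refine ⟨e.symm, fun d m => ?_⟩
  obtain ⟨z, rfl⟩ := e.surjective m
  rw [LinearEquiv.symm_apply_apply]
  constructor
  · exact fun h => mem_of_map_mem
      (iSup_outer_deg hgr.1.submodule_iSup_eq_top (iSup_cyclic_deg J hB))
      hE.internal.submodule_iSupIndep (annMap ℬ E J) (annMap_mem_deg hE) hinj h
  · exact fun h => annMap_mem_deg hE d z h

end Annihilator

end GrMod

/-! ### The modules `V(i^n)` and injectivity of evaluation -/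

namespace GrMod

open KLR NilHeckeRel

section OneColour

variable {k : Type u} [Field k] {I : Type v} [DecidableEq I] {D : BorcherdsCartanDatum I}
variable {i : I} {n : ℕ}

theorem xRep_mem_trivIdeal (a : ℕ) : xRep k D i n a ∈ trivIdeal k D i n :=
  Ideal.subset_span (Or.inl ⟨_, _, _, rfl⟩)

theorem tRep_mem_trivIdeal (hi : ¬ D.IsReal i) (a : ℕ) : tRep k D i n a ∈ trivIdeal k D i n :=
  Ideal.subset_span (Or.inr ⟨hi, _, _, _, _, rfl⟩)

/-- The generator of `V(i^n)`. -/
noncomputable def vGen (k : Type u) [Field k] (D : BorcherdsCartanDatum I) (i : I) (n : ℕ) :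
    (cyclic (grading k D (Multiset.replicate n i)) (trivIdeal k D i n)).carrier :=
  cyclicMk _ _ 1

theorem smul_vGen (b : KLR k D (Multiset.replicate n i)) :
    b • vGen k D i n = cyclicMk _ _ b := by
  rw [vGen, ← map_smul, smul_eq_mul, mul_one]

theorem exists_smul_vGen (y : (cyclic (grading k D (Multiset.replicate n i))
    (trivIdeal k D i n)).carrier) : ∃ b : KLR k D (Multiset.replicate n i), b • vGen k D i n = y := by
  obtain ⟨b, rfl⟩ := cyclicMk_surjective _ _ y
  exact ⟨b, smul_vGen b⟩

theorem xRep_smul_vGen (a : ℕ) : xRep k D i n a • vGen k D i n = 0 := by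
  rw [smul_vGen, cyclicMk_eq_zero _ _ (xRep_mem_trivIdeal a)]

theorem tRep_smul_vGen (hi : ¬ D.IsReal i) (a : ℕ) : tRep k D i n a • vGen k D i n = 0 := by
  rw [smul_vGen, cyclicMk_eq_zero _ _ (tRep_mem_trivIdeal hi a)]

/-- For imaginary `i` the module `V(i^n)` is one-dimensional. -/
theorem exists_eq_smul_vGen (hi : ¬ D.IsReal i) (y : (cyclic
    (grading k D (Multiset.replicate n i)) (trivIdeal k D i n)).carrier) :
    ∃ c : k, c • vGen k D i n = y := by
  obtain ⟨b, rfl⟩ := exists_smul_vGen y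
  rw [← Submodule.mem_span_singleton]
  refine smul_mem_of_rep _ (fun a _ z hz => ?_) (fun a _ z hz => ?_) b
    (Submodule.mem_span_singleton_self _)
  all_goals
    obtain ⟨c, rfl⟩ := Submodule.mem_span_singleton.1 hz
    rw [smul_comm]
  · rw [xRep_smul_vGen, smul_zero]; exact zero_mem _
  · rw [tRep_smul_vGen hi, smul_zero]; exact zero_mem _

section Real

theorem nilHeckeRel_real (hi : D.IsReal i) : NilHeckeRel n
    (1 : KLR k D (Multiset.replicate n i)) (xRep k D i n) (tRep k D i n) := by
  have := nilHeckeRel_rep (k := k) (D := D) (i := i) (n := n)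
  rwa [if_pos hi] at this

/-- For real `i` the module `V(i^n)` is spanned by products of crossings applied to the
generator. -/
theorem mem_of_tRep_stable (hi : D.IsReal i) (Z : Submodule k (cyclic
    (grading k D (Multiset.replicate n i)) (trivIdeal k D i n)).carrier)
    (h0 : vGen k D i n ∈ Z) (ht : ∀ b, b + 1 < n → ∀ z ∈ Z, tRep k D i n b • z ∈ Z)
    (y : (cyclic (grading k D (Multiset.replicate n i)) (trivIdeal k D i n)).carrier) : y ∈ Z := by
  let T : Set (Submodule k (cyclic
    (grading k D (Multiset.replicate n i)) (trivIdeal k D i n)).carrier) :=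
    {Z | vGen k D i n ∈ Z ∧ ∀ b, b + 1 < n → ∀ z ∈ Z, tRep k D i n b • z ∈ Z}
  have hv : vGen k D i n ∈ sInf T := Submodule.mem_sInf.2 fun Z hZ => hZ.1
  have hT : ∀ b, b + 1 < n → ∀ z ∈ sInf T, tRep k D i n b • z ∈ sInf T := fun b hb z hz =>
    Submodule.mem_sInf.2 fun Z hZ => hZ.2 b hb z (Submodule.mem_sInf.1 hz Z hZ)
  -- The smallest crossing-stable subspace through the generator is also dot-stable: the vectors in
  -- it whose dotted multiples stay in it already form such a subspace.
  have hx : sInf T ≤ sInf T ⊓ ⨅ a, ⨅ _ : a < n, (sInf T).comap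
      (Algebra.lsmul k k (cyclic (grading k D (Multiset.replicate n i))
        (trivIdeal k D i n)).carrier (xRep k D i n a)) := by
    refine sInf_le ⟨⟨hv, ?_⟩, fun b hb z hz => ⟨hT b hb z hz.1, ?_⟩⟩
    · refine (Submodule.mem_iInf _).2 fun a => (Submodule.mem_iInf _).2 fun _ => ?_
      change xRep k D i n a • vGen k D i n ∈ sInf T
      rw [xRep_smul_vGen]
      exact zero_mem _
    · refine (Submodule.mem_iInf _).2 fun a => (Submodule.mem_iInf _).2 fun ha => ?_
      change xRep k D i n a • tRep k D i n b • z ∈ sInf T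
      obtain ⟨c, hc, ε, hε⟩ := (nilHeckeRel_real (k := k) hi).x_smul_t_smul (E := (cyclic
        (grading k D (Multiset.replicate n i)) (trivIdeal k D i n)).carrier) rfl ha hb
      rw [hε]
      refine add_mem (hT b hb _ ?_) (zsmul_mem hz.1 ε)
      exact (Submodule.mem_iInf _).1 ((Submodule.mem_iInf _).1 hz.2 c) hc
  obtain ⟨b, rfl⟩ := exists_smul_vGen y
  have : b • vGen k D i n ∈ sInf T := smul_mem_of_rep _ (fun a ha z hz =>
    (Submodule.mem_iInf _).1 ((Submodule.mem_iInf _).1 (hx hz).2 a) ha) hT b hv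
  exact Submodule.mem_sInf.1 this Z ⟨h0, ht⟩

/-- The locally nilpotent vectors for the `x_a`. -/
def xNilSubmodule {B : Type v} [Ring B] {E : Type w} [AddCommGroup E] [Module B E] [Module k E]
    [SMulCommClass B k E] (n : ℕ) (x : ℕ → B) : Submodule k E where
  carrier := {y | ∃ l, XNil n x l y}
  add_mem' := fun ⟨l, hl⟩ ⟨l', hl'⟩ =>
    ⟨max l l', (hl.mono (le_max_left _ _)).add (hl'.mono (le_max_right _ _))⟩
  zero_mem' := ⟨0, xNil_zero_iff.2 rfl⟩
  smul_mem' := fun c y ⟨l, hl⟩ => ⟨l, fun L hL hn => by rw [smul_comm, hl L hL hn, smul_zero]⟩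

theorem exists_xNil_V (hi : D.IsReal i) (y : (cyclic
    (grading k D (Multiset.replicate n i)) (trivIdeal k D i n)).carrier) :
    ∃ l, XNil n (xRep k D i n) l y := by
  refine mem_of_tRep_stable hi (xNilSubmodule n (xRep k D i n)) ?_ ?_ y
  · refine ⟨1, xNil_succ_iff.2 fun a _ => ?_⟩
    rw [xRep_smul_vGen]
    exact xNil_zero_iff.2 rfl
  · rintro b hb z ⟨l, hl⟩
    exact ⟨l + 1, XNil.t_smul (nilHeckeRel_real hi) rfl hb hl⟩

/-- The longest word kills every `t_b z`, so on `V(i^n)` it only sees a multiple of the generator.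
-/
theorem exists_longest_smul_V (hi : D.IsReal i) (y : (cyclic
    (grading k D (Multiset.replicate n i)) (trivIdeal k D i n)).carrier) :
    ∃ c : k, longest (tRep k D i n) n n • y = longest (tRep k D i n) n n • c • vGen k D i n := by
  let Z : Submodule k (cyclic
      (grading k D (Multiset.replicate n i)) (trivIdeal k D i n)).carrier :=
    (Submodule.span k {longest (tRep k D i n) n n • vGen k D i n}).comap
      (Algebra.lsmul k k _ (longest (tRep k D i n) n n))
  have hy : y ∈ Z := by
    refine mem_of_tRep_stable hi Z ?_ ?_ y
    · exact Submodule.mem_span_singleton_self _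
    · intro b hb z _
      change longest (tRep k D i n) n n • tRep k D i n b • z ∈ Submodule.span k _
      rw [smul_smul, (nilHeckeRel_real hi).longest_mul_t le_rfl (by omega) hb, zero_smul]
      exact zero_mem _
  obtain ⟨c, hc⟩ := Submodule.mem_span_singleton.1 hy
  exact ⟨c, by rw [smul_comm]; exact hc.symm⟩

end Real

variable {A : Type (max u v)} [Ring A] [Algebra k A]
variable {E : GrMod.{u, max u v, w} k (A ⊗[k] KLR k D (Multiset.replicate n i))}

variable (A) in
/-- The embedding `b ↦ 1 ⊗ b`. -/
noncomputable def inR (k : Type u) [Field k] (D : BorcherdsCartanDatum I) (i : I) (n : ℕ)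
    [Algebra k A] :
    KLR k D (Multiset.replicate n i) →+* A ⊗[k] KLR k D (Multiset.replicate n i) :=
  (Algebra.TensorProduct.includeRight : KLR k D (Multiset.replicate n i) →ₐ[k] _).toRingHom

theorem inR_smul_outerMk {K : GrMod.{u, max u v, w} k A}
    {N : GrMod.{u, max u v, w'} k (KLR k D (Multiset.replicate n i))}
    (b : KLR k D (Multiset.replicate n i)) (e : K.carrier) (y : N.carrier) :
    inR A k D i n b • outerMk K N e y = outerMk K N e (b • y) := by
  refine (tmul_smul_outerMk (1 : A) b e y).trans ?_
  rw [one_smul]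

/-- Let `v` be the generator of `V(i^n)`; evaluation sends `e ⊗ v` to `e`. For imaginary `i` every
tensor has this form. For real `i` the kernel is stable under the dots, which act locally
nilpotently, so if nonzero it contains some `q ≠ 0` killed by all dots. With `T` the longest word,
`T q = T (e ⊗ v)` for some `e`. Evaluating gives `T e = 0`, so `e = 0` by `eq_zero_of_longest_smul`;
then `T q = 0`, and `q = 0` for the same reason. -/
theorem annMap_injective : Function.Injective
    (annMap (grading k D (Multiset.replicate n i)) E (trivIdeal k D i n)) := by
  set J := trivIdeal k D i n with hJ
  set ℬ := grading k D (Multiset.replicate n i) with hℬ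
  have h1 : ∀ e : (ann E J).carrier, annMap ℬ E J (outerMk _ _ e (vGen k D i n)) =
      annIncl E J e := fun e => one_smul (A ⊗[k] KLR k D (Multiset.replicate n i)) _
  rw [injective_iff_map_eq_zero]
  intro q hq
  by_cases hi : D.IsReal i
  · by_contra hq0
    have hrel := (nilHeckeRel_real (k := k) (n := n) hi).map (inR A k D i n)
    rw [map_one] at hrel
    have hnil : ∀ q : ((ann E J).outer (cyclic ℬ J)).carrier,
        ∃ l, XNil n (fun a => inR A k D i n (xRep k D i n a)) l q := by
      have hmk : ∀ l e (y : (cyclic ℬ J).carrier), XNil n (xRep k D i n) l y →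
          XNil n (fun a => inR A k D i n (xRep k D i n a)) l (outerMk (ann E J) (cyclic ℬ J) e y) := by
        intro l e
        induction l with
        | zero => intro y hy; rw [xNil_zero_iff.1 hy, map_zero]; exact xNil_zero_iff.2 rfl
        | succ l ih =>
          intro y hy
          refine xNil_succ_iff.2 fun a ha => ?_
          rw [inR_smul_outerMk]
          exact ih _ (xNil_succ_iff.1 hy a ha)
      intro q
      induction q using outer_induction with
      | zero => exact ⟨0, xNil_zero_iff.2 rfl⟩
      | mk e y =>
        obtain ⟨l, hl⟩ := exists_xNil_V hi y
        exact ⟨l, hmk l e y hl⟩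
      | add z z' hz hz' => exact (xNilSubmodule (k := k) n _).add_mem hz hz'
    have hT : ∀ q : ((ann E J).outer (cyclic ℬ J)).carrier, ∃ e,
        longest (fun a => inR A k D i n (tRep k D i n a)) n n • q =
          longest (fun a => inR A k D i n (tRep k D i n a)) n n •
            outerMk (ann E J) (cyclic ℬ J) e (vGen k D i n) := by
      intro q
      rw [map_longest]
      induction q using outer_induction with
      | zero => exact ⟨0, by rw [map_zero, LinearMap.zero_apply]⟩
      | mk e y =>
        obtain ⟨c, hc⟩ := exists_longest_smul_V hi y
        refine ⟨c • e, ?_⟩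
        rw [inR_smul_outerMk, hc, ← inR_smul_outerMk, map_smul, map_smul, LinearMap.smul_apply]
      | add z z' hz hz' =>
        obtain ⟨e, he⟩ := hz
        obtain ⟨e', he'⟩ := hz'
        exact ⟨e + e', by rw [smul_add, he, he', map_add, LinearMap.add_apply, smul_add]⟩
    obtain ⟨l, hl⟩ := hnil q
    obtain ⟨q, hq, hq0, hqx⟩ := exists_x_killed {q | annMap ℬ E J q = 0} (fun a _ y hy => by
      rw [Set.mem_ofPred_eq, annMap_smul, show annMap ℬ E J y = 0 from hy, smul_zero]) hq hl hq0
    obtain ⟨e, he⟩ := hT q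
    have h2 := congrArg (annMap ℬ E J) he
    rw [annMap_smul, show annMap ℬ E J q = 0 from hq, smul_zero, annMap_smul, h1] at h2
    have h3 := hrel.eq_zero_of_longest_smul rfl
      (fun a _ => smul_annIncl E J e (xRep_mem_trivIdeal a)) le_rfl h2.symm
    have h4 : e = 0 := annIncl_injective E J (h3.trans (map_zero _).symm)
    rw [h4, map_zero, LinearMap.zero_apply, smul_zero] at he
    exact hq0 (hrel.eq_zero_of_longest_smul rfl hqx le_rfl he)
  · obtain ⟨e, rfl⟩ : ∃ e, outerMk (ann E J) (cyclic ℬ J) e (vGen k D i n) = q := by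
      clear hq
      induction q using outer_induction with
      | zero => exact ⟨0, by rw [map_zero, LinearMap.zero_apply]⟩
      | mk e y =>
        obtain ⟨c, rfl⟩ := exists_eq_smul_vGen hi y
        exact ⟨c • e, by rw [map_smul, map_smul, LinearMap.smul_apply]⟩
      | add z z' hz hz' =>
        obtain ⟨e, rfl⟩ := hz
        obtain ⟨e', rfl⟩ := hz'
        exact ⟨e + e', by rw [map_add, LinearMap.add_apply]⟩
    rw [h1] at hq
    rw [annIncl_injective E J (hq.trans (map_zero _).symm), map_zero, LinearMap.zero_apply]

theorem gen_mem_grading {ν : Multiset I} (g : Diagram I) :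
    gen ν g ∈ grading k D ν (g.deg D) :=
  Submodule.subset_span ⟨[g], by simp, by simp⟩

theorem iSup_grading (ν : Multiset I) : iSup (grading k D ν) = ⊤ := by
  rw [eq_top_iff]
  rintro r -
  rw [← mul_one r, ← smul_eq_mul]
  refine smul_mem_of_gen (D := D) (iSup (grading k D ν)) (fun g x hx => ?_) r
    (Submodule.mem_iSup_of_mem 0 (Submodule.subset_span ⟨[], by simp, by simp⟩))
  have : iSup (grading k D ν) ≤ (iSup (grading k D ν)).comap (actL (gen (D := D) ν g)) := by
    refine iSup_le fun d => Submodule.span_le.2 ?_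
    rintro _ ⟨l, rfl, rfl⟩
    refine Submodule.mem_iSup_of_mem (g.deg D + (l.map (Diagram.deg D)).sum) ?_
    exact Submodule.subset_span ⟨g :: l, by simp, by simp [actL_apply]⟩
  exact this hx

theorem trivIdeal_homogeneous : ∀ b ∈ ({z | ∃ a j b, z = gen (k := k) (D := D)
      (Multiset.replicate n i) (.dot a j b)} ∪
    {z | ¬ D.IsReal i ∧ ∃ a j l b, z = gen (k := k) (D := D) (Multiset.replicate n i)
      (.cross a j l b)}), ∃ d, b ∈ grading k D (Multiset.replicate n i) d := by
  rintro _ (⟨a, j, b, rfl⟩ | ⟨-, a, j, l, b, rfl⟩) <;> exact ⟨_, gen_mem_grading _⟩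

/-- Dots raise the degree by `2 r_i > 0` and the degrees of `E` are bounded, so some nonzero vector
is killed by all dots. For imaginary `i` the crossings preserve the space of such vectors, and
`exists_t_killed` finds one that they kill as well. -/
theorem annSpace_trivIdeal_ne_bot {𝒜 : ℤ → Submodule k A}
    (hE : IsBigraded 𝒜 (grading k D (Multiset.replicate n i)) E) [Module.Finite k E.carrier]
    [Nontrivial E.carrier] : annSpace E (trivIdeal k D i n) ≠ ⊥ := by
  have hfin : {d | E.deg d ≠ ⊥}.Finite :=
    WellFoundedGT.finite_ne_bot_of_iSupIndep hE.internal.submodule_iSupIndep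
  obtain ⟨N, hN⟩ := hfin.bddAbove
  have hN' : ∀ d, N < d → E.deg d = ⊥ := by
    intro d hd
    by_contra h
    exact absurd (hN h) (not_le.2 hd)
  have hX : ∀ (a : ℕ) (d : ℤ), ∀ e ∈ E.deg d, inR A k D i n (xRep k D i n a) • e ∈
      E.deg (2 * D.r i + d) := fun a d e he => hE.right (2 * D.r i) d _
      (gen_mem_grading (.dot (List.replicate a i) i (List.replicate (n - 1 - a) i))) e he
  -- Each dot raises the degree by at least one, so `l` dots lead from degree `d` beyond the bound
  -- `N`.
  have hnil : ∀ (l : ℕ) (d : ℤ), N < d + l → ∀ e ∈ E.deg d,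
      XNil n (fun a => inR A k D i n (xRep k D i n a)) l e := by
    intro l
    induction l with
    | zero =>
      intro d hd e he
      rw [hN' d (by simpa using hd)] at he
      exact xNil_zero_iff.2 he
    | succ l ih =>
      intro d hd e he
      have := D.r_pos i
      exact xNil_succ_iff.2 fun a _ => ih _ (by push_cast at hd; omega) _ (hX a d e he)
  have hnil' : ∀ e : E.carrier, e ∈ xNilSubmodule (k := k) n
      (fun a => inR A k D i n (xRep k D i n a)) := by
    intro e
    have : iSup E.deg ≤ xNilSubmodule (k := k) n (fun a => inR A k D i n (xRep k D i n a)) :=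
      iSup_le fun d e he => ⟨(N - d + 1).toNat, hnil _ d (by omega) e he⟩
    rw [hE.internal.submodule_iSup_eq_top] at this
    exact this Submodule.mem_top
  obtain ⟨e, he⟩ := exists_ne (0 : E.carrier)
  obtain ⟨l, hl⟩ := hnil' e
  obtain ⟨e, -, he, hx⟩ := exists_x_killed Set.univ (fun _ _ _ _ => Set.mem_univ _)
    (Set.mem_univ _) hl he
  rw [Submodule.ne_bot_iff]
  have hdot : ∀ e : E.carrier, (∀ a < n, inR A k D i n (xRep k D i n a) • e = 0) → ∀ a j b,
      ((1 : A) ⊗ₜ[k] gen (k := k) (D := D) (Multiset.replicate n i) (.dot a j b)) • e = 0 := by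
    intro e hx a j b
    obtain h | ⟨l, hl, h⟩ := gen_dot_replicate (k := k) (D := D) (i := i) (n := n) a j b
    · rw [h, TensorProduct.tmul_zero, zero_smul]
    · rw [h]; exact hx l hl
  by_cases hi : D.IsReal i
  · refine ⟨e, (mem_annSpace_span rfl).2 ?_, he⟩
    rintro _ (⟨a, j, b, rfl⟩ | ⟨hi', -⟩)
    · exact hdot e hx a j b
    · exact absurd hi hi'
  · have hrel := (nilHeckeRel_rep (k := k) (D := D) (i := i) (n := n)).map (inR A k D i n)
    rw [if_neg hi, map_zero] at hrel
    obtain ⟨e, hx, he, ht⟩ := hrel.exists_t_killed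
      {e : E.carrier | ∀ a < n, inR A k D i n (xRep k D i n a) • e = 0}
      (fun b hb e he a ha => hrel.x_smul_t_smul_eq_zero rfl hb he ha) ⟨e, hx, he⟩
    refine ⟨e, (mem_annSpace_span rfl).2 ?_, he⟩
    rintro _ (⟨a, j, b, rfl⟩ | ⟨-, a, j, l, b, rfl⟩)
    · exact hdot e hx a j b
    · obtain h | ⟨c, hc, h⟩ := gen_cross_replicate (k := k) (D := D) (i := i) (n := n) a j l b
      · rw [h, TensorProduct.tmul_zero, zero_smul]
      · rw [h]; exact ht c hc

end OneColour

end GrMod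

/-! ### Juxtaposition and blocks -/

namespace KLR

open Diagram

section Juxtaposition

variable {k : Type u} [Field k] {I : Type v} [DecidableEq I] {D : BorcherdsCartanDatum I}
variable {ν ν' μ : Multiset I}

theorem mem_seqOf_left {s t : List I} (h : s ++ t ∈ SeqOf (ν + ν')) (ht : t ∈ SeqOf ν') :
    s ∈ SeqOf ν := by
  rw [mem_seqOf] at *
  rw [← ht, ← Multiset.coe_add] at h
  exact add_right_cancel h

theorem idem₂_mul_idem {s t : List I} (hs : s ∈ SeqOf ν) (ht : t ∈ SeqOf ν') :
    idem₂ k D ν ν' μ * gen μ (.idem (s ++ t)) = gen μ (.idem (s ++ t)) := by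
  rw [idem₂, Finset.sum_mul, Finset.sum_eq_single_of_mem s hs, Finset.sum_mul,
    Finset.sum_eq_single_of_mem t ht, idem_mul_idem, if_pos rfl]
  · intro t' _ hne
    rw [idem_mul_idem, if_neg fun h => hne (List.append_cancel_left h)]
  · intro s' hs' hne
    rw [Finset.sum_mul]
    refine Finset.sum_eq_zero fun t' ht' => ?_
    rw [idem_mul_idem, if_neg fun h => hne (List.append_inj h (length_of_mem hs' hs)).1]

theorem juxt_tmul_one (a : KLR k D ν) :
    juxt k D ν ν' μ (a ⊗ₜ 1) = padL k D ν ν' μ a := by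
  rw [juxt_tmul, padR_one, ← padL_one, ← padL_mul, mul_one]

theorem juxt_one_tmul (b : KLR k D ν') :
    juxt k D ν ν' μ (1 ⊗ₜ b) = padR k D ν ν' μ b := by
  rw [juxt_tmul, padL_one, ← padR_one, ← padR_mul, one_mul]

theorem one_mem_grading : (1 : KLR k D ν) ∈ grading k D ν 0 :=
  Submodule.subset_span ⟨[], by simp, by simp⟩

theorem mul_mem_grading {c d : ℤ} {x y : KLR k D ν} (hx : x ∈ grading k D ν c)
    (hy : y ∈ grading k D ν d) : x * y ∈ grading k D ν (c + d) := by
  have h : grading k D ν c * grading k D ν d ≤ grading k D ν (c + d) := by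
    rw [grading, grading, Submodule.span_mul_span, Submodule.span_le]
    rintro _ ⟨_, ⟨l, rfl, rfl⟩, _, ⟨l', rfl, rfl⟩, rfl⟩
    exact Submodule.subset_span ⟨l ++ l', by simp, by simp⟩
  exact h (Submodule.mul_mem_mul hx hy)

theorem idem₂_mem_grading : idem₂ k D ν ν' μ ∈ grading k D μ 0 :=
  sum_mem fun _ _ => sum_mem fun _ _ => GrMod.gen_mem_grading (.idem _)

theorem deg_pad (p t : List I) (g : Diagram I) : (g.pad p t).deg D = g.deg D := by
  cases g <;> rfl

/-- Stated for non-unital maps: `padL` and `padR` send `1` to `idem₂`, and degree zero is all that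
is needed of it. -/
theorem map_mem_grading (φ : KLR k D ν →ₗ[k] KLR k D μ) (h1 : φ 1 ∈ grading k D μ 0)
    (hmul : ∀ x y, φ (x * y) = φ x * φ y)
    (hgen : ∀ g : Diagram I, φ (gen ν g) ∈ grading k D μ (g.deg D)) {d : ℤ} {x : KLR k D ν}
    (hx : x ∈ grading k D ν d) : φ x ∈ grading k D μ d := by
  have : grading k D ν d ≤ (grading k D μ d).comap φ := by
    refine Submodule.span_le.2 ?_
    rintro _ ⟨l, rfl, rfl⟩
    clear hx
    change φ (List.map (gen ν) l).prod ∈ grading k D μ _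
    induction l with
    | nil => simpa using h1
    | cons g l ih =>
      rw [List.map_cons, List.map_cons, List.prod_cons, List.sum_cons, hmul]
      exact mul_mem_grading (hgen g) ih
  exact this hx

theorem padL_mem_grading {d : ℤ} {x : KLR k D ν} (hx : x ∈ grading k D ν d) :
    padL k D ν ν' μ x ∈ grading k D μ d := by
  refine map_mem_grading _ (by rw [padL_one]; exact idem₂_mem_grading) padL_mul (fun g => ?_) hx
  rw [padL_gen]
  split_ifs
  · exact sum_mem fun t _ => by
      rw [← deg_pad (D := D) [] t g]
      exact GrMod.gen_mem_grading _
  · exact zero_mem _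

theorem padR_mem_grading {d : ℤ} {x : KLR k D ν'} (hx : x ∈ grading k D ν' d) :
    padR k D ν ν' μ x ∈ grading k D μ d := by
  refine map_mem_grading _ (by rw [padR_one]; exact idem₂_mem_grading) padR_mul (fun g => ?_) hx
  rw [padR_gen]
  split_ifs
  · exact sum_mem fun t _ => by
      rw [← deg_pad (D := D) t [] g]
      exact GrMod.gen_mem_grading _
  · exact zero_mem _

variable {i : I} {n : ℕ}

theorem replicate_mem_seqOf : List.replicate n i ∈ SeqOf (Multiset.replicate n i) :=
  mem_seqOf_replicate.2 rfl

/-- Only the sequence `i^n` can stand on the right. If `g` does not have weight `ν`, both sides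
vanish; for the right-hand side this is where `hν` enters. -/
theorem juxt_gen_tmul_one (hν : ν + Multiset.replicate n i = μ) (g : Diagram I) :
    juxt k D ν (Multiset.replicate n i) μ (gen ν g ⊗ₜ 1) =
      gen μ (g.pad [] (List.replicate n i)) := by
  rw [juxt_tmul_one, padL_gen, seqOf_replicate, Finset.sum_singleton]
  split_ifs with h
  · rfl
  · rw [gen_eq_zero]
    rw [pad_top, List.nil_append, ← hν]
    exact fun h' => h (mem_seqOf_left h' replicate_mem_seqOf)

theorem juxt_idem_tmul_gen (hν : ν + Multiset.replicate n i = μ) (s : List I) (h : Diagram I)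
    (ht : h.top = List.replicate n i) :
    juxt k D ν (Multiset.replicate n i) μ (gen ν (.idem s) ⊗ₜ gen _ h) =
      gen μ (h.pad s []) := by
  by_cases hs : s ∈ SeqOf ν
  · rw [juxt_tmul, padL_gen, padR_gen, if_pos (show (Diagram.idem s).top ∈ SeqOf ν from hs), if_pos (ht ▸ replicate_mem_seqOf),
      seqOf_replicate, Finset.sum_singleton, Finset.mul_sum, Finset.sum_eq_single_of_mem s hs]
    · rw [pad_idem, List.nil_append, idem_mul_gen, if_pos (by rw [pad_top, ht, List.append_nil])]
    · intro s' hs' hne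
      rw [pad_idem, List.nil_append, idem_mul_gen, if_neg]
      rw [pad_top, ht, List.append_nil]
      exact fun h => hne (List.append_cancel_right h).symm
  · rw [gen_idem_eq_zero hs, TensorProduct.zero_tmul, map_zero, gen_eq_zero]
    rw [pad_top, List.append_nil, ht, ← hν]
    exact fun h' => hs (mem_seqOf_left h' replicate_mem_seqOf)

variable {X : Type w} [AddCommGroup X] [Module k X] [Module (KLR k D μ) X]
  [IsScalarTower k (KLR k D μ) X] {W : Submodule k X}

/-- A subspace of `1_{ν,ni} X` that is stable under `R(ν) ⊗ R(ni)` and on which no sequence ends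
with `i^{n+1}` is a block. -/
theorem isBlock_of_juxt_stable (hν : ν + Multiset.replicate n i = μ)
    (h1 : ∀ c, ∀ x ∈ W, juxt k D ν (Multiset.replicate n i) μ c • x ∈ W)
    (h2 : ∀ x ∈ W, idem₂ k D ν (Multiset.replicate n i) μ • x = x)
    (h3 : ∀ s, ∀ x ∈ W, gen (k := k) (D := D) μ (.idem (s ++ List.replicate (n + 1) i)) • x = 0) :
    IsBlock D μ i n [] W where
  stable g x hx := by
    rw [List.append_nil, ← juxt_gen_tmul_one hν]
    exact h1 _ x hx
  dot s a b hab x hx := by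
    have := h1 (gen ν (.idem s) ⊗ₜ gen _ (.dot (List.replicate a i) i (List.replicate b i))) x hx
    rw [juxt_idem_tmul_gen hν s (.dot (List.replicate a i) i (List.replicate b i))] at this
    · exact this
    · rw [top_dot, ← List.replicate_succ, List.replicate_append_replicate, ← hab, add_assoc]
  cross s a b hab x hx := by
    have := h1 (gen ν (.idem s) ⊗ₜ
      gen _ (.cross (List.replicate a i) i i (List.replicate b i))) x hx
    rw [juxt_idem_tmul_gen hν s (.cross (List.replicate a i) i i (List.replicate b i))] at this
    · exact this
    · rw [top_cross, ← List.replicate_succ, ← List.replicate_succ,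
        List.replicate_append_replicate, ← hab]
      exact congrArg (List.replicate · i) (by omega)
  supp s hs x hx := by
    rw [← h2 x hx, smul_smul, idem₂, seqOf_replicate, Finset.mul_sum, Finset.sum_eq_zero, zero_smul]
    intro s' _
    rw [Finset.sum_singleton, idem_mul_idem, if_neg]
    simpa using hs s'
  eps s x hx := by
    rw [List.append_nil]
    exact h3 s x hx

theorem mem_padClosure_of_span {x : X} (hx : x ∈ Submodule.span (KLR k D μ) (W : Set X)) :
    x ∈ padClosure D μ [] W := by
  induction hx using Submodule.span_induction with
  | mem x hx => exact le_padClosure _ _ hx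
  | zero => exact zero_mem _
  | add x y _ _ h h' => exact add_mem h h'
  | smul r x _ h =>
    refine smul_mem_of_gen _ (fun g x hx => ?_) r h
    have := padClosure_stable (D := D) (μ := μ) [] W g x hx
    have e : g.pad [] [] = g := by cases g <;> simp [Diagram.pad]
    rwa [e] at this

/-- The form of the shuffle lemma on which both the irreducibility of `Δ` and the uniqueness of the
maximal graded submodule depend. -/
theorem IsBlock.idem₂_smul_mem (h : IsBlock D μ i n [] W) (ν : Multiset I) {x : X}
    (hx : x ∈ Submodule.span (KLR k D μ) (W : Set X)) :
    idem₂ k D ν (Multiset.replicate n i) μ • x ∈ W := by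
  rw [idem₂, seqOf_replicate, Finset.sum_smul]
  refine sum_mem fun s _ => ?_
  have := h.idem_smul_mem s (mem_padClosure_of_span hx)
  rw [List.append_nil] at this
  rwa [Finset.sum_singleton]

end Juxtaposition

end KLR

/-! ### Graded submodules and heads -/

namespace GrMod

open KLR Diagram

section Generic

variable {k : Type u} [Field k] {A : Type v} [Ring A] [Algebra k A]

theorem isHomogeneous_span_of_isGraded {𝒜 : ℤ → Submodule k A} (hA : iSup 𝒜 = ⊤)
    {M : GrMod.{u, v, w} k A} (hM : M.IsGraded 𝒜) {S : Submodule k M.carrier}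
    (hS : S ≤ ⨆ d, S ⊓ M.deg d) : M.IsHomogeneous (Submodule.span A (S : Set M.carrier)) := by
  set N := Submodule.span A (S : Set M.carrier) with hN
  set H := ⨆ d, N.restrictScalars k ⊓ M.deg d with hH
  refine le_antisymm ?_ (iSup_le fun d => inf_le_left)
  have hl : ∀ a : A, ∀ e ∈ H, a • e ∈ H := by
    intro a e he
    obtain ⟨s, f, hf, rfl⟩ := exists_sum_components hA a
    rw [Finset.sum_smul]
    refine sum_mem fun c _ => ?_
    have : H ≤ H.comap (Algebra.lsmul k k M.carrier (f c)) := by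
      refine iSup_le fun d => ?_
      rintro e ⟨he, hd⟩
      exact Submodule.mem_iSup_of_mem (c + d) ⟨N.smul_mem _ he, hM.2 c d _ (hf c) e hd⟩
    exact this he
  intro e he
  induction (show e ∈ N from he) using Submodule.span_induction with
  | mem e he' =>
    have : S ≤ H := hS.trans (iSup_mono fun d => inf_le_inf_right _ fun e he =>
      Submodule.subset_span he)
    exact this he'
  | zero => exact zero_mem _
  | add e e' h1 h2 h h' => exact add_mem (h h1) (h' h2)
  | smul c e h1 h => exact hl c e (h h1)

/-- A graded module with a unique maximal graded submodule, the kernel of a surjection of degree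
zero, has the target of the surjection as its head. -/
theorem iso_head {X : GrMod.{u, v, w} k A} {M : GrMod.{u, v, w'} k A}
    (φ : X.carrier →ₗ[A] M.carrier) (hX : iSup X.deg = ⊤) (hM : iSupIndep M.deg)
    (hφ : ∀ d, ∀ x ∈ X.deg d, φ x ∈ M.deg d) (hsurj : Function.Surjective φ)
    [Nontrivial M.carrier]
    (hmax : ∀ W, X.IsHomogeneous W → W ≠ ⊤ → W ≤ LinearMap.ker φ) : M.Iso X.head := by
  have hker : X.IsHomogeneous (LinearMap.ker φ) := by
    refine le_antisymm ?_ (iSup_le fun d => inf_le_left)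
    refine CompClosed.le_iSup ?_ hX
    have h : (LinearMap.ker φ).restrictScalars k = LinearMap.ker (φ.restrictScalars k) := rfl
    rw [h]
    exact compClosed_ker hM _ 0 fun d x hx => by rw [add_zero]; exact hφ d x hx
  have hker' : LinearMap.ker φ ≠ ⊤ := by
    intro h
    obtain ⟨m, hm⟩ := exists_ne (0 : M.carrier)
    obtain ⟨x, rfl⟩ := hsurj m
    have hx : x ∈ LinearMap.ker φ := h ▸ Submodule.mem_top
    exact hm hx
  -- All proper graded submodules lie in the kernel, which is itself proper and graded, so it is the
  -- only maximal one.
  have hrad : X.grRadical = LinearMap.ker φ := by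
    refine le_antisymm (sInf_le ⟨hker, hker', fun W hW hlt => ?_⟩) (le_sInf fun W hW => ?_)
    · by_contra hne
      exact absurd (hmax W hW hne) (not_le_of_gt hlt)
    · rcases (hmax W hW.1 hW.2.1).lt_or_eq with hlt | heq
      · exact absurd (hW.2.2 _ hker hlt) hker'
      · exact heq.ge
  let e : X.head.carrier ≃ₗ[A] M.carrier :=
    (Submodule.quotEquivOfEq _ _ hrad).trans (φ.quotKerEquivOfSurjective hsurj)
  have he : ∀ d, ∀ x ∈ X.head.deg d, e x ∈ M.deg d := by
    rintro d _ ⟨x, hx, rfl⟩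
    exact hφ d x hx
  have htop : iSup X.head.deg = ⊤ := by
    change (⨆ d, (X.deg d).map (X.grRadical.mkQ.restrictScalars k)) = ⊤
    rw [← Submodule.map_iSup, hX, Submodule.map_top]
    exact LinearMap.range_eq_top.2 X.grRadical.mkQ_surjective
  refine ⟨e.symm, fun d m => ?_⟩
  obtain ⟨x, rfl⟩ := e.surjective m
  rw [LinearEquiv.symm_apply_apply]
  exact ⟨fun h => mem_of_map_mem htop hM (e.toLinearMap.restrictScalars k) he e.injective h,
    he d x⟩

end Generic

/-! ### The function `ε_i` -/

section Eps

variable {k : Type u} [Field k] {I : Type v} [DecidableEq I] {D : BorcherdsCartanDatum I}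
variable {ν : Multiset I} {M : GrMod.{u, max u v, w} k (KLR k D ν)} {i : I} {n : ℕ}

/-- Removes the truncated subtraction `ν - ni` from the definition: a nonzero idempotent on `s i^n`
has weight `ν`, and then the subtraction is exact. -/
theorem nontrivial_delta_iff : Nontrivial (delta i n M).carrier ↔
    ∃ s, ∃ m : M.carrier, gen (k := k) (D := D) ν (.idem (s ++ List.replicate n i)) • m ≠ 0 := by
  constructor
  · intro h
    obtain ⟨⟨_, m, rfl⟩, hm⟩ := exists_ne (0 : (delta i n M).carrier)
    have hm' : idem₂ k D (ν - Multiset.replicate n i) (Multiset.replicate n i) ν • m ≠ 0 :=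
      fun h0 => hm (Subtype.ext h0)
    rw [idem₂, seqOf_replicate, Finset.sum_smul] at hm'
    obtain ⟨s, -, hs⟩ := Finset.exists_ne_zero_of_sum_ne_zero hm'
    rw [Finset.sum_singleton] at hs
    exact ⟨s, m, hs⟩
  · rintro ⟨s, m, hm⟩
    have hmem : s ++ List.replicate n i ∈ SeqOf ν := by
      by_contra h
      rw [gen_idem_eq_zero h, zero_smul] at hm
      exact hm rfl
    have hs : s ∈ SeqOf (ν - Multiset.replicate n i) := by
      rw [mem_seqOf] at hmem ⊢
      rw [← hmem, ← Multiset.coe_add, Multiset.coe_replicate, add_tsub_cancel_right]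
    refine ⟨⟨gen (k := k) (D := D) ν (.idem (s ++ List.replicate n i)) • m,
      gen (k := k) (D := D) ν (.idem (s ++ List.replicate n i)) • m, ?_⟩, 0,
      fun h => hm (congrArg Subtype.val h)⟩
    change idem₂ k D _ _ ν • gen (k := k) (D := D) ν (.idem (s ++ List.replicate n i)) • m = _
    rw [smul_smul, idem₂_mul_idem hs replicate_mem_seqOf]

/-- Boundedness makes `eps` a true maximum; the supremum of an unbounded set of naturals would be
the default value `0`. -/
theorem bddAbove_eps : BddAbove {n : ℕ | Nontrivial (delta i n M).carrier} := by
  refine ⟨ν.card, fun n hn => ?_⟩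
  obtain ⟨s, m, hm⟩ := nontrivial_delta_iff.1 hn
  by_contra h
  rw [gen_idem_eq_zero, zero_smul] at hm
  · exact hm rfl
  · rw [mem_seqOf]
    rintro rfl
    simp at h

theorem le_eps {s : List I} {m : M.carrier}
    (hm : gen (k := k) (D := D) ν (.idem (s ++ List.replicate n i)) • m ≠ 0) : n ≤ M.eps i :=
  le_csSup bddAbove_eps (nontrivial_delta_iff.2 ⟨s, m, hm⟩)

theorem smul_eq_zero_of_eps_lt (h : M.eps i < n) (s : List I) (m : M.carrier) :
    gen (k := k) (D := D) ν (.idem (s ++ List.replicate n i)) • m = 0 := by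
  by_contra hm
  exact absurd (le_eps hm) (not_le.2 h)

theorem nontrivial_delta_eps [Nontrivial M.carrier] : Nontrivial (delta i (M.eps i) M).carrier := by
  refine Nat.sSup_mem (s := {n : ℕ | Nontrivial (delta i n M).carrier}) ⟨0, ?_⟩ bddAbove_eps
  refine nontrivial_delta_iff.2 ?_
  obtain ⟨m, hm⟩ := exists_ne (0 : M.carrier)
  rw [← one_smul (KLR k D ν) m, ← sum_idem, Finset.sum_smul] at hm
  obtain ⟨s, -, hs⟩ := Finset.exists_ne_zero_of_sum_ne_zero hm
  exact ⟨s, m, by simpa using hs⟩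

theorem sub_add_of_nontrivial_delta (h : Nontrivial (delta i n M).carrier) :
    ν - Multiset.replicate n i + Multiset.replicate n i = ν := by
  obtain ⟨s, m, hm⟩ := nontrivial_delta_iff.1 h
  by_contra hne
  rw [gen_idem_eq_zero, zero_smul] at hm
  · exact hm rfl
  · rw [mem_seqOf]
    rintro rfl
    rw [← Multiset.coe_add, Multiset.coe_replicate, add_tsub_cancel_right] at hne
    exact hne rfl

end Eps

end GrMod

theorem map_le_iSup_inf {k : Type u} [Field k] {E : Type v} [AddCommGroup E] [Module k E]
    {F : Type w} [AddCommGroup F] [Module k F] {𝓜 : ℤ → Submodule k E} {𝓝 : ℤ → Submodule k F}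
    (φ : E →ₗ[k] F) (hφ : ∀ d, ∀ e ∈ 𝓜 d, φ e ∈ 𝓝 d) {S : Submodule k E}
    (hS : S ≤ ⨆ d, S ⊓ 𝓜 d) : S.map φ ≤ ⨆ d, S.map φ ⊓ 𝓝 d := by
  refine (Submodule.map_mono hS).trans ?_
  rw [Submodule.map_iSup]
  refine iSup_mono fun d => ?_
  rintro _ ⟨e, ⟨he, hd⟩, rfl⟩
  exact ⟨⟨e, he, rfl⟩, hφ d e hd⟩

/-! ### Irreducibility and factorisation of the restriction -/

namespace GrMod

open KLR Diagram

section Restriction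

variable {k : Type u} [Field k] {I : Type v} [DecidableEq I] {D : BorcherdsCartanDatum I}
variable {ν ν' μ : Multiset I} {M : GrMod.{u, max u v, w} k (KLR k D μ)} {i : I} {n : ℕ}

/-- The inclusion of `1_{ν,ν'} M` in `M`. -/
noncomputable def resIncl (ν ν' : Multiset I) (M : GrMod.{u, max u v, w} k (KLR k D μ)) :
    (res ν ν' M).carrier →ₗ[k] M.carrier := (resSpace ν ν' M).subtype

theorem resIncl_injective : Function.Injective (resIncl ν ν' M) := Subtype.val_injective

theorem resIncl_smul (c : KLR k D ν ⊗[k] KLR k D ν') (e : (res ν ν' M).carrier) :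
    resIncl ν ν' M (c • e) = juxt k D ν ν' μ c • resIncl ν ν' M e := rfl

theorem idem₂_smul_resIncl (e : (res ν ν' M).carrier) :
    idem₂ k D ν ν' μ • resIncl ν ν' M e = resIncl ν ν' M e := by
  rw [← juxt_one, ← resIncl_smul, one_smul]

theorem resIncl_mem_deg (d : ℤ) (e : (res ν ν' M).carrier) (he : e ∈ (res ν ν' M).deg d) :
    resIncl ν ν' M e ∈ M.deg d := he

theorem isBigraded_res (hM : M.IsGraded (grading k D μ)) :
    IsBigraded (grading k D ν) (grading k D ν') (res ν ν' M) where
  internal := isInternal_comap hM.1 (by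
    -- As the kernel of the degree-zero element `1 - 1_{ν,ν'}`, the subspace contains the components
    -- of its vectors.
    have h : resSpace ν ν' M =
        LinearMap.ker (Algebra.lsmul k k M.carrier (1 - idem₂ k D ν ν' μ)) := by
      ext m
      constructor
      · rintro ⟨m, rfl⟩
        change (1 - idem₂ k D ν ν' μ) • idem₂ k D ν ν' μ • m = 0
        rw [sub_smul, one_smul, smul_smul, ← juxt_one, ← juxt_mul, one_mul, sub_self]
      · intro h
        change (1 - idem₂ k D ν ν' μ) • m = 0 at h
        rw [sub_smul, one_smul, sub_eq_zero] at h
        exact ⟨m, h.symm⟩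
    rw [h]
    refine (compClosed_ker hM.1.submodule_iSupIndep _ 0 fun d e he => ?_).le_iSup
      hM.1.submodule_iSup_eq_top
    rw [add_comm]
    exact hM.2 0 d _ (sub_mem one_mem_grading idem₂_mem_grading) e he)
  left c d a ha e he := by
    change juxt k D ν ν' μ (a ⊗ₜ 1) • e.1 ∈ M.deg (c + d)
    rw [juxt_tmul_one]
    exact hM.2 c d _ (padL_mem_grading ha) _ he
  right c d b hb e he := by
    change juxt k D ν ν' μ (1 ⊗ₜ b) • e.1 ∈ M.deg (c + d)
    rw [juxt_one_tmul]
    exact hM.2 c d _ (padR_mem_grading hb) _ he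

/-- A nonzero graded submodule `W` is a block in `M`, since no sequence of `M` ends in `i^{n+1}`. It
generates `M`, so every vector of the restriction lies in `1_{μ-ni,ni} R(μ) W`, hence in `W` by the
shuffle lemma. -/
theorem delta_irreducible (hM : M.IsIrr) (hn : M.eps i = n) : (M.delta i n).GrIrreducible := by
  obtain ⟨hgr, -, hnt, hirr⟩ := hM
  have hΔ : Nontrivial (delta i n M).carrier := hn ▸ nontrivial_delta_eps
  refine ⟨hΔ, fun W hW => or_iff_not_imp_left.2 fun hW0 => ?_⟩
  have hν := sub_add_of_nontrivial_delta hΔ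
  set N := (W.restrictScalars k).map (resIncl _ _ M) with hN
  have hblock : IsBlock D μ i n [] N := by
    refine isBlock_of_juxt_stable hν ?_ ?_ ?_
    · rintro c _ ⟨e, he, rfl⟩
      exact ⟨c • e, W.smul_mem c he, rfl⟩
    · rintro _ ⟨e, -, rfl⟩
      exact idem₂_smul_resIncl e
    · exact fun s x _ => smul_eq_zero_of_eps_lt (by omega) s x
  have hhom : N ≤ ⨆ d, N ⊓ M.deg d := map_le_iSup_inf _ resIncl_mem_deg (hW.le)
  rcases hirr _ (isHomogeneous_span_of_isGraded (iSup_grading μ) hgr hhom) with h | h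
  · refine absurd ((Submodule.eq_bot_iff _).2 fun e he => ?_) hW0
    have : resIncl _ _ M e ∈ Submodule.span (KLR k D μ) (N : Set M.carrier) :=
      Submodule.subset_span ⟨e, he, rfl⟩
    rw [h, Submodule.mem_bot] at this
    exact resIncl_injective (this.trans (map_zero _).symm)
  · rw [eq_top_iff]
    rintro e -
    have : resIncl _ _ M e ∈ Submodule.span (KLR k D μ) (N : Set M.carrier) :=
      h ▸ Submodule.mem_top
    obtain ⟨e', he', h'⟩ := hblock.idem₂_smul_mem (μ - Multiset.replicate n i) this
    exact resIncl_injective (h'.trans (idem₂_smul_resIncl e)) ▸ he'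

/-- A sequence of the first factor ending in `i^N` becomes a sequence of `M` ending in `i^{N+n}`,
and `n` is maximal. -/
theorem eps_ann_delta (hn : M.eps i = n) (J : Ideal (KLR k D (Multiset.replicate n i)))
    (hν : μ - Multiset.replicate n i + Multiset.replicate n i = μ)
    [Nontrivial (ann (M.delta i n) J).carrier] : (ann (M.delta i n) J).eps i = 0 := by
  obtain ⟨s, e, he⟩ := nontrivial_delta_iff.1
    (nontrivial_delta_eps (M := ann (M.delta i n) J) (i := i))
  set N := (ann (M.delta i n) J).eps i
  have h : resIncl _ _ M (annIncl (M.delta i n) J (gen (k := k) (D := D) (μ - Multiset.replicate n i)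
      (.idem (s ++ List.replicate N i)) • e)) =
      gen (k := k) (D := D) μ (.idem (s ++ List.replicate (N + n) i)) •
        resIncl _ _ M (annIncl (M.delta i n) J e) := by
    rw [annIncl_smul]
    refine (resIncl_smul _ _).trans ?_
    rw [juxt_gen_tmul_one hν, pad_idem, List.nil_append, List.append_assoc,
      List.replicate_append_replicate]
  have := le_eps (n := N + n) (i := i) (s := s)
    (m := resIncl _ _ M (annIncl (M.delta i n) J e)) fun h0 => he (by
      rw [h0] at h
      exact annIncl_injective _ J ((resIncl_injective (h.trans (map_zero _).symm)).trans
        (map_zero _).symm))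
  omega

/-- `V k D i n` unfolds to the cyclic module of `trivIdeal k D i n`, so the factor `K` is `ann` of
that ideal. -/
theorem exists_delta_iso_outer (hM : M.IsIrr) (hn : M.eps i = n) :
    ∃ K : GrMod.{u, max u v, w} k (KLR k D (μ - Multiset.replicate n i)),
      K.IsIrr ∧ K.eps i = 0 ∧ (M.delta i n).Iso (K.outer (V k D i n)) := by
  have hirr := delta_irreducible hM hn
  have hE : IsBigraded (grading k D _) (grading k D _) (M.delta i n) := isBigraded_res hM.1
  have := hM.2.1
  have : Module.Finite k (M.delta i n).carrier :=
    Module.Finite.of_injective (resIncl _ _ M) resIncl_injective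
  have := hirr.1
  have hne := annSpace_trivIdeal_ne_bot hE
  have hK := ann_irreducible hE (iSup_grading _) (iSup_grading _) rfl trivIdeal_homogeneous hirr hne
    (annMap_injective (E := M.delta i n))
  have : Nontrivial (ann (M.delta i n) (trivIdeal k D i n)).carrier := hK.1
  exact ⟨ann (M.delta i n) (trivIdeal k D i n),
    ⟨ann_isGraded hE rfl trivIdeal_homogeneous,
      Module.Finite.of_injective (annIncl _ _) (annIncl_injective _ _), hK⟩,
    eps_ann_delta hn _ (sub_add_of_nontrivial_delta hirr.1),
    iso_ann_outer hE (iSup_grading _) (iSup_grading _) rfl trivIdeal_homogeneous hirr hne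
      annMap_injective⟩

end Restriction

/-! ### Induced modules and Frobenius reciprocity -/

section Induction

variable {k : Type u} [Field k] {I : Type v} [DecidableEq I] {D : BorcherdsCartanDatum I}
variable {ν ν' μ : Multiset I}
  {N : GrMod.{u, max u v, w} k (KLR k D ν ⊗[k] KLR k D ν')} {i : I} {n : ℕ}

/-- The class of `r ⊗ u` in the induced module. -/
noncomputable def indMk (μ : Multiset I) (N : GrMod.{u, max u v, w} k (KLR k D ν ⊗[k] KLR k D ν')) :
    KLR k D μ →ₗ[k] N.carrier →ₗ[k] (ind μ N).carrier :=
  (TensorProduct.mk k (KLR k D μ) N.carrier).compr₂ ((indRel μ N).mkQ.restrictScalars k)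

theorem smul_indMk (r r' : KLR k D μ) (u : N.carrier) :
    r • indMk μ N r' u = indMk μ N (r * r') u := rfl

theorem indMk_mul_juxt (r : KLR k D μ) (c : KLR k D ν ⊗[k] KLR k D ν') (u : N.carrier) :
    indMk μ N (r * juxt k D ν ν' μ c) u = indMk μ N r (c • u) :=
  (Submodule.Quotient.eq _).2 (Submodule.subset_span ⟨r, c, u, rfl⟩)

/-- Equivariance of `u ↦ 1 ⊗ u`, whose image is the block that generates the induced module. -/
theorem juxt_smul_indMk_one (c : KLR k D ν ⊗[k] KLR k D ν') (u : N.carrier) :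
    juxt k D ν ν' μ c • indMk μ N 1 u = indMk μ N 1 (c • u) := by
  rw [smul_indMk, mul_one, ← indMk_mul_juxt, one_mul]

theorem ind_induction {p : (ind μ N).carrier → Prop} (zero : p 0) (mk : ∀ r u, p (indMk μ N r u))
    (add : ∀ z z', p z → p z' → p (z + z')) (z) : p z := by
  obtain ⟨z, rfl⟩ := (indRel μ N).mkQ_surjective z
  induction z using TensorProduct.induction_on with
  | zero => exact zero
  | tmul r u => exact mk r u
  | add z z' h h' => exact add _ _ h h'

theorem indMk_mem_deg {a b : ℤ} {r : KLR k D μ} {u : N.carrier} (hr : r ∈ grading k D μ a)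
    (hu : u ∈ N.deg b) : indMk μ N r u ∈ (ind μ N).deg (a + b) :=
  Submodule.subset_span (R := k) (M := (ind μ N).carrier) ⟨a, b, rfl, r, hr, u, hu, rfl⟩

theorem iSup_ind_deg (hN : iSup N.deg = ⊤) : iSup (ind μ N).deg = ⊤ := by
  rw [eq_top_iff]
  rintro z -
  induction z using ind_induction with
  | zero => exact Submodule.zero_mem _
  | add z z' h h' => exact Submodule.add_mem _ h h'
  | mk r u =>
    obtain ⟨s, f, hf, rfl⟩ := exists_sum_components (iSup_grading (k := k) (D := D) μ) r
    obtain ⟨s', f', hf', rfl⟩ := exists_sum_components hN u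
    rw [map_sum (indMk μ N), LinearMap.sum_apply]
    refine Submodule.sum_mem _ fun c _ => ?_
    rw [map_sum]
    exact Submodule.sum_mem _ fun d _ => Submodule.mem_iSup_of_mem (c + d)
      (indMk_mem_deg (hf c) (hf' d))

section Lift

variable {X : Type w'} [AddCommGroup X] [Module k X] [Module (KLR k D μ) X]
  [IsScalarTower k (KLR k D μ) X] (f : N.carrier →ₗ[k] X)
  (hf : ∀ c u, f (c • u) = juxt k D ν ν' μ c • f u)

/-- Frobenius reciprocity: the map `r ⊗ u ↦ r f(u)`. -/
noncomputable def indLift : (ind μ N).carrier →ₗ[KLR k D μ] X :=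
  (indRel μ N).liftQ
    (TensorProduct.AlgebraTensorModule.lift (LinearMap.toSpanSingleton (KLR k D μ) _ f))
    (by
      refine Submodule.span_le.2 ?_
      rintro _ ⟨r, c, u, rfl⟩
      change TensorProduct.AlgebraTensorModule.lift _ _ = _
      rw [map_sub, TensorProduct.AlgebraTensorModule.lift_tmul,
        TensorProduct.AlgebraTensorModule.lift_tmul]
      change (r * juxt k D ν ν' μ c) • f u - r • f (c • u) = 0
      rw [hf, mul_smul, sub_self])

theorem indLift_mk (r : KLR k D μ) (u : N.carrier) : indLift f hf (indMk μ N r u) = r • f u := rfl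

theorem indLift_mk_one (u : N.carrier) : indLift f hf (indMk μ N 1 u) = f u :=
  (indLift_mk f hf 1 u).trans (one_smul _ _)

end Lift

variable {M : GrMod.{u, max u v, w'} k (KLR k D μ)}

theorem indLift_mem_deg (hM : M.IsGraded (grading k D μ)) (f : N.carrier →ₗ[k] M.carrier)
    (hf : ∀ c u, f (c • u) = juxt k D ν ν' μ c • f u) (hdeg : ∀ d, ∀ u ∈ N.deg d, f u ∈ M.deg d)
    (d : ℤ) (z : (ind μ N).carrier) (hz : z ∈ (ind μ N).deg d) : indLift f hf z ∈ M.deg d := by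
  have : (ind μ N).deg d ≤ (M.deg d).comap ((indLift f hf).restrictScalars k) := by
    refine Submodule.span_le.2 ?_
    rintro _ ⟨a, b, rfl, r, hr, u, hu, rfl⟩
    exact hM.2 a b r hr _ (hdeg b u hu)
  exact this hz

end Induction

/-! ### The unique maximal graded submodule of an induced module -/

section InductionHead

variable {k : Type u} [Field k] {I : Type v} [DecidableEq I] {D : BorcherdsCartanDatum I}
variable {ν μ : Multiset I} {i : I} {n : ℕ}
  {N : GrMod.{u, max u v, w} k (KLR k D ν ⊗[k] KLR k D (Multiset.replicate n i))}
  {M : GrMod.{u, max u v, w'} k (KLR k D μ)}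

/-- The vectors `1 ⊗ u` form a block that generates the induced module. Suppose a graded submodule
`W` maps onto `M`, and let `z ∈ W` map to `f u`. By the shuffle lemma `1_{ν,ni} z` has the form `1 ⊗
u'`, and `f u' = f u`, so `u' = u` and `1 ⊗ u ∈ W`. Hence `W` is everything, and all proper graded
submodules lie in the kernel of `indLift`. -/
theorem iso_head_ind (hν : ν + Multiset.replicate n i = μ) (hM : M.IsIrr) [Nontrivial N.carrier]
    (hN : iSup N.deg = ⊤)
    (heps : ∀ s u, gen (k := k) (D := D) μ (.idem (s ++ List.replicate (n + 1) i)) •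
      indMk μ N 1 u = 0)
    (f : N.carrier →ₗ[k] M.carrier)
    (hf : ∀ c u, f (c • u) = juxt k D ν (Multiset.replicate n i) μ c • f u)
    (hdeg : ∀ d, ∀ u ∈ N.deg d, f u ∈ M.deg d) (hinj : Function.Injective f) :
    M.Iso (ind μ N).head := by
  obtain ⟨hgr, -, hnt, hirr⟩ := hM
  have htop := iSup_ind_deg (μ := μ) hN
  have hblock : IsBlock D μ i n [] (LinearMap.range (indMk μ N 1)) := by
    refine isBlock_of_juxt_stable hν ?_ ?_ ?_
    · rintro c _ ⟨u, rfl⟩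
      exact ⟨c • u, (juxt_smul_indMk_one c u).symm⟩
    · rintro _ ⟨u, rfl⟩
      rw [← juxt_one, juxt_smul_indMk_one, one_smul]
    · rintro s _ ⟨u, rfl⟩
      exact heps s u
  have hspan : ∀ z, z ∈ Submodule.span (KLR k D μ)
      (LinearMap.range (indMk μ N 1) : Set (ind μ N).carrier) := by
    intro z
    induction z using ind_induction with
    | zero => exact Submodule.zero_mem _
    | add z z' h h' => exact Submodule.add_mem _ h h'
    | mk r u =>
      rw [← mul_one r, ← smul_indMk]
      exact Submodule.smul_mem _ r (Submodule.subset_span ⟨u, rfl⟩)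
  have hdich : ∀ W, (ind μ N).IsHomogeneous W →
      W.map (indLift f hf) = ⊥ ∨ W.map (indLift f hf) = ⊤ := fun W hW =>
    hirr _ (le_antisymm (map_le_iSup_inf ((indLift f hf).restrictScalars k)
      (indLift_mem_deg hgr f hf hdeg) hW.le) (iSup_le fun d => inf_le_left))
  refine iso_head (indLift f hf) htop hgr.1.submodule_iSupIndep (indLift_mem_deg hgr f hf hdeg)
    ?_ fun W hW hne => ?_
  · have hhom : (ind μ N).IsHomogeneous ⊤ := by
      rw [IsHomogeneous, Submodule.restrictScalars_top]
      simpa using htop.symm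
    rcases hdich ⊤ hhom with h | h
    · obtain ⟨u, hu⟩ := exists_ne (0 : N.carrier)
      refine absurd (hinj (((indLift_mk_one f hf u).symm.trans ?_).trans (map_zero f).symm)) hu
      rw [← Submodule.mem_bot (KLR k D μ), ← h]
      exact ⟨_, Submodule.mem_top, rfl⟩
    · rwa [Submodule.map_top, LinearMap.range_eq_top] at h
  · rcases hdich W hW with h | h
    · exact LinearMap.le_ker_iff_map.2 h
    · refine absurd (eq_top_iff.2 fun z _ => ?_) hne
      have hle : Submodule.span (KLR k D μ)
          (LinearMap.range (indMk μ N 1) : Set (ind μ N).carrier) ≤ W := by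
        refine Submodule.span_le.2 ?_
        rintro _ ⟨u, rfl⟩
        obtain ⟨z, hz, hzu⟩ : f u ∈ W.map (indLift f hf) := h ▸ Submodule.mem_top
        obtain ⟨u', hu'⟩ := hblock.idem₂_smul_mem ν (hspan z)
        have : f u' = f u := by
          rw [← indLift_mk_one f hf, hu', map_smul, hzu, ← juxt_one, ← hf, one_smul]
        rw [← hinj this, SetLike.mem_coe, hu']
        exact W.smul_mem _ hz
      exact hle (hspan z)

/-- Of the last `n + 1` strands `i`, the first belongs to `K`, which has no sequence ending in `i`.
-/
theorem idem_smul_indMk_one_eq_zero (hν : ν + Multiset.replicate n i = μ)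
    {K : GrMod.{u, max u v, w} k (KLR k D ν)} (hK : K.eps i = 0)
    (L : GrMod.{u, max u v, w'} k (KLR k D (Multiset.replicate n i))) (s : List I)
    (u : (K.outer L).carrier) :
    gen (k := k) (D := D) μ (.idem (s ++ List.replicate (n + 1) i)) •
      indMk μ (K.outer L) 1 u = 0 := by
  have h : gen (k := k) (D := D) μ (.idem (s ++ List.replicate (n + 1) i)) =
      juxt k D ν (Multiset.replicate n i) μ (gen ν (.idem (s ++ List.replicate 1 i)) ⊗ₜ 1) := by
    rw [juxt_gen_tmul_one hν, pad_idem, List.nil_append, List.append_assoc,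
      List.replicate_append_replicate, add_comm]
  rw [h, juxt_smul_indMk_one]
  refine (congrArg _ ?_).trans (map_zero _)
  induction u using outer_induction with
  | zero => exact smul_zero _
  | add z z' h h' => rw [smul_add, h, h', add_zero]
  | mk m l =>
    rw [tmul_smul_outerMk, smul_eq_zero_of_eps_lt (by omega), map_zero, LinearMap.zero_apply]

end InductionHead

end GrMod

theorem mainTheorem12 {k : Type u} [Field k] [IsAlgClosed k] {I : Type v} [Fintype I]
    [DecidableEq I] (D : BorcherdsCartanDatum I) (ν : Multiset I) (i : I) (n : ℕ)
    (M : GrMod.{u, max u v, w} k (KLR k D ν)) (hM : M.IsIrr) (hn : M.eps i = n) :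
    (∃ K : GrMod.{u, max u v, w} k (KLR k D (ν - Multiset.replicate n i)),
      K.IsIrr ∧ K.eps i = 0 ∧ (M.delta i n).Iso (K.outer (GrMod.V k D i n))) ∧
    (∀ K : GrMod.{u, max u v, w} k (KLR k D (ν - Multiset.replicate n i)),
      K.IsIrr → K.eps i = 0 → (M.delta i n).Iso (K.outer (GrMod.V k D i n)) →
        M.Iso (GrMod.ind ν (K.outer (GrMod.V k D i n))).head) := by
  refine ⟨GrMod.exists_delta_iso_outer hM hn, fun K hK hK0 ⟨e, he⟩ => ?_⟩
  have hΔ := (GrMod.delta_irreducible hM hn).1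
  have hν := GrMod.sub_add_of_nontrivial_delta hΔ
  have : Nontrivial (K.outer (GrMod.V k D i n)).carrier := e.symm.toEquiv.nontrivial
  refine GrMod.iso_head_ind hν hM
    (GrMod.iSup_outer_deg hK.1.1.submodule_iSup_eq_top
      (GrMod.iSup_cyclic_deg _ (GrMod.iSup_grading _)))
    (GrMod.idem_smul_indMk_one_eq_zero hν hK0 _)
    -- Frobenius reciprocity is applied to the inverse of the given isomorphism followed by the
    -- inclusion of `Δ_{i^n} M` in `M`.
    (GrMod.resIncl _ _ M ∘ₗ e.symm.toLinearMap.restrictScalars k) (fun c u => ?_)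
    (fun d u hu => ?_) (GrMod.resIncl_injective.comp e.symm.injective)
  · exact (congrArg (GrMod.resIncl _ _ M) (e.symm.map_smul c u)).trans (GrMod.resIncl_smul c _)
  · exact (he d (e.symm u)).2 (by rwa [e.apply_symm_apply])
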